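/- **Theorem.** Let $M$ be a connected Riemann surface and let $f\colon M\to S^3\subset\mathbb R^4$ be a smooth conformal immersion whose image is not contained in a round 2-sphere. Suppose that the Schwarzian derivative of $f$ is holomorphic. Then $f$ is a cyclide of Dupin. *Schwarzian derivative.* Let $\langle v,w\rangle=-v_0w_0+\sum_{k=1}^4v_kw_k$ be the Lorentz form on $\mathbb R^{4,1}$, extended complex bilinearly to $\mathbb C^5$; $S^3$ is identified with the projectivized light cone by $x\leftrightarrow[1:x]$. For a holomorphic coordinate $z$ on an open subset of $M$ write $|df|^2=e^{2u}|dz|^2$, let $\psi=e^{-u}(1,f)$ (the lift of $f$ with $|d\psi|^2=|dz|^2$) and $V=\operatorname{span}\{\psi,\psi_z,\psi_{\bar z},\psi_{z\bar z}\}\subset\mathbb C^5$. The Schwarzian derivative $S_z(f)$ is the complex function $c$ determined by $$\psi_{zz}+\tfrac c2\,\psi\in V^\perp .$$ The Schwarzian of $f$ is *holomorphic* if $S_z(f)$ is a holomorphic function for every holomorphic coordinate $z$. *Cyclide of Dupin.* The map $f$ is a cyclide of Dupin (a homogeneous surface) if it parametrizes an open piece of a two-dimensional orbit of a two-parameter group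 of Möbius transformations, that is: there are commuting $A,B\in\mathfrak{so}(4,1)$ and $x\in S^3$ such that the orbit map $\Phi\colon\mathbb R^2\to S^3$, $[1:\Phi(s,t)]=[\exp(sA+tB)(1,x)]$, is an immersion and $f(M)=\Phi(W)$ for some open set $W\subset\mathbb R^2$. -/

import Mathlib

open scoped Manifold ContDiff

noncomputable section

/-- The unit sphere `S³ ⊆ ℝ⁴`. -/
abbrev S3 : Type := Metric.sphere (0 : EuclideanSpace ℝ (Fin 4)) 1

/-- The Lorentz form `⟨v, w⟩ = -v₀w₀ + ∑_{k=1}^{4} v_k w_k`. For `R = ℝ` this is Minkowski space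
`ℝ^{4,1}`, for `R = ℂ` the complex bilinear extension to its complexification. -/
def lorentz {R : Type*} [CommRing R] (v w : Fin 5 → R) : R :=
  -(v 0 * w 0) + ∑ k : Fin 4, v k.succ * w k.succ

/-- The Euclidean lift `x ↦ (1, x)`; for `x ∈ S³` it spans the null line `[1 : x]`
that corresponds to `x`. -/
def euclideanLift (x : EuclideanSpace ℝ (Fin 4)) : Fin 5 → ℝ :=
  Fin.cons 1 fun k => x k

/-- The point of `S³` that corresponds to the null line of a non-zero null vector `v`
(such a vector has `v₀ ≠ 0`), i.e. the inverse of `x ↦ [1 : x]`. -/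
def lightConePoint (v : Fin 5 → ℝ) : EuclideanSpace ℝ (Fin 4) :=
  WithLp.toLp 2 fun k => v k.succ / v 0

/-- The (round) 2-spheres of `S³`: projectivized light cones of the hyperplanes of `ℝ^{4,1}`
orthogonal to a space-like vector `n`. -/
def IsTwoSphere (S : Set S3) : Prop :=
  ∃ n : Fin 5 → ℝ, 0 < lorentz n n ∧ S = {x : S3 | lorentz n (euclideanLift x) = 0}

section Wirtinger

variable {E : Type*} [NormedAddCommGroup E] [NormedSpace ℂ E]

/-- `∂g/∂z = (g_x - i g_y) / 2`. -/
def dz (g : ℂ → E) (z : ℂ) : E :=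
  (1 / 2 : ℂ) • (fderiv ℝ g z 1 - Complex.I • fderiv ℝ g z Complex.I)

/-- `∂g/∂z̄ = (g_x + i g_y) / 2`. -/
def dzbar (g : ℂ → E) (z : ℂ) : E :=
  (1 / 2 : ℂ) • (fderiv ℝ g z 1 + Complex.I • fderiv ℝ g z Complex.I)

end Wirtinger

/-- The normalized lift `ψ = e^{-u} (1, g)` of a conformal immersion `g` of a domain of `ℂ` into
`S³ ⊆ ℝ⁴`, where `|dg|² = e^{2u} |dz|²` (so that `e^u = |g_x|`). It is the positive multiple
of `(1, g)` with `|dψ|² = |dz|²`. It is regarded as a map into the complexification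
of `ℝ^{4,1}`. -/
def normalizedLift (g : ℂ → EuclideanSpace ℝ (Fin 4)) (z : ℂ) : Fin 5 → ℂ :=
  fun k => ((‖fderiv ℝ g z 1‖⁻¹ * euclideanLift (g z) k : ℝ) : ℂ)

/-- The complexified fibre `V ⊗ ℂ = span {ψ, ψ_z, ψ_z̄, ψ_{z z̄}}` of the mean curvature sphere
congruence at `z`. -/
def centralSphere (g : ℂ → EuclideanSpace ℝ (Fin 4)) (z : ℂ) : Submodule ℂ (Fin 5 → ℂ) :=
  Submodule.span ℂ {normalizedLift g z, dz (normalizedLift g) z, dzbar (normalizedLift g) z,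
    dz (dzbar (normalizedLift g)) z}

/-- `c` is the Schwarzian derivative on `U` of the conformal immersion `g : U → S³`:
`ψ_{zz} + (c/2) ψ = κ` with `κ` a section of `V^⊥ ⊗ ℂ`. -/
def IsSchwarzianOn (g : ℂ → EuclideanSpace ℝ (Fin 4)) (U : Set ℂ) (c : ℂ → ℂ) : Prop :=
  ∀ z ∈ U, ∀ v ∈ centralSphere g z,
    lorentz (dz (dz (normalizedLift g)) z + (c z / 2) • normalizedLift g z) v = 0

section Surface

variable {M : Type*} [TopologicalSpace M] [ChartedSpace ℂ M]

/-- The holomorphic coordinates `z : M ⊇ U → ℂ` of a Riemann surface. -/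
def holomorphicCoordinates (M : Type*) [TopologicalSpace M] [ChartedSpace ℂ M] :
    Set (OpenPartialHomeomorph M ℂ) :=
  IsManifold.maximalAtlas 𝓘(ℂ, ℂ) ω M

/-- The map `f : M → S³ ⊆ ℝ⁴` written in the coordinate `e`. -/
def inCoordinate (f : M → S3) (e : OpenPartialHomeomorph M ℂ) (z : ℂ) :
    EuclideanSpace ℝ (Fin 4) :=
  (f (e.symm z) : EuclideanSpace ℝ (Fin 4))

/-- Smooth conformal immersions of a Riemann surface into `S³`: in every holomorphic coordinate
the differential is everywhere a non-zero multiple of a linear isometry. -/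
def IsConformalImmersion (f : M → S3) : Prop :=
  ContMDiff 𝓘(ℝ, ℂ) (𝓡 3) ∞ f ∧
    ∀ e ∈ holomorphicCoordinates M, ∀ z ∈ e.target, ConformalAt (inCoordinate f e) z

/-- In every holomorphic coordinate `z` the Schwarzian `S_z(f)` is a holomorphic function. -/
def HasHolomorphicSchwarzian (f : M → S3) : Prop :=
  ∀ e ∈ holomorphicCoordinates M, ∃ c : ℂ → ℂ,
    IsSchwarzianOn (inCoordinate f e) e.target c ∧ DifferentiableOn ℂ c e.target

end Surface

/-- The Lie algebra `so(4,1)` of the Lorentz group. -/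
def IsInfinitesimalLorentz (A : Matrix (Fin 5) (Fin 5) ℝ) : Prop :=
  ∀ v w : Fin 5 → ℝ, lorentz (A.mulVec v) w + lorentz v (A.mulVec w) = 0

/-- The orbit map `(s, t) ↦ exp(sA + tB) · x` of the Möbius transformations of `S³` induced by
the Lorentz transformations `exp(sA + tB)`. -/
def orbitMap (A B : Matrix (Fin 5) (Fin 5) ℝ) (x : S3) (q : ℝ × ℝ) : EuclideanSpace ℝ (Fin 4) :=
  lightConePoint
    ((NormedSpace.exp (q.1 • A + q.2 • B)).mulVec (euclideanLift x))

/-- `f` is a cyclide of Dupin, i.e. a homogeneous surface: `f` parametrizes an open piece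
(the image of an open set `W` of parameters) of a two-dimensional orbit of a two-parameter group
`{exp(sA + tB)}`, `A` and `B` commuting, of Möbius transformations. -/
def IsCyclideOfDupin {M : Type*} (f : M → S3) : Prop :=
  ∃ A B : Matrix (Fin 5) (Fin 5) ℝ,
    IsInfinitesimalLorentz A ∧ IsInfinitesimalLorentz B ∧ Commute A B ∧
    ∃ x : S3,
      (∀ q : ℝ × ℝ, Function.Injective (fderiv ℝ (orbitMap A B x) q)) ∧
      ∃ W : Set (ℝ × ℝ), IsOpen W ∧
        Set.range (fun p : M => (f p : EuclideanSpace ℝ (Fin 4))) = orbitMap A B x '' W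

end

/-! The surface is studied through the moving frame ψ, ψ_z, ψ_z̄, ψ_{zz̄} and the normal part κ =
ψ_zz + (c/2)ψ of ψ_zz. All pairings of the first four vectors are constant, except ⟨ψ_{zz̄},
ψ_{zz̄}⟩ = ⟨κ, κ̄⟩. Their orthogonal complement is a line, so ⟨κ, κ̄⟩ = |⟨κ, κ⟩|. The Gauss equation
(`gauss`) expresses c_z̄ through κ and its derivatives. If c is holomorphic, its conjugate says that
⟨κ, κ⟩⟨κ, κ̄⟩ = ⟨κ, κ⟩|⟨κ, κ⟩| is holomorphic (`wdb_quartic`), and this function transforms as a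
quartic differential (`quartic_comp`).

Where the quartic differential is non-zero, a fourth root θ dz = dw gives a flat coordinate w = s +
it in which ⟨κ, κ⟩ = 1. Then κ is real, integrability makes c real (`conj_schwarzian`), and a real
holomorphic c is constant. The frame now solves dF = F (A ds + B dt) with constant matrices
satisfying AB = BA = 0 (`fderiv_frameVec`). Hence F = F₀ exp(sA + tB) (`realFrame_eq`), and the
surface is locally an orbit of the group generated by F₀AF₀⁻¹ and F₀BF₀⁻¹
(`orbitMap_eq_orbitPoint`).

The quartic differential has no zeros. If it vanishes near a point, then κ = 0 there, the space V is
parallel, and the surface lies in a 2-sphere, first locally and then globally by connectedness; this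
is excluded. An isolated zero cannot occur either (`quartic_ne_zero`): on a disc with the zero on
its boundary w is bounded, so the frame is bounded. But the lift normalized for w is |θ|ψ, and its
pairing -1/2 with the bounded frame vector ψ_{ww̄} keeps |θ| away from zero.

Globally, two flat coordinates differ by a fourth root of unity and a translation, and orbit maps
are real analytic. So a homogeneous parametrization with fixed F₀ and c continues from disc to disc
over the connected surface (`isOrbitCoordinateAt_extend`). The flat coordinate need not be
single-valued on M; the values of all its branches form the open parameter set of the orbit. -/

open Complex Set Metric Filter Topology
open scoped ComplexConjugate

noncomputable section

/-! ### Wirtinger calculus for smooth maps of plane domains -/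

section WirtingerCalculus

variable {E : Type*} [NormedAddCommGroup E] [NormedSpace ℂ E]

theorem fderiv_apply_eq_dz_add_dzbar (F : ℂ → E) (z v : ℂ) :
    fderiv ℝ F z v = v • dz F z + conj v • dzbar F z := by
  have hv : v = v.re • (1 : ℂ) + v.im • I := by
    simp [Complex.re_add_im]
  have h1 : fderiv ℝ F z v = v.re • fderiv ℝ F z 1 + v.im • fderiv ℝ F z I := by
    conv_lhs => rw [hv]
    rw [map_add, map_smul, map_smul]
  have h2 : conj v = v.re - v.im * I := by
    apply Complex.ext <;> simp
  rw [h1, h2, dz, dzbar]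
  conv_rhs => rw [← Complex.re_add_im v]
  simp only [← Complex.coe_smul, smul_add, smul_sub, smul_smul, add_re, ofReal_re, mul_re,
    ofReal_im, I_re, I_im, add_im, mul_im]
  match_scalars <;> ring_nf <;> simp

theorem dz_congr {F G : ℂ → E} {U : Set ℂ} (hU : IsOpen U) (h : EqOn F G U) {z : ℂ}
    (hz : z ∈ U) : dz F z = dz G z := by
  have : F =ᶠ[𝓝 z] G := h.eventuallyEq_of_mem (hU.mem_nhds hz)
  rw [dz, dz, this.fderiv_eq]

theorem dzbar_congr {F G : ℂ → E} {U : Set ℂ} (hU : IsOpen U) (h : EqOn F G U) {z : ℂ}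
    (hz : z ∈ U) : dzbar F z = dzbar G z := by
  have : F =ᶠ[𝓝 z] G := h.eventuallyEq_of_mem (hU.mem_nhds hz)
  rw [dzbar, dzbar, this.fderiv_eq]

theorem dz_add {F G : ℂ → E} {z : ℂ} (hF : DifferentiableAt ℝ F z)
    (hG : DifferentiableAt ℝ G z) : dz (fun y => F y + G y) z = dz F z + dz G z := by
  simp only [dz, fderiv_fun_add hF hG, add_apply]
  module

theorem dzbar_add {F G : ℂ → E} {z : ℂ} (hF : DifferentiableAt ℝ F z)
    (hG : DifferentiableAt ℝ G z) : dzbar (fun y => F y + G y) z = dzbar F z + dzbar G z := by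
  simp only [dzbar, fderiv_fun_add hF hG, add_apply]
  module

theorem dz_smul {f : ℂ → ℂ} {F : ℂ → E} {z : ℂ} (hf : DifferentiableAt ℝ f z)
    (hF : DifferentiableAt ℝ F z) :
    dz (fun y => f y • F y) z = dz f z • F z + f z • dz F z := by
  simp only [dz, fderiv_fun_smul hf hF, add_apply,
    smul_apply, ContinuousLinearMap.smulRight_apply, smul_eq_mul]
  module

theorem dzbar_smul {f : ℂ → ℂ} {F : ℂ → E} {z : ℂ} (hf : DifferentiableAt ℝ f z)
    (hF : DifferentiableAt ℝ F z) :
    dzbar (fun y => f y • F y) z = dzbar f z • F z + f z • dzbar F z := by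
  simp only [dzbar, fderiv_fun_smul hf hF, add_apply,
    smul_apply, ContinuousLinearMap.smulRight_apply, smul_eq_mul]
  module

theorem dz_const (a : E) (z : ℂ) : dz (fun _ => a) z = 0 := by
  simp [dz]

theorem dzbar_const (a : E) (z : ℂ) : dzbar (fun _ => a) z = 0 := by
  simp [dzbar]

theorem fderiv_of_holomorphic {f : ℂ → E} {z : ℂ} (hf : DifferentiableAt ℂ f z) (v : ℂ) :
    fderiv ℝ f z v = v • deriv f z := by
  have := (hf.hasDerivAt.hasFDerivAt.restrictScalars ℝ).fderiv
  rw [this]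
  simp

theorem dzbar_of_holomorphic {f : ℂ → E} {z : ℂ} (hf : DifferentiableAt ℂ f z) :
    dzbar f z = 0 := by
  rw [dzbar, fderiv_of_holomorphic hf, fderiv_of_holomorphic hf, one_smul, smul_smul, I_mul_I]
  module

/-- Without its conjugate-linear part, the real differential is multiplication by `dz f z`, hence
complex linear. -/
theorem differentiableAt_of_dzbar_eq_zero {f : ℂ → ℂ} {z : ℂ} (hf : DifferentiableAt ℝ f z)
    (h : dzbar f z = 0) : DifferentiableAt ℂ f z := by
  have h2 : HasFDerivAt f ((ContinuousLinearMap.smulRight (1 : ℂ →L[ℂ] ℂ) (dz f z))) z := by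
    have h3 : HasFDerivAt f (fderiv ℝ f z) z := hf.hasFDerivAt
    rw [hasFDerivAt_iff_isLittleO_nhds_zero] at h3 ⊢
    refine h3.congr_left fun v => ?_
    rw [fderiv_apply_eq_dz_add_dzbar, h]
    simp
  exact h2.differentiableAt

theorem contDiffOn_fderiv_apply {F : ℂ → E} {U : Set ℂ} (hU : IsOpen U)
    (hF : ContDiffOn ℝ ∞ F U) (v : ℂ) : ContDiffOn ℝ ∞ (fun z => fderiv ℝ F z v) U :=
  (hF.fderiv_of_isOpen hU (m := ∞) (by simp)).clm_apply contDiffOn_const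

theorem contDiffOn_dz {F : ℂ → E} {U : Set ℂ} (hU : IsOpen U) (hF : ContDiffOn ℝ ∞ F U) :
    ContDiffOn ℝ ∞ (dz F) U := by
  unfold dz
  exact contDiffOn_const.smul ((contDiffOn_fderiv_apply hU hF 1).sub
    (contDiffOn_const.smul (contDiffOn_fderiv_apply hU hF I)))

theorem contDiffOn_dzbar {F : ℂ → E} {U : Set ℂ} (hU : IsOpen U) (hF : ContDiffOn ℝ ∞ F U) :
    ContDiffOn ℝ ∞ (dzbar F) U := by
  unfold dzbar
  exact contDiffOn_const.smul ((contDiffOn_fderiv_apply hU hF 1).add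
    (contDiffOn_const.smul (contDiffOn_fderiv_apply hU hF I)))

theorem ContDiffOn.differentiableAt_of_isOpen {F : ℂ → E} {U : Set ℂ}
    (hF : ContDiffOn ℝ ∞ F U) (hU : IsOpen U) {z : ℂ} (hz : z ∈ U) : DifferentiableAt ℝ F z :=
  (hF.contDiffAt (hU.mem_nhds hz)).differentiableAt (by simp)

theorem dz_dzbar_comm {F : ℂ → E} {U : Set ℂ} (hU : IsOpen U) (hF : ContDiffOn ℝ ∞ F U)
    {z : ℂ} (hz : z ∈ U) : dz (dzbar F) z = dzbar (dz F) z := by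
  have hd : DifferentiableAt ℝ (fderiv ℝ F) z :=
    ((hF.fderiv_of_isOpen hU (m := ∞) (by simp)).contDiffAt (hU.mem_nhds hz)).differentiableAt
      (by simp)
  have happ (v w : ℂ) : fderiv ℝ (fun y => fderiv ℝ F y v) z w
      = fderiv ℝ (fderiv ℝ F) z w v := by
    rw [fderiv_clm_apply hd (differentiableAt_const v)]
    simp
  have hdv (v : ℂ) : DifferentiableAt ℝ (fun y => fderiv ℝ F y v) z :=
    hd.clm_apply (differentiableAt_const v)
  have hsymm : fderiv ℝ (fderiv ℝ F) z 1 I = fderiv ℝ (fderiv ℝ F) z I 1 :=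
    (hF.contDiffAt (hU.mem_nhds hz)).isSymmSndFDerivAt
      (by simp only [minSmoothness_of_isRCLikeNormedField]; exact WithTop.coe_le_coe.2 le_top) 1 I
  have f1 (w : ℂ) : fderiv ℝ (dzbar F) z w = (1 / 2 : ℂ) •
      (fderiv ℝ (fderiv ℝ F) z w 1 + I • fderiv ℝ (fderiv ℝ F) z w I) := by
    have h : HasFDerivAt (dzbar F) _ z := ((hdv 1).hasFDerivAt.add
      ((hdv I).hasFDerivAt.const_smul I)).const_smul (1 / 2 : ℂ)
    rw [h.fderiv]
    simp [happ]
  have f2 (w : ℂ) : fderiv ℝ (dz F) z w = (1 / 2 : ℂ) •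
      (fderiv ℝ (fderiv ℝ F) z w 1 - I • fderiv ℝ (fderiv ℝ F) z w I) := by
    have h : HasFDerivAt (dz F) _ z := ((hdv 1).hasFDerivAt.sub
      ((hdv I).hasFDerivAt.const_smul I)).const_smul (1 / 2 : ℂ)
    rw [h.fderiv]
    simp [happ]
  rw [dz, dzbar, f1, f1, f2, f2, hsymm]
  module

end WirtingerCalculus

theorem dz_apply {ι : Type*} [Fintype ι] {F : ℂ → ι → ℂ} {z : ℂ} (hF : DifferentiableAt ℝ F z)
    (i : ι) : dz F z i = dz (fun y => F y i) z := by
  have h (v : ℂ) : fderiv ℝ (fun y => F y i) z v = fderiv ℝ F z v i := by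
    rw [fderiv_pi (differentiableAt_pi.1 hF)]; rfl
  simp [dz, h]

theorem dzbar_apply {ι : Type*} [Fintype ι] {F : ℂ → ι → ℂ} {z : ℂ}
    (hF : DifferentiableAt ℝ F z) (i : ι) : dzbar F z i = dzbar (fun y => F y i) z := by
  have h (v : ℂ) : fderiv ℝ (fun y => F y i) z v = fderiv ℝ F z v i := by
    rw [fderiv_pi (differentiableAt_pi.1 hF)]; rfl
  simp [dzbar, h]

theorem fderiv_conj {f : ℂ → ℂ} {z : ℂ} (hf : DifferentiableAt ℝ f z) (v : ℂ) :
    fderiv ℝ (fun y => conj (f y)) z v = conj (fderiv ℝ f z v) := by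
  have := (conjCLE.toContinuousLinearMap.hasFDerivAt (x := f z)).comp z hf.hasFDerivAt
  have h2 : HasFDerivAt (fun y => conj (f y)) _ z := this
  rw [h2.fderiv]
  simp

theorem dz_conj {f : ℂ → ℂ} {z : ℂ} (hf : DifferentiableAt ℝ f z) :
    dz (fun y => conj (f y)) z = conj (dzbar f z) := by
  simp [dz, dzbar, fderiv_conj hf, sub_eq_add_neg, Complex.conj_ofNat]

theorem dzbar_conj {f : ℂ → ℂ} {z : ℂ} (hf : DifferentiableAt ℝ f z) :
    dzbar (fun y => conj (f y)) z = conj (dz f z) := by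
  simp [dz, dzbar, fderiv_conj hf, sub_eq_add_neg, Complex.conj_ofNat]

theorem contDiffOn_conj {f : ℂ → ℂ} {U : Set ℂ} (hf : ContDiffOn ℝ ∞ f U) :
    ContDiffOn ℝ ∞ (fun y => conj (f y)) U :=
  conjCLE.contDiff.comp_contDiffOn hf

theorem contDiffOn_real_of_holomorphic {f : ℂ → ℂ} {U : Set ℂ} (hU : IsOpen U)
    (hf : DifferentiableOn ℂ f U) : ContDiffOn ℝ ∞ f U :=
  (hf.contDiffOn hU).restrict_scalars ℝ

/-! ### The Lorentz form and null frames -/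

section LorentzAlgebra

variable {R : Type*} [CommRing R]

theorem lorentz_eq (v w : Fin 5 → R) :
    lorentz v w = -(v 0 * w 0) + v 1 * w 1 + v 2 * w 2 + v 3 * w 3 + v 4 * w 4 := by
  simp [lorentz, Fin.sum_univ_four]
  ring_nf

theorem lorentz_comm (v w : Fin 5 → R) : lorentz v w = lorentz w v := by
  simp only [lorentz_eq]; ring

theorem lorentz_add_left (u v w : Fin 5 → R) :
    lorentz (u + v) w = lorentz u w + lorentz v w := by
  simp only [lorentz_eq, Pi.add_apply]; ring

theorem lorentz_add_right (u v w : Fin 5 → R) :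
    lorentz w (u + v) = lorentz w u + lorentz w v := by
  simp only [lorentz_eq, Pi.add_apply]; ring

theorem lorentz_sub_left (u v w : Fin 5 → R) :
    lorentz (u - v) w = lorentz u w - lorentz v w := by
  simp only [lorentz_eq, Pi.sub_apply]; ring

theorem lorentz_sub_right (u v w : Fin 5 → R) :
    lorentz w (u - v) = lorentz w u - lorentz w v := by
  simp only [lorentz_eq, Pi.sub_apply]; ring

theorem lorentz_smul_left (a : R) (v w : Fin 5 → R) :
    lorentz (a • v) w = a * lorentz v w := by
  simp only [lorentz_eq, Pi.smul_apply, smul_eq_mul]; ring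

theorem lorentz_smul_right (a : R) (v w : Fin 5 → R) :
    lorentz w (a • v) = a * lorentz w v := by
  simp only [lorentz_eq, Pi.smul_apply, smul_eq_mul]; ring

theorem lorentz_zero_left (w : Fin 5 → R) : lorentz 0 w = 0 := by
  simp [lorentz_eq]

theorem lorentz_zero_right (w : Fin 5 → R) : lorentz w 0 = 0 := by
  simp [lorentz_eq]

theorem lorentz_star (v w : Fin 5 → ℂ) : lorentz (star v) (star w) = conj (lorentz v w) := by
  simp [lorentz_eq]

theorem eq_zero_of_lorentz_eq_zero {v : Fin 5 → R} (h : ∀ w, lorentz v w = 0) : v = 0 := by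
  funext i
  have := h (Pi.single i 1)
  fin_cases i <;> simpa [lorentz_eq, Pi.single_apply] using this

end LorentzAlgebra

theorem eq_zero_of_lorentz_basis {K : Type*} [Field K] {b : Fin 5 → Fin 5 → K}
    (hb : LinearIndependent K b) {v : Fin 5 → K} (h : ∀ i, lorentz v (b i) = 0) : v = 0 := by
  refine eq_zero_of_lorentz_eq_zero fun w => ?_
  have hw : w ∈ Submodule.span K (Set.range b) := by
    rw [hb.span_eq_top_of_card_eq_finrank' (by simp)]; trivial
  induction hw using Submodule.span_induction with
  | mem x hx => obtain ⟨i, rfl⟩ := hx; exact h i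
  | zero => exact lorentz_zero_right _
  | add x y _ _ hx hy => rw [lorentz_add_right, hx, hy, add_zero]
  | smul a x _ hx => rw [lorentz_smul_right, hx, mul_zero]

/-- The pairings of `ψ, ψ_z, ψ_z̄, ψ_{z z̄}` for a normalized lift `ψ`. -/
structure IsNullFrame (p q q' n : Fin 5 → ℂ) : Prop where
  pp : lorentz p p = 0
  pq : lorentz p q = 0
  pq' : lorentz p q' = 0
  pn : lorentz p n = -1 / 2
  qq : lorentz q q = 0
  qq' : lorentz q q' = 1 / 2
  q'q' : lorentz q' q' = 0
  qn : lorentz q n = 0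
  q'n : lorentz q' n = 0

namespace IsNullFrame

variable {p q q' n : Fin 5 → ℂ} (h : IsNullFrame p q q' n)
include h

/-- The pairing of `n` with itself is not prescribed. Pairing with `p` isolates `d`, so the unknown
⟨n, n⟩ has disappeared when pairing with `n` determines `a`. -/
theorem coeff_eq_zero {a b b' d : ℂ} {x : Fin 5 → ℂ} (hxp : lorentz p x = 0)
    (hxq : lorentz q x = 0) (hxq' : lorentz q' x = 0) (hxn : lorentz n x = 0)
    (h0 : a • p + b • q + b' • q' + d • n + x = 0) :
    a = 0 ∧ b = 0 ∧ b' = 0 ∧ d = 0 ∧ x = 0 := by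
  have e1 := congrArg (lorentz p) h0
  have e2 := congrArg (lorentz q) h0
  have e3 := congrArg (lorentz q') h0
  have e4 := congrArg (lorentz n) h0
  simp only [lorentz_add_right, lorentz_smul_right, lorentz_zero_right, h.pp, h.pq, h.pq', h.pn,
    lorentz_comm q p, lorentz_comm q' p, lorentz_comm n p, lorentz_comm q' q, lorentz_comm n q,
    lorentz_comm n q', h.qq, h.qq', h.q'q', h.qn, h.q'n, hxp, hxq, hxq', hxn] at e1 e2 e3 e4
  have hd : d = 0 := by linear_combination -2 * e1
  have hb' : b' = 0 := by linear_combination 2 * e2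
  have hb : b = 0 := by linear_combination 2 * e3
  have ha : a = 0 := by subst hd; linear_combination -2 * e4
  subst hd hb' hb ha
  simpa using h0

theorem linearIndependent {x : Fin 5 → ℂ} (hx0 : x ≠ 0) (hxp : lorentz p x = 0)
    (hxq : lorentz q x = 0) (hxq' : lorentz q' x = 0) (hxn : lorentz n x = 0) :
    LinearIndependent ℂ ![p, q, q', n, x] := by
  rw [Fintype.linearIndependent_iff]
  intro g hg
  simp only [Fin.sum_univ_five] at hg
  have hg' : g 0 • p + g 1 • q + g 2 • q' + g 3 • n + g 4 • x = 0 := hg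
  obtain ⟨h0, h1, h2, h3, h4⟩ := h.coeff_eq_zero (x := g 4 • x)
    (by rw [lorentz_smul_right, hxp, mul_zero]) (by rw [lorentz_smul_right, hxq, mul_zero])
    (by rw [lorentz_smul_right, hxq', mul_zero]) (by rw [lorentz_smul_right, hxn, mul_zero]) hg'
  have h4' := (smul_eq_zero.1 h4).resolve_right hx0
  intro i
  fin_cases i <;> assumption

theorem eq_zero_of_orthogonal {x v : Fin 5 → ℂ} (hx0 : x ≠ 0) (hxp : lorentz p x = 0)
    (hxq : lorentz q x = 0) (hxq' : lorentz q' x = 0) (hxn : lorentz n x = 0)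
    (hvp : lorentz v p = 0) (hvq : lorentz v q = 0) (hvq' : lorentz v q' = 0)
    (hvn : lorentz v n = 0) (hvx : lorentz v x = 0) : v = 0 := by
  refine eq_zero_of_lorentz_basis (h.linearIndependent hx0 hxp hxq hxq' hxn) fun i => ?_
  fin_cases i <;> assumption

/-- Four linear conditions on five coordinates have a non-zero solution. It is not null, since
otherwise it would be orthogonal to a whole basis, so a complex square root normalizes it. The
orthogonal complement of the frame is thus a line, which turns pairings of normal parts into
products of scalars. -/
theorem exists_unit_normal : ∃ ξ : Fin 5 → ℂ, lorentz ξ ξ = 1 ∧ lorentz ξ p = 0 ∧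
    lorentz ξ q = 0 ∧ lorentz ξ q' = 0 ∧ lorentz ξ n = 0 ∧
    ∀ v, lorentz v p = 0 → lorentz v q = 0 → lorentz v q' = 0 → lorentz v n = 0 →
      v = lorentz v ξ • ξ := by
  obtain ⟨x, hx0, hx⟩ : ∃ x : Fin 5 → ℂ, x ≠ 0 ∧ ∀ i, lorentz (![p, q, q', n] i) x = 0 := by
    let T : (Fin 5 → ℂ) →ₗ[ℂ] (Fin 4 → ℂ) :=
      { toFun := fun x i => lorentz (![p, q, q', n] i) x
        map_add' := fun x y => funext fun i => lorentz_add_right _ _ _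
        map_smul' := fun a x => funext fun i => lorentz_smul_right _ _ _ }
    obtain ⟨x, hx, hx0⟩ := (Submodule.ne_bot_iff _).1
      (LinearMap.ker_ne_bot_of_finrank_lt (f := T) (by simp))
    exact ⟨x, hx0, fun i => congrFun (LinearMap.mem_ker.1 hx) i⟩
  have hxp : lorentz p x = 0 := hx 0
  have hxq : lorentz q x = 0 := hx 1
  have hxq' : lorentz q' x = 0 := hx 2
  have hxn : lorentz n x = 0 := hx 3
  have hxx : lorentz x x ≠ 0 := by
    intro hxx
    refine hx0 (h.eq_zero_of_orthogonal hx0 hxp hxq hxq' hxn ?_ ?_ ?_ ?_ hxx) <;>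
      rwa [lorentz_comm]
  obtain ⟨r, hr⟩ := IsAlgClosed.exists_pow_nat_eq (lorentz x x) (n := 2) (by norm_num)
  have hr0 : r ≠ 0 := by rintro rfl; apply hxx; rw [← hr]; simp
  have e : ∀ y, lorentz (r⁻¹ • x) y = r⁻¹ * lorentz x y := lorentz_smul_left _ _
  have hunit : lorentz (r⁻¹ • x) (r⁻¹ • x) = 1 := by
    rw [e, lorentz_smul_right, ← hr]; field_simp
  have hyp : lorentz (r⁻¹ • x) p = 0 := by rw [e, lorentz_comm, hxp, mul_zero]
  have hyq : lorentz (r⁻¹ • x) q = 0 := by rw [e, lorentz_comm, hxq, mul_zero]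
  have hyq' : lorentz (r⁻¹ • x) q' = 0 := by rw [e, lorentz_comm, hxq', mul_zero]
  have hyn : lorentz (r⁻¹ • x) n = 0 := by rw [e, lorentz_comm, hxn, mul_zero]
  refine ⟨r⁻¹ • x, hunit, hyp, hyq, hyq', hyn, fun v hp hq hq' hn => ?_⟩
  rw [← sub_eq_zero]
  set y := r⁻¹ • x
  refine h.eq_zero_of_orthogonal (x := y) ?_ (by rw [lorentz_comm, hyp])
    (by rw [lorentz_comm, hyq]) (by rw [lorentz_comm, hyq']) (by rw [lorentz_comm, hyn])
    ?_ ?_ ?_ ?_ ?_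
  · intro h0; rw [h0, lorentz_zero_left] at hunit; exact zero_ne_one hunit
  · rw [lorentz_sub_left, lorentz_smul_left, hp, hyp]; ring
  · rw [lorentz_sub_left, lorentz_smul_left, hq, hyq]; ring
  · rw [lorentz_sub_left, lorentz_smul_left, hq', hyq']; ring
  · rw [lorentz_sub_left, lorentz_smul_left, hn, hyn]; ring
  · rw [lorentz_sub_left, lorentz_smul_left, hunit]; ring

end IsNullFrame

theorem eq_zero_of_null {v : Fin 5 → ℝ} (h : lorentz v v = 0) (h0 : v 0 = 0) : v = 0 := by
  rw [lorentz, h0, mul_zero, neg_zero, zero_add,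
    Finset.sum_eq_zero_iff_of_nonneg fun k _ => mul_self_nonneg _] at h
  funext i
  refine Fin.cases h0 (fun k => ?_) i
  exact mul_self_eq_zero.1 (h k (Finset.mem_univ k))

theorem lorentz_ofReal (v w : Fin 5 → ℝ) :
    lorentz (fun i => (v i : ℂ)) (fun i => (w i : ℂ)) = (lorentz v w : ℝ) := by
  simp [lorentz]

/-- Vectors orthogonal to a real null vector have non-negative length. -/
theorem sum_sq_le_of_lorentz_eq_zero {p : Fin 5 → ℂ} (hreal : star p = p) (hp0 : p 0 ≠ 0)
    (hpp : lorentz p p = 0) {v : Fin 5 → ℂ} (hv : lorentz v p = 0) :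
    0 ≤ (lorentz v (star v)).re := by
  have hpr (i : Fin 5) : ((p i).re : ℂ) = p i := by
    have := congrFun hreal i
    exact Complex.conj_eq_iff_re.1 this
  obtain ⟨r, hr⟩ : ∃ r : Fin 5 → ℝ, ∀ i, p i = r i := ⟨fun i => (p i).re, fun i => (hpr i).symm⟩
  have hr0 : r 0 ≠ 0 := by intro h; apply hp0; rw [hr, h]; simp
  have hrr : r 0 ^ 2 = ∑ k : Fin 4, r k.succ ^ 2 := by
    rw [lorentz] at hpp
    simp only [hr] at hpp
    have : -(r 0 * r 0) + ∑ k : Fin 4, r k.succ * r k.succ = 0 := by exact_mod_cast hpp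
    simp only [pow_two]; linarith
  have hvn : v 0 * r 0 = ∑ k : Fin 4, v k.succ * r k.succ := by
    rw [lorentz] at hv
    simp only [hr] at hv
    linear_combination -hv
  -- Cauchy–Schwarz for the spatial parts; the spatial norm of `r` is `|r 0|` because `r` is null.
  have hcs : ‖v 0‖ ^ 2 * r 0 ^ 2 ≤ (∑ k : Fin 4, ‖v k.succ‖ ^ 2) * r 0 ^ 2 := by
    calc ‖v 0‖ ^ 2 * r 0 ^ 2 = ‖v 0 * r 0‖ ^ 2 := by
          rw [norm_mul, mul_pow, Complex.norm_real, Real.norm_eq_abs, sq_abs]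
      _ ≤ (∑ k : Fin 4, ‖v k.succ‖ * |r k.succ|) ^ 2 := by
          rw [hvn]
          gcongr
          refine (norm_sum_le _ _).trans_eq (Finset.sum_congr rfl fun k _ => ?_)
          rw [norm_mul, Complex.norm_real, Real.norm_eq_abs]
      _ ≤ (∑ k : Fin 4, ‖v k.succ‖ ^ 2) * ∑ k : Fin 4, |r k.succ| ^ 2 :=
          Finset.sum_mul_sq_le_sq_mul_sq _ _ _
      _ = _ := by simp only [sq_abs, hrr]
  have hle := le_of_mul_le_mul_right hcs (by positivity)
  have : lorentz v (star v) = ((-‖v 0‖ ^ 2 + ∑ k : Fin 4, ‖v k.succ‖ ^ 2 : ℝ) : ℂ) := by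
    simp only [lorentz, Pi.star_apply, RCLike.star_def, Complex.mul_conj']
    push_cast
    ring
  rw [this, ofReal_re]
  linarith

theorem fderiv_lorentz {F G : ℂ → Fin 5 → ℂ} {z : ℂ} (hF : DifferentiableAt ℝ F z)
    (hG : DifferentiableAt ℝ G z) (v : ℂ) :
    fderiv ℝ (fun y => lorentz (F y) (G y)) z v =
      lorentz (fderiv ℝ F z v) (G z) + lorentz (F z) (fderiv ℝ G z v) := by
  have hF' := hasFDerivAt_pi'.1 hF.hasFDerivAt
  have hG' := hasFDerivAt_pi'.1 hG.hasFDerivAt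
  have h : HasFDerivAt (fun y => lorentz (F y) (G y)) _ z :=
    ((hF' 0).mul (hG' 0)).neg.add
      (HasFDerivAt.fun_sum (u := Finset.univ) fun (k : Fin 4) _ => (hF' k.succ).mul (hG' k.succ))
  rw [h.fderiv]
  simp [lorentz, Fin.sum_univ_four]
  ring

theorem dz_lorentz {F G : ℂ → Fin 5 → ℂ} {z : ℂ} (hF : DifferentiableAt ℝ F z)
    (hG : DifferentiableAt ℝ G z) : dz (fun y => lorentz (F y) (G y)) z =
      lorentz (dz F z) (G z) + lorentz (F z) (dz G z) := by
  simp only [dz, fderiv_lorentz hF hG, lorentz_smul_left, lorentz_smul_right, lorentz_sub_left,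
    lorentz_sub_right, smul_eq_mul]
  ring

theorem dzbar_lorentz {F G : ℂ → Fin 5 → ℂ} {z : ℂ} (hF : DifferentiableAt ℝ F z)
    (hG : DifferentiableAt ℝ G z) : dzbar (fun y => lorentz (F y) (G y)) z =
      lorentz (dzbar F z) (G z) + lorentz (F z) (dzbar G z) := by
  simp only [dzbar, fderiv_lorentz hF hG, lorentz_smul_left, lorentz_smul_right,
    lorentz_add_left, lorentz_add_right, smul_eq_mul]
  ring

theorem contDiffOn_lorentz {F G : ℂ → Fin 5 → ℂ} {U : Set ℂ} (hF : ContDiffOn ℝ ∞ F U)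
    (hG : ContDiffOn ℝ ∞ G U) : ContDiffOn ℝ ∞ (fun y => lorentz (F y) (G y)) U := by
  have hF' := contDiffOn_pi.1 hF
  have hG' := contDiffOn_pi.1 hG
  exact ((hF' 0).mul (hG' 0)).neg.add
    (ContDiffOn.sum fun (k : Fin 4) _ => (hF' k.succ).mul (hG' k.succ))

/-! ### Wirtinger derivatives with respect to w, where dw = θ dz -/

section ScaledWirtinger

variable {E : Type*} [NormedAddCommGroup E] [NormedSpace ℂ E]

/-- The Wirtinger derivative `∂/∂w` for a holomorphic function `w` with `dw = θ dz`. -/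
def wd (θ : ℂ → ℂ) (F : ℂ → E) (z : ℂ) : E := (θ z)⁻¹ • dz F z

/-- The Wirtinger derivative `∂/∂w̄` for a holomorphic function `w` with `dw = θ dz`. -/
def wdb (θ : ℂ → ℂ) (F : ℂ → E) (z : ℂ) : E := (conj (θ z))⁻¹ • dzbar F z

variable {θ : ℂ → ℂ} {U : Set ℂ}

theorem fderiv_eq_wd_add_wdb {z : ℂ} (hθ : θ z ≠ 0) (F : ℂ → E) (v : ℂ) :
    fderiv ℝ F z v = (θ z * v) • wd θ F z + conj (θ z * v) • wdb θ F z := by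
  have : conj (θ z) ≠ 0 := (map_ne_zero _).2 hθ
  rw [fderiv_apply_eq_dz_add_dzbar, wd, wdb, smul_smul, smul_smul, map_mul]
  congr 2 <;> field_simp

theorem wd_congr {F G : ℂ → E} (hU : IsOpen U) (h : EqOn F G U) {z : ℂ} (hz : z ∈ U) :
    wd θ F z = wd θ G z := by
  rw [wd, wd, dz_congr hU h hz]

theorem wdb_congr {F G : ℂ → E} (hU : IsOpen U) (h : EqOn F G U) {z : ℂ} (hz : z ∈ U) :
    wdb θ F z = wdb θ G z := by
  rw [wdb, wdb, dzbar_congr hU h hz]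

theorem wd_const (a : E) (z : ℂ) : wd θ (fun _ => a) z = 0 := by
  rw [wd, dz_const, smul_zero]

theorem wdb_const (a : E) (z : ℂ) : wdb θ (fun _ => a) z = 0 := by
  rw [wdb, dzbar_const, smul_zero]

theorem wd_add {F G : ℂ → E} {z : ℂ} (hF : DifferentiableAt ℝ F z)
    (hG : DifferentiableAt ℝ G z) : wd θ (fun y => F y + G y) z = wd θ F z + wd θ G z := by
  rw [wd, wd, wd, dz_add hF hG, smul_add]

theorem wdb_add {F G : ℂ → E} {z : ℂ} (hF : DifferentiableAt ℝ F z)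
    (hG : DifferentiableAt ℝ G z) : wdb θ (fun y => F y + G y) z = wdb θ F z + wdb θ G z := by
  rw [wdb, wdb, wdb, dzbar_add hF hG, smul_add]

theorem wd_smul {f : ℂ → ℂ} {F : ℂ → E} {z : ℂ} (hf : DifferentiableAt ℝ f z)
    (hF : DifferentiableAt ℝ F z) :
    wd θ (fun y => f y • F y) z = wd θ f z • F z + f z • wd θ F z := by
  rw [wd, wd, wd, dz_smul hf hF]
  module

theorem wdb_smul {f : ℂ → ℂ} {F : ℂ → E} {z : ℂ} (hf : DifferentiableAt ℝ f z)
    (hF : DifferentiableAt ℝ F z) :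
    wdb θ (fun y => f y • F y) z = wdb θ f z • F z + f z • wdb θ F z := by
  rw [wdb, wdb, wdb, dzbar_smul hf hF]
  module

theorem contDiffOn_inv_holomorphic (hU : IsOpen U) (hθ : DifferentiableOn ℂ θ U)
    (hθ0 : ∀ z ∈ U, θ z ≠ 0) : ContDiffOn ℝ ∞ (fun z => (θ z)⁻¹) U :=
  contDiffOn_real_of_holomorphic hU (hθ.inv hθ0)

theorem contDiffOn_wd (hU : IsOpen U) (hθ : DifferentiableOn ℂ θ U) (hθ0 : ∀ z ∈ U, θ z ≠ 0)
    {F : ℂ → E} (hF : ContDiffOn ℝ ∞ F U) : ContDiffOn ℝ ∞ (wd θ F) U :=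
  (contDiffOn_inv_holomorphic hU hθ hθ0).smul (contDiffOn_dz hU hF)

theorem contDiffOn_wdb (hU : IsOpen U) (hθ : DifferentiableOn ℂ θ U) (hθ0 : ∀ z ∈ U, θ z ≠ 0)
    {F : ℂ → E} (hF : ContDiffOn ℝ ∞ F U) : ContDiffOn ℝ ∞ (wdb θ F) U := by
  have := contDiffOn_conj (contDiffOn_inv_holomorphic hU hθ hθ0)
  simp only [map_inv₀] at this
  exact this.smul (contDiffOn_dzbar hU hF)

/-- Since θ is holomorphic, its inverse passes through ∂/∂z̄ and the conjugate of its inverse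
through ∂/∂z. A primitive w of θ plays no role. -/
theorem wd_wdb_comm (hU : IsOpen U) (hθ : DifferentiableOn ℂ θ U) (hθ0 : ∀ z ∈ U, θ z ≠ 0)
    {F : ℂ → E} (hF : ContDiffOn ℝ ∞ F U) {z : ℂ} (hz : z ∈ U) :
    wd θ (wdb θ F) z = wdb θ (wd θ F) z := by
  have hi : DifferentiableAt ℂ (fun y => (θ y)⁻¹) z :=
    (hθ.inv hθ0).differentiableAt (hU.mem_nhds hz)
  have hir : DifferentiableAt ℝ (fun y => (θ y)⁻¹) z := hi.restrictScalars ℝ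
  have hic : DifferentiableAt ℝ (fun y => conj ((θ y)⁻¹)) z :=
    (contDiffOn_conj (contDiffOn_inv_holomorphic hU hθ hθ0)).differentiableAt_of_isOpen hU hz
  have e1 : wdb θ F = fun y => conj ((θ y)⁻¹) • dzbar F y := by
    funext y; rw [wdb, map_inv₀]
  have e2 : wd θ F = fun y => (θ y)⁻¹ • dz F y := rfl
  rw [wd, wdb, e1, e2, dz_smul hic ((contDiffOn_dzbar hU hF).differentiableAt_of_isOpen hU hz),
    dzbar_smul hir ((contDiffOn_dz hU hF).differentiableAt_of_isOpen hU hz), dz_conj hir,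
    dzbar_of_holomorphic hi, dz_dzbar_comm hU hF hz, map_inv₀]
  simp only [map_zero, zero_smul, zero_add, smul_smul]
  rw [mul_comm]

end ScaledWirtinger

section

variable {θ : ℂ → ℂ}

theorem wd_lorentz {F G : ℂ → Fin 5 → ℂ} {z : ℂ} (hF : DifferentiableAt ℝ F z)
    (hG : DifferentiableAt ℝ G z) : wd θ (fun y => lorentz (F y) (G y)) z =
      lorentz (wd θ F z) (G z) + lorentz (F z) (wd θ G z) := by
  rw [wd, wd, wd, dz_lorentz hF hG, lorentz_smul_left, lorentz_smul_right, smul_eq_mul]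
  ring

theorem wdb_lorentz {F G : ℂ → Fin 5 → ℂ} {z : ℂ} (hF : DifferentiableAt ℝ F z)
    (hG : DifferentiableAt ℝ G z) : wdb θ (fun y => lorentz (F y) (G y)) z =
      lorentz (wdb θ F z) (G z) + lorentz (F z) (wdb θ G z) := by
  rw [wdb, wdb, wdb, dzbar_lorentz hF hG, lorentz_smul_left, lorentz_smul_right, smul_eq_mul]
  ring

theorem wd_conj {f : ℂ → ℂ} {z : ℂ} (hf : DifferentiableAt ℝ f z) :
    wd θ (fun y => conj (f y)) z = conj (wdb θ f z) := by
  rw [wd, wdb, dz_conj hf]; simp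

theorem wdb_conj {f : ℂ → ℂ} {z : ℂ} (hf : DifferentiableAt ℝ f z) :
    wdb θ (fun y => conj (f y)) z = conj (wd θ f z) := by
  rw [wd, wdb, dzbar_conj hf]; simp

theorem differentiableAt_star {F : ℂ → Fin 5 → ℂ} {z : ℂ} (hF : DifferentiableAt ℝ F z) :
    DifferentiableAt ℝ (fun y => star (F y)) z := by
  rw [differentiableAt_pi] at hF ⊢
  exact fun i => conjCLE.toContinuousLinearMap.differentiableAt.comp z (hF i)

theorem wd_star {F : ℂ → Fin 5 → ℂ} {z : ℂ} (hF : DifferentiableAt ℝ F z) :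
    wd θ (fun y => star (F y)) z = star (wdb θ F z) := by
  funext i
  rw [wd, wdb, Pi.smul_apply, dz_apply (differentiableAt_star hF), Pi.star_apply, Pi.smul_apply,
    dzbar_apply hF]
  exact wd_conj (differentiableAt_pi.1 hF i)

theorem wdb_star {F : ℂ → Fin 5 → ℂ} {z : ℂ} (hF : DifferentiableAt ℝ F z) :
    wdb θ (fun y => star (F y)) z = star (wd θ F z) := by
  funext i
  rw [wd, wdb, Pi.smul_apply, dzbar_apply (differentiableAt_star hF), Pi.star_apply,
    Pi.smul_apply, dz_apply hF]
  exact wdb_conj (differentiableAt_pi.1 hF i)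

end

/-! ### Structure equations of a normalized lift -/

/-- `ψ` is a real light-like map on `U` with `|dψ|² = |dw|²`, where `dw = θ dz`. -/
structure IsNormalizedLift (U : Set ℂ) (θ : ℂ → ℂ) (ψ : ℂ → Fin 5 → ℂ) : Prop where
  isOpen : IsOpen U
  holo : DifferentiableOn ℂ θ U
  ne_zero : ∀ z ∈ U, θ z ≠ 0
  smooth : ContDiffOn ℝ ∞ ψ U
  real : ∀ z ∈ U, star (ψ z) = ψ z
  null : ∀ z ∈ U, lorentz (ψ z) (ψ z) = 0
  conformal : ∀ z ∈ U, lorentz (wd θ ψ z) (wd θ ψ z) = 0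
  unit : ∀ z ∈ U, lorentz (wd θ ψ z) (wdb θ ψ z) = 1 / 2

/-- The Schwarzian `c = 4 ⟨ψ_{ww}, ψ_{w w̄}⟩` of a normalized lift. -/
def liftSchwarzian (θ : ℂ → ℂ) (ψ : ℂ → Fin 5 → ℂ) (z : ℂ) : ℂ :=
  4 * lorentz (wd θ (wd θ ψ) z) (wd θ (wdb θ ψ) z)

/-- The normal part `κ = ψ_{ww} + (c/2) ψ` of `ψ_{ww}`. -/
def liftHopf (θ : ℂ → ℂ) (ψ : ℂ → Fin 5 → ℂ) (z : ℂ) : Fin 5 → ℂ :=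
  wd θ (wd θ ψ) z + (liftSchwarzian θ ψ z / 2) • ψ z

namespace IsNormalizedLift

variable {U : Set ℂ} {θ : ℂ → ℂ} {ψ : ℂ → Fin 5 → ℂ} (h : IsNormalizedLift U θ ψ)
include h

theorem smooth_wd {F : ℂ → Fin 5 → ℂ} (hF : ContDiffOn ℝ ∞ F U) : ContDiffOn ℝ ∞ (wd θ F) U :=
  contDiffOn_wd h.isOpen h.holo h.ne_zero hF

theorem smooth_wdb {F : ℂ → Fin 5 → ℂ} (hF : ContDiffOn ℝ ∞ F U) :
    ContDiffOn ℝ ∞ (wdb θ F) U :=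
  contDiffOn_wdb h.isOpen h.holo h.ne_zero hF

theorem leibniz_wd {F G : ℂ → Fin 5 → ℂ} {a : ℂ → ℂ} (hF : ContDiffOn ℝ ∞ F U)
    (hG : ContDiffOn ℝ ∞ G U) (ha : ∀ z ∈ U, lorentz (F z) (G z) = a z) {z : ℂ} (hz : z ∈ U) :
    lorentz (wd θ F z) (G z) + lorentz (F z) (wd θ G z) = wd θ a z := by
  rw [← wd_lorentz (hF.differentiableAt_of_isOpen h.isOpen hz)
    (hG.differentiableAt_of_isOpen h.isOpen hz)]
  exact wd_congr h.isOpen ha hz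

theorem leibniz_wdb {F G : ℂ → Fin 5 → ℂ} {a : ℂ → ℂ} (hF : ContDiffOn ℝ ∞ F U)
    (hG : ContDiffOn ℝ ∞ G U) (ha : ∀ z ∈ U, lorentz (F z) (G z) = a z) {z : ℂ} (hz : z ∈ U) :
    lorentz (wdb θ F z) (G z) + lorentz (F z) (wdb θ G z) = wdb θ a z := by
  rw [← wdb_lorentz (hF.differentiableAt_of_isOpen h.isOpen hz)
    (hG.differentiableAt_of_isOpen h.isOpen hz)]
  exact wdb_congr h.isOpen ha hz

theorem leibniz_wd_const {F G : ℂ → Fin 5 → ℂ} {a : ℂ} (hF : ContDiffOn ℝ ∞ F U)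
    (hG : ContDiffOn ℝ ∞ G U) (ha : ∀ z ∈ U, lorentz (F z) (G z) = a) {z : ℂ} (hz : z ∈ U) :
    lorentz (wd θ F z) (G z) = - lorentz (F z) (wd θ G z) := by
  rw [eq_neg_iff_add_eq_zero, h.leibniz_wd (a := fun _ => a) hF hG ha hz, wd_const]

theorem leibniz_wdb_const {F G : ℂ → Fin 5 → ℂ} {a : ℂ} (hF : ContDiffOn ℝ ∞ F U)
    (hG : ContDiffOn ℝ ∞ G U) (ha : ∀ z ∈ U, lorentz (F z) (G z) = a) {z : ℂ} (hz : z ∈ U) :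
    lorentz (wdb θ F z) (G z) = - lorentz (F z) (wdb θ G z) := by
  rw [eq_neg_iff_add_eq_zero, h.leibniz_wdb (a := fun _ => a) hF hG ha hz, wdb_const]

theorem star_wd {F G : ℂ → Fin 5 → ℂ} (hF : ContDiffOn ℝ ∞ F U)
    (hG : ∀ z ∈ U, star (F z) = G z) {z : ℂ} (hz : z ∈ U) : star (wd θ F z) = wdb θ G z := by
  rw [← wdb_star (hF.differentiableAt_of_isOpen h.isOpen hz)]
  exact wdb_congr h.isOpen hG hz

theorem star_wdb {F G : ℂ → Fin 5 → ℂ} (hF : ContDiffOn ℝ ∞ F U)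
    (hG : ∀ z ∈ U, star (F z) = G z) {z : ℂ} (hz : z ∈ U) : star (wdb θ F z) = wd θ G z := by
  rw [← wd_star (hF.differentiableAt_of_isOpen h.isOpen hz)]
  exact wd_congr h.isOpen hG hz

theorem comm {F : ℂ → Fin 5 → ℂ} (hF : ContDiffOn ℝ ∞ F U) {z : ℂ} (hz : z ∈ U) :
    wd θ (wdb θ F) z = wdb θ (wd θ F) z :=
  wd_wdb_comm h.isOpen h.holo h.ne_zero hF hz

theorem star_q {z : ℂ} (hz : z ∈ U) : star (wd θ ψ z) = wdb θ ψ z :=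
  h.star_wd h.smooth h.real hz

theorem star_q' {z : ℂ} (hz : z ∈ U) : star (wdb θ ψ z) = wd θ ψ z :=
  h.star_wdb h.smooth h.real hz

theorem star_k {z : ℂ} (hz : z ∈ U) : star (wd θ (wd θ ψ) z) = wdb θ (wdb θ ψ) z :=
  h.star_wd (h.smooth_wd h.smooth) (fun _ => h.star_q) hz

theorem star_k' {z : ℂ} (hz : z ∈ U) : star (wdb θ (wdb θ ψ) z) = wd θ (wd θ ψ) z :=
  h.star_wdb (h.smooth_wdb h.smooth) (fun _ => h.star_q') hz

theorem star_n {z : ℂ} (hz : z ∈ U) : star (wd θ (wdb θ ψ) z) = wd θ (wdb θ ψ) z := by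
  rw [h.star_wd (h.smooth_wdb h.smooth) (fun _ => h.star_q') hz, h.comm h.smooth hz]

/-- Every pairing is obtained by differentiating one already known to be constant, starting from
nullity, conformality and the normalization. -/
theorem isNullFrame {z : ℂ} (hz : z ∈ U) :
    IsNullFrame (ψ z) (wd θ ψ z) (wdb θ ψ z) (wd θ (wdb θ ψ) z) := by
  have sq := h.smooth_wd h.smooth
  have sq' := h.smooth_wdb h.smooth
  have pq {z} (hz : z ∈ U) : lorentz (ψ z) (wd θ ψ z) = 0 := by
    have := h.leibniz_wd_const h.smooth h.smooth h.null hz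
    rw [lorentz_comm] at this
    linear_combination this / 2
  have pq' {z} (hz : z ∈ U) : lorentz (ψ z) (wdb θ ψ z) = 0 := by
    have := h.leibniz_wdb_const h.smooth h.smooth h.null hz
    rw [lorentz_comm] at this
    linear_combination this / 2
  have q'q' {z} (hz : z ∈ U) : lorentz (wdb θ ψ z) (wdb θ ψ z) = 0 := by
    rw [← h.star_q hz, lorentz_star, h.conformal z hz, map_zero]
  refine ⟨h.null z hz, pq hz, pq' hz, ?_, h.conformal z hz, h.unit z hz, q'q' hz, ?_, ?_⟩
  · have := h.leibniz_wd_const h.smooth sq' (fun _ => pq') hz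
    rw [h.unit z hz] at this
    linear_combination this
  · have := h.leibniz_wdb_const sq sq h.conformal hz
    rw [h.comm h.smooth hz]
    rw [lorentz_comm] at this
    linear_combination this / 2
  · have := h.leibniz_wd_const sq' sq' (fun _ => q'q') hz
    rw [lorentz_comm] at this
    linear_combination this / 2

theorem kp {z : ℂ} (hz : z ∈ U) : lorentz (wd θ (wd θ ψ) z) (ψ z) = 0 := by
  have := h.leibniz_wd_const (h.smooth_wd h.smooth) h.smooth
    (fun z hz => by rw [lorentz_comm]; exact (h.isNullFrame hz).pq) hz
  rw [this, h.conformal z hz, neg_zero]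

theorem kq {z : ℂ} (hz : z ∈ U) : lorentz (wd θ (wd θ ψ) z) (wd θ ψ z) = 0 := by
  have := h.leibniz_wd_const (h.smooth_wd h.smooth) (h.smooth_wd h.smooth) h.conformal hz
  rw [lorentz_comm (wd θ ψ z)] at this
  linear_combination this / 2

theorem kq' {z : ℂ} (hz : z ∈ U) : lorentz (wd θ (wd θ ψ) z) (wdb θ ψ z) = 0 := by
  rw [h.leibniz_wd_const (h.smooth_wd h.smooth) (h.smooth_wdb h.smooth) h.unit hz,
    (h.isNullFrame hz).qn, neg_zero]

theorem k'p {z : ℂ} (hz : z ∈ U) : lorentz (wdb θ (wdb θ ψ) z) (ψ z) = 0 := by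
  rw [← h.star_k hz, ← h.real z hz, lorentz_star, h.kp hz, map_zero]

theorem k'q {z : ℂ} (hz : z ∈ U) : lorentz (wdb θ (wdb θ ψ) z) (wd θ ψ z) = 0 := by
  rw [← h.star_k hz, ← h.star_q' hz, lorentz_star, h.kq' hz, map_zero]

theorem k'q' {z : ℂ} (hz : z ∈ U) : lorentz (wdb θ (wdb θ ψ) z) (wdb θ ψ z) = 0 := by
  rw [← h.star_k hz, ← h.star_q hz, lorentz_star, h.kq hz, map_zero]

omit h in
theorem kn {z : ℂ} : lorentz (wd θ (wd θ ψ) z) (wd θ (wdb θ ψ) z)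
    = liftSchwarzian θ ψ z / 4 := by
  rw [liftSchwarzian]; ring

theorem k'n {z : ℂ} (hz : z ∈ U) : lorentz (wdb θ (wdb θ ψ) z) (wd θ (wdb θ ψ) z)
    = conj (liftSchwarzian θ ψ z) / 4 := by
  rw [← h.star_k hz, ← h.star_n hz, lorentz_star, kn]
  simp [Complex.conj_ofNat]

/-- `D ψ_{w w̄} = D̄ ψ_{ww}`. -/
theorem wdb_k {z : ℂ} (hz : z ∈ U) : wdb θ (wd θ (wd θ ψ)) z = wd θ (wd θ (wdb θ ψ)) z := by
  rw [← h.comm (h.smooth_wd h.smooth) hz]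
  exact wd_congr h.isOpen (fun z hz => (h.comm h.smooth hz).symm) hz

theorem wdb_n {z : ℂ} (hz : z ∈ U) : wdb θ (wd θ (wdb θ ψ)) z = wd θ (wdb θ (wdb θ ψ)) z :=
  (h.comm (h.smooth_wdb h.smooth) hz).symm

/-- Differentiate ⟨ψ_{ww̄}, ψ_w̄⟩ = 0 along w and ⟨ψ_ww, ψ_w̄⟩ = 0 along w̄. The same third
derivative ψ_{www̄} occurs in both, paired with ψ_w̄. -/
theorem nn {z : ℂ} (hz : z ∈ U) : lorentz (wd θ (wdb θ ψ) z) (wd θ (wdb θ ψ) z) =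
    lorentz (wd θ (wd θ ψ) z) (wdb θ (wdb θ ψ) z) := by
  have sq := h.smooth_wd h.smooth
  have sq' := h.smooth_wdb h.smooth
  have e1 := h.leibniz_wd_const (h.smooth_wd sq') sq'
    (fun z hz => by rw [lorentz_comm]; exact (h.isNullFrame hz).q'n) hz
  have e2 := h.leibniz_wdb_const (h.smooth_wd sq) sq' (fun z hz => h.kq' hz) hz
  rw [h.wdb_k hz] at e2
  linear_combination e1 - e2

theorem smooth_k : ContDiffOn ℝ ∞ (wd θ (wd θ ψ)) U := h.smooth_wd (h.smooth_wd h.smooth)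

theorem smooth_k' : ContDiffOn ℝ ∞ (wdb θ (wdb θ ψ)) U := h.smooth_wdb (h.smooth_wdb h.smooth)

theorem smooth_n : ContDiffOn ℝ ∞ (wd θ (wdb θ ψ)) U := h.smooth_wd (h.smooth_wdb h.smooth)

theorem smooth_liftSchwarzian : ContDiffOn ℝ ∞ (liftSchwarzian θ ψ) U :=
  contDiffOn_const.mul (contDiffOn_lorentz h.smooth_k h.smooth_n)

theorem smooth_liftHopf : ContDiffOn ℝ ∞ (liftHopf θ ψ) U :=
  h.smooth_k.add (((h.smooth_liftSchwarzian).div_const 2).smul h.smooth)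

theorem dn_p {z : ℂ} (hz : z ∈ U) : lorentz (wd θ (wd θ (wdb θ ψ)) z) (ψ z) = 0 := by
  rw [h.leibniz_wd_const h.smooth_n h.smooth
    (fun z hz => by rw [lorentz_comm]; exact (h.isNullFrame hz).pn) hz, lorentz_comm,
    (h.isNullFrame hz).qn, neg_zero]

theorem dn_n {z : ℂ} (hz : z ∈ U) :
    2 * lorentz (wd θ (wd θ (wdb θ ψ)) z) (wd θ (wdb θ ψ) z) =
      lorentz (wd θ (wd θ (wd θ ψ)) z) (wdb θ (wdb θ ψ) z) +
      lorentz (wd θ (wd θ ψ) z) (wd θ (wdb θ (wdb θ ψ)) z) := by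
  rw [h.leibniz_wd (a := fun z => lorentz (wd θ (wdb θ ψ) z) (wd θ (wdb θ ψ) z)) h.smooth_k
    h.smooth_k' (fun z hz => (h.nn hz).symm) hz,
    ← h.leibniz_wd h.smooth_n h.smooth_n (fun z _ => rfl) hz, lorentz_comm (wd θ (wdb θ ψ) z)]
  ring

theorem dn_q {z : ℂ} (hz : z ∈ U) : lorentz (wd θ (wd θ (wdb θ ψ)) z) (wd θ ψ z) =
    -(liftSchwarzian θ ψ z / 4) := by
  rw [h.leibniz_wd_const h.smooth_n (h.smooth_wd h.smooth)
    (fun z hz => by rw [lorentz_comm]; exact (h.isNullFrame hz).qn) hz, lorentz_comm, kn]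

theorem dn_q' {z : ℂ} (hz : z ∈ U) : lorentz (wd θ (wd θ (wdb θ ψ)) z) (wdb θ ψ z) =
    -lorentz (wd θ (wdb θ ψ) z) (wd θ (wdb θ ψ) z) := by
  rw [h.leibniz_wd_const h.smooth_n (h.smooth_wdb h.smooth)
    (fun z hz => by rw [lorentz_comm]; exact (h.isNullFrame hz).q'n) hz]

/-- The Gauss equation. -/
theorem gauss {z : ℂ} (hz : z ∈ U) : wdb θ (liftSchwarzian θ ψ) z =
    2 * (lorentz (wd θ (wd θ (wd θ ψ)) z) (wdb θ (wdb θ ψ) z) +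
      3 * lorentz (wd θ (wd θ ψ) z) (wd θ (wdb θ (wdb θ ψ)) z)) := by
  -- Differentiating ⟨ψ_ww, ψ_{ww̄}⟩ = c/4 along w̄ leaves the pairing of ψ_{www̄} with ψ_{ww̄},
  -- which `dn_n` evaluates from the derivative of `nn`.
  have e1 := h.leibniz_wdb (a := fun z => (1 / 4 : ℂ) • liftSchwarzian θ ψ z) h.smooth_k
    h.smooth_n (fun z _ => by rw [kn, smul_eq_mul]; ring) hz
  rw [wdb_smul (differentiableAt_const _)
    (h.smooth_liftSchwarzian.differentiableAt_of_isOpen h.isOpen hz), wdb_const, h.wdb_k hz,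
    h.wdb_n hz, smul_eq_mul] at e1
  have e2 := h.dn_n hz
  linear_combination -4 * e1 + 2 * e2

/-- Codimension one enters here: ψ_ww and its conjugate have normal parts a ξ and b ξ on one line.
Consequently ⟨ψ_ww, ψ_ww⟩ = a², its conjugate is b², and ⟨ψ_ww, ψ_w̄w̄⟩ = ab. -/
theorem exists_normal {z : ℂ} (hz : z ∈ U) : ∃ (ξ : Fin 5 → ℂ) (a b : ℂ),
    lorentz ξ ξ = 1 ∧ lorentz ξ (ψ z) = 0 ∧ lorentz ξ (wd θ ψ z) = 0 ∧
    lorentz ξ (wdb θ ψ z) = 0 ∧ lorentz ξ (wd θ (wdb θ ψ) z) = 0 ∧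
    wd θ (wd θ ψ) z = -(liftSchwarzian θ ψ z / 2) • ψ z + a • ξ ∧
    wdb θ (wdb θ ψ) z = -(conj (liftSchwarzian θ ψ z) / 2) • ψ z + b • ξ := by
  have hf := h.isNullFrame hz
  obtain ⟨ξ, h1, hp, hq, hq', hn, hv⟩ := hf.exists_unit_normal
  have key (v : Fin 5 → ℂ) (c : ℂ) (h1 : lorentz v (ψ z) = 0) (h2 : lorentz v (wd θ ψ z) = 0)
      (h3 : lorentz v (wdb θ ψ z) = 0) (h4 : lorentz v (wd θ (wdb θ ψ) z) = c / 4) :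
      ∃ a : ℂ, v = -(c / 2) • ψ z + a • ξ := by
    refine ⟨lorentz (v + (c / 2) • ψ z) ξ, ?_⟩
    rw [← hv (v + (c / 2) • ψ z)]
    · module
    · rw [lorentz_add_left, lorentz_smul_left, h1, hf.pp]; ring
    · rw [lorentz_add_left, lorentz_smul_left, h2, hf.pq]; ring
    · rw [lorentz_add_left, lorentz_smul_left, h3, hf.pq']; ring
    · rw [lorentz_add_left, lorentz_smul_left, h4, hf.pn]; ring
  obtain ⟨a, ha⟩ := key _ _ (h.kp hz) (h.kq hz) (h.kq' hz) kn
  obtain ⟨b, hb⟩ := key _ _ (h.k'p hz) (h.k'q hz) (h.k'q' hz) (h.k'n hz)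
  exact ⟨ξ, a, b, h1, hp, hq, hq', hn, ha, hb⟩

theorem zero_ne {z : ℂ} (hz : z ∈ U) : ψ z 0 ≠ 0 := by
  intro h0
  have hpr (i : Fin 5) : ((ψ z i).re : ℂ) = ψ z i :=
    Complex.conj_eq_iff_re.1 (congrFun (h.real z hz) i)
  have hψ : (fun i => (ψ z i).re) = 0 := by
    refine eq_zero_of_null ?_ (by simp [h0])
    have := lorentz_ofReal (fun i => (ψ z i).re) (fun i => (ψ z i).re)
    simp only [hpr] at this
    rw [show (fun i => ψ z i) = ψ z from rfl, h.null z hz] at this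
    exact_mod_cast this.symm
  have hψ' : ψ z = 0 := by
    funext i
    rw [← hpr i, congrFun hψ i]; simp
  have := (h.isNullFrame hz).pn
  rw [hψ', lorentz_zero_left] at this
  norm_num at this

/-- With a and b from `exists_normal`, the square of the left side is a²b², the product of ⟨ψ_ww,
ψ_ww⟩ and its conjugate. The sign is fixed because the left side is real and non-negative: ψ_ww is
orthogonal to the real null vector ψ. -/
theorem lorentz_kk' {z : ℂ} (hz : z ∈ U) :
    lorentz (wd θ (wd θ ψ) z) (wdb θ (wdb θ ψ) z) =
      ‖lorentz (wd θ (wd θ ψ) z) (wd θ (wd θ ψ) z)‖ := by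
  have hf := h.isNullFrame hz
  set R := lorentz (wd θ (wd θ ψ) z) (wdb θ (wdb θ ψ) z) with hR
  have hreal : conj R = R := by
    rw [hR, ← h.nn hz, ← lorentz_star, h.star_n hz]
  have hnn : 0 ≤ R.re := by
    rw [hR, ← h.star_k hz]
    exact sum_sq_le_of_lorentz_eq_zero (h.real z hz) (h.zero_ne hz) hf.pp (h.kp hz)
  obtain ⟨ξ, a, b, h1, hp, hq, hq', hn, ha, hb⟩ := h.exists_normal hz
  have hpξ : lorentz (ψ z) ξ = 0 := by rw [lorentz_comm, hp]
  have hQ : lorentz (wd θ (wd θ ψ) z) (wd θ (wd θ ψ) z) = a ^ 2 := by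
    rw [ha]
    simp only [lorentz_add_left, lorentz_add_right, lorentz_smul_left, lorentz_smul_right, h1, hp,
      hpξ, hf.pp]
    ring
  have hQ' : conj (lorentz (wd θ (wd θ ψ) z) (wd θ (wd θ ψ) z)) = b ^ 2 := by
    rw [← lorentz_star, h.star_k hz, hb]
    simp only [lorentz_add_left, lorentz_add_right, lorentz_smul_left, lorentz_smul_right, h1, hp,
      hpξ, hf.pp]
    ring
  have hR' : R = a * b := by
    rw [hR, ha, hb]
    simp only [lorentz_add_left, lorentz_add_right, lorentz_smul_left, lorentz_smul_right, h1, hp,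
      hpξ, hf.pp]
    ring
  have hRr : (R.re : ℂ) = R := Complex.conj_eq_iff_re.1 hreal
  rw [← hRr]
  congr 1
  rw [← Real.sqrt_sq (norm_nonneg _), eq_comm, Real.sqrt_eq_iff_mul_self_eq (sq_nonneg _) hnn]
  have hc := Complex.mul_conj' (lorentz (wd θ (wd θ ψ) z) (wd θ (wd θ ψ) z))
  rw [hQ'] at hc
  have : ((R.re * R.re : ℝ) : ℂ) =
      ((‖lorentz (wd θ (wd θ ψ) z) (wd θ (wd θ ψ) z)‖ ^ 2 : ℝ) : ℂ) := by
    push_cast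
    rw [hRr, hR', ← hc, hQ]
    ring
  exact_mod_cast this.symm

/-- In terms of normal components the function is a³b. Its w̄-derivative is a² times 3b a_w̄ + a
b_w̄, and the second factor vanishes by the conjugate of the Gauss equation with c_w̄ = 0. -/
theorem wdb_quartic {z : ℂ} (hz : z ∈ U) (hc : wdb θ (liftSchwarzian θ ψ) z = 0) :
    wdb θ (fun z => lorentz (wd θ (wd θ ψ) z) (wd θ (wd θ ψ) z) •
      lorentz (wd θ (wd θ ψ) z) (wdb θ (wdb θ ψ) z)) z = 0 := by
  have hk := h.smooth_k.differentiableAt_of_isOpen h.isOpen hz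
  have hk' := h.smooth_k'.differentiableAt_of_isOpen h.isOpen hz
  have hf := h.isNullFrame hz
  rw [wdb_smul ((contDiffOn_lorentz h.smooth_k h.smooth_k).differentiableAt_of_isOpen h.isOpen hz)
    ((contDiffOn_lorentz h.smooth_k h.smooth_k').differentiableAt_of_isOpen h.isOpen hz),
    wdb_lorentz hk hk, wdb_lorentz hk hk', lorentz_comm (wd θ (wd θ ψ) z) (wdb θ _ z),
    lorentz_comm (wd θ (wd θ ψ) z) (wdb θ (wdb θ (wdb θ ψ)) z)]
  have hg := h.gauss hz
  rw [hc] at hg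
  have hg' := congrArg conj hg
  have s1 : star (wd θ (wd θ (wd θ ψ)) z) = wdb θ (wdb θ (wdb θ ψ)) z :=
    h.star_wd h.smooth_k (fun _ => h.star_k) hz
  have s2 : star (wd θ (wdb θ (wdb θ ψ)) z) = wdb θ (wd θ (wd θ ψ)) z :=
    h.star_wd h.smooth_k' (fun _ => h.star_k') hz
  simp only [map_mul, map_add, ← lorentz_star, s1, s2, h.star_k hz, h.star_k' hz, map_zero,
    Complex.conj_ofNat] at hg'
  rw [lorentz_comm (wdb θ (wdb θ ψ) z) (wdb θ (wd θ (wd θ ψ)) z)] at hg'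
  have hx : lorentz (wdb θ (wd θ (wd θ ψ)) z) (ψ z) = 0 := by
    rw [h.wdb_k hz, h.dn_p hz]
  obtain ⟨ξ, a, b, h1, hp, hq, hq', hn, ha, hb⟩ := h.exists_normal hz
  have hpξ : lorentz (ψ z) ξ = 0 := by rw [lorentz_comm, hp]
  -- Pairing with ψ_ww and with ψ_w̄w̄ is proportional on vectors orthogonal to ψ, in the ratio a :
  -- b. This replaces the derivatives of a and b, so that ξ need not be chosen differentiably.
  have r1 : lorentz (wdb θ (wd θ (wd θ ψ)) z) (wd θ (wd θ ψ) z) *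
      lorentz (wd θ (wd θ ψ) z) (wdb θ (wdb θ ψ) z) =
      lorentz (wd θ (wd θ ψ) z) (wd θ (wd θ ψ) z) *
      lorentz (wdb θ (wd θ (wd θ ψ)) z) (wdb θ (wdb θ ψ) z) := by
    generalize wdb θ (wd θ (wd θ ψ)) z = X at *
    rw [ha, hb]
    simp only [lorentz_add_left, lorentz_add_right, lorentz_smul_left, lorentz_smul_right, h1, hp,
      hpξ, hf.pp, hx]
    ring
  simp only [smul_eq_mul]
  linear_combination 2 * r1 - (lorentz (wd θ (wd θ ψ) z) (wd θ (wd θ ψ) z)) * hg' / 2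

end IsNormalizedLift

/-! ### Constant structure equations when ⟨κ, κ⟩ = 1 -/

namespace IsNormalizedLift

variable {U : Set ℂ} {θ : ℂ → ℂ} {ψ : ℂ → Fin 5 → ℂ} (h : IsNormalizedLift U θ ψ)
include h

theorem hopf_p {z : ℂ} (hz : z ∈ U) : lorentz (liftHopf θ ψ z) (ψ z) = 0 := by
  rw [liftHopf, lorentz_add_left, lorentz_smul_left, h.kp hz, h.null z hz]; ring

theorem hopf_q {z : ℂ} (hz : z ∈ U) : lorentz (liftHopf θ ψ z) (wd θ ψ z) = 0 := by
  rw [liftHopf, lorentz_add_left, lorentz_smul_left, h.kq hz, (h.isNullFrame hz).pq]; ring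

theorem hopf_q' {z : ℂ} (hz : z ∈ U) : lorentz (liftHopf θ ψ z) (wdb θ ψ z) = 0 := by
  rw [liftHopf, lorentz_add_left, lorentz_smul_left, h.kq' hz, (h.isNullFrame hz).pq']; ring

theorem hopf_n {z : ℂ} (hz : z ∈ U) : lorentz (liftHopf θ ψ z) (wd θ (wdb θ ψ) z) = 0 := by
  rw [liftHopf, lorentz_add_left, lorentz_smul_left, kn, (h.isNullFrame hz).pn]; ring

variable (hQ : ∀ z ∈ U, lorentz (wd θ (wd θ ψ) z) (wd θ (wd θ ψ) z) = 1)
include hQ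

theorem kk'_eq_one {z : ℂ} (hz : z ∈ U) :
    lorentz (wd θ (wd θ ψ) z) (wdb θ (wdb θ ψ) z) = 1 := by
  rw [h.lorentz_kk' hz, hQ z hz]; simp

theorem k'k'_eq_one {z : ℂ} (hz : z ∈ U) :
    lorentz (wdb θ (wdb θ ψ) z) (wdb θ (wdb θ ψ) z) = 1 := by
  rw [← h.star_k hz, lorentz_star, hQ z hz, map_one]

theorem hopf_k {z : ℂ} (hz : z ∈ U) : lorentz (liftHopf θ ψ z) (wd θ (wd θ ψ) z) = 1 := by
  rw [liftHopf, lorentz_add_left, lorentz_smul_left, hQ z hz, lorentz_comm (ψ z), h.kp hz]; ring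

theorem hopf_hopf {z : ℂ} (hz : z ∈ U) : lorentz (liftHopf θ ψ z) (liftHopf θ ψ z) = 1 := by
  nth_rw 2 [liftHopf]
  rw [lorentz_add_right, lorentz_smul_right, h.hopf_k hQ hz, h.hopf_p hz]; ring

/-- With a and b from `exists_normal`, a² = 1 and ab = 1 give a = b, so κ and its conjugate have the
same normal component. -/
theorem star_hopf {z : ℂ} (hz : z ∈ U) : star (liftHopf θ ψ z) = liftHopf θ ψ z := by
  have hf := h.isNullFrame hz
  obtain ⟨ξ, a, b, h1, hp, hq, hq', hn, ha, hb⟩ := h.exists_normal hz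
  have hpξ : lorentz (ψ z) ξ = 0 := by rw [lorentz_comm, hp]
  have e1 := hQ z hz
  have e2 := h.kk'_eq_one hQ hz
  rw [ha] at e1 e2
  rw [hb] at e2
  simp only [lorentz_add_left, lorentz_add_right, lorentz_smul_left, lorentz_smul_right, h1, hp,
    hpξ, hf.pp] at e1 e2
  have hab : a = b := by
    linear_combination b * e1 - a * e2
  have hs : star (liftHopf θ ψ z) = wdb θ (wdb θ ψ) z +
      (conj (liftSchwarzian θ ψ z) / 2) • ψ z := by
    rw [liftHopf, star_add, h.star_k hz, star_smul, h.real z hz]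
    simp
  rw [hs, liftHopf, ha, hb, hab]
  module

theorem k_sub_k' {z : ℂ} (hz : z ∈ U) : wd θ (wd θ ψ) z = wdb θ (wdb θ ψ) z +
    ((conj (liftSchwarzian θ ψ z) - liftSchwarzian θ ψ z) / 2) • ψ z := by
  have e := h.star_hopf hQ hz
  rw [liftHopf, star_add, h.star_k hz, star_smul, h.real z hz] at e
  simp only [star_div₀, RCLike.star_def, Complex.conj_ofNat] at e
  rw [eq_comm, ← sub_eq_iff_eq_add] at e
  rw [← e]
  module

/-- The normalization ⟨κ, κ⟩ = 1 alone annihilates the right side of the Gauss equation. Its two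
terms are opposite up to the factor 3, as ⟨ψ_ww, ψ_w̄w̄⟩ = 1. The second is zero since ψ_ww agrees
with ψ_w̄w̄ modulo ψ and ⟨ψ_w̄w̄, ψ_w̄w̄⟩ is constant. -/
theorem wdb_schwarzian {z : ℂ} (hz : z ∈ U) : wdb θ (liftSchwarzian θ ψ) z = 0 := by
  have e1 := h.leibniz_wd_const h.smooth_k h.smooth_k' (fun z hz => h.kk'_eq_one hQ hz) hz
  have e2 := h.leibniz_wd_const h.smooth_k' h.smooth_k' (fun z hz => h.k'k'_eq_one hQ hz) hz
  have e3 := h.leibniz_wd_const h.smooth_k' h.smooth (fun z hz => h.k'p hz) hz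
  rw [h.k'q hz] at e3
  have e4 : lorentz (wd θ (wd θ ψ) z) (wd θ (wdb θ (wdb θ ψ)) z) = 0 := by
    rw [h.k_sub_k' hQ hz, lorentz_add_left, lorentz_smul_left, lorentz_comm (ψ z), e3]
    rw [lorentz_comm] at e2
    linear_combination e2 / 2
  rw [h.gauss hz, e1, e4]
  ring

theorem eq_of_pairings {v w : Fin 5 → ℂ} {z : ℂ} (hz : z ∈ U)
    (hp : lorentz v (ψ z) = lorentz w (ψ z)) (hq : lorentz v (wd θ ψ z) = lorentz w (wd θ ψ z))
    (hq' : lorentz v (wdb θ ψ z) = lorentz w (wdb θ ψ z))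
    (hn : lorentz v (wd θ (wdb θ ψ) z) = lorentz w (wd θ (wdb θ ψ) z))
    (hk : lorentz v (liftHopf θ ψ z) = lorentz w (liftHopf θ ψ z)) : v = w := by
  rw [← sub_eq_zero]
  have hκ := h.hopf_hopf hQ hz
  refine (h.isNullFrame hz).eq_zero_of_orthogonal (x := liftHopf θ ψ z) ?_ ?_ ?_ ?_ ?_ ?_ ?_ ?_ ?_ ?_
  · intro h0; rw [h0, lorentz_zero_left] at hκ; exact zero_ne_one hκ
  · rw [lorentz_comm, h.hopf_p hz]
  · rw [lorentz_comm, h.hopf_q hz]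
  · rw [lorentz_comm, h.hopf_q' hz]
  · rw [lorentz_comm, h.hopf_n hz]
  all_goals rw [lorentz_sub_left, sub_eq_zero]; assumption

/-- The coefficients are read off by pairing with the frame ψ, ψ_w, ψ_w̄, ψ_{ww̄}, κ, which
determines a vector by `eq_of_pairings`. The components along ψ and κ vanish because the relevant
pairings are constant. -/
theorem wd_n {z : ℂ} (hz : z ∈ U) : wd θ (wd θ (wdb θ ψ)) z =
    (-2 : ℂ) • wd θ ψ z + (-(liftSchwarzian θ ψ z / 2)) • wdb θ ψ z := by
  have hf := h.isNullFrame hz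
  refine h.eq_of_pairings hQ hz ?_ ?_ ?_ ?_ ?_
  · rw [h.dn_p hz, lorentz_add_left, lorentz_smul_left, lorentz_smul_left, lorentz_comm, hf.pq,
      lorentz_comm, hf.pq']; ring
  · rw [h.dn_q hz, lorentz_add_left, lorentz_smul_left, lorentz_smul_left, hf.qq,
      lorentz_comm, hf.qq']; ring
  · rw [h.dn_q' hz, h.nn hz, h.kk'_eq_one hQ hz, lorentz_add_left, lorentz_smul_left,
      lorentz_smul_left, hf.qq', hf.q'q']; ring
  · have e := h.leibniz_wd_const h.smooth_n h.smooth_n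
      (fun z hz => (h.nn hz).trans (h.kk'_eq_one hQ hz)) hz
    rw [lorentz_comm (wd θ (wdb θ ψ) z)] at e
    rw [lorentz_add_left, lorentz_smul_left, lorentz_smul_left, hf.qn, hf.q'n]
    linear_combination e / 2
  · have e := h.leibniz_wdb_const h.smooth_k h.smooth_k hQ hz
    rw [lorentz_comm (wd θ (wd θ ψ) z), h.wdb_k hz] at e
    rw [lorentz_add_left, lorentz_smul_left, lorentz_smul_left, lorentz_comm (wd θ ψ z),
      h.hopf_q hz, lorentz_comm (wdb θ ψ z), h.hopf_q' hz, liftHopf, lorentz_add_right,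
      lorentz_smul_right, h.dn_p hz]
    linear_combination e / 2

theorem wd_hopf {z : ℂ} (hz : z ∈ U) : wd θ (liftHopf θ ψ) z = (-2 : ℂ) • wdb θ ψ z := by
  have hf := h.isNullFrame hz
  have hs := h.smooth_liftHopf
  refine h.eq_of_pairings hQ hz ?_ ?_ ?_ ?_ ?_
  · rw [h.leibniz_wd_const hs h.smooth (fun z hz => h.hopf_p hz) hz, h.hopf_q hz,
      lorentz_smul_left, lorentz_comm, hf.pq']; ring
  · rw [h.leibniz_wd_const hs (h.smooth_wd h.smooth) (fun z hz => h.hopf_q hz) hz,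
      h.hopf_k hQ hz, lorentz_smul_left, lorentz_comm, hf.qq']; ring
  · rw [h.leibniz_wd_const hs (h.smooth_wdb h.smooth) (fun z hz => h.hopf_q' hz) hz,
      h.hopf_n hz, lorentz_smul_left, hf.q'q']; ring
  · rw [h.leibniz_wd_const hs h.smooth_n (fun z hz => h.hopf_n hz) hz, h.wd_n hQ hz,
      lorentz_add_right, lorentz_smul_right, lorentz_smul_right, h.hopf_q hz, h.hopf_q' hz,
      lorentz_smul_left, hf.q'n]; ring
  · have e := h.leibniz_wd_const hs hs (fun z hz => h.hopf_hopf hQ hz) hz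
    rw [lorentz_comm (liftHopf θ ψ z)] at e
    rw [lorentz_smul_left, lorentz_comm (wdb θ ψ z), h.hopf_q' hz]
    linear_combination e / 2

/-- This is an integrability condition. The vector ∂_w̄ ∂_w ψ_{ww̄} is real because ψ_{ww̄} is real
and the derivatives commute, while `wd_n` evaluates it as -2ψ_{ww̄} - (c/2)ψ_w̄w̄. Pairing it and
its conjugate with ψ_ww compares c with its conjugate. -/
theorem conj_schwarzian {z : ℂ} (hz : z ∈ U) :
    conj (liftSchwarzian θ ψ z) = liftSchwarzian θ ψ z := by
  have hr : star (wdb θ (wd θ (wd θ (wdb θ ψ))) z) = wdb θ (wd θ (wd θ (wdb θ ψ))) z := by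
    rw [h.star_wdb (h.smooth_wd h.smooth_n)
      (fun z hz => h.star_wd h.smooth_n (fun z hz => h.star_n hz) hz) hz, h.comm h.smooth_n hz]
  have hd : wdb θ (wd θ (wd θ (wdb θ ψ))) z =
      (-2 : ℂ) • wd θ (wdb θ ψ) z + (-(liftSchwarzian θ ψ z / 2)) • wdb θ (wdb θ ψ) z := by
    have hq := (h.smooth_wd h.smooth).differentiableAt_of_isOpen h.isOpen hz
    have hq' := (h.smooth_wdb h.smooth).differentiableAt_of_isOpen h.isOpen hz
    have hc := h.smooth_liftSchwarzian.differentiableAt_of_isOpen h.isOpen hz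
    have hc2 : (fun z => -(liftSchwarzian θ ψ z / 2)) =
      fun z => (-1 / 2 : ℂ) • liftSchwarzian θ ψ z := by
      funext z; rw [smul_eq_mul]; ring
    have hcd : DifferentiableAt ℝ (fun z => -(liftSchwarzian θ ψ z / 2)) z := by
      rw [hc2]; exact (differentiableAt_const (c := (-1 / 2 : ℂ))).fun_smul hc
    have hcw : wdb θ (fun z => -(liftSchwarzian θ ψ z / 2)) z = 0 := by
      rw [hc2, wdb_smul (differentiableAt_const _) hc, wdb_const, h.wdb_schwarzian hQ hz]
      simp
    rw [wdb_congr (G := fun z => (-2 : ℂ) • wd θ ψ z + (-(liftSchwarzian θ ψ z / 2)) • wdb θ ψ z)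
      h.isOpen (fun z hz => h.wd_n hQ hz) hz,
      wdb_add (F := fun z => (-2 : ℂ) • wd θ ψ z)
        (G := fun z => (-(liftSchwarzian θ ψ z / 2)) • wdb θ ψ z)
        ((differentiableAt_const (c := (-2 : ℂ))).fun_smul hq) (hcd.fun_smul hq'),
      wdb_smul (differentiableAt_const _) hq, wdb_smul hcd hq', wdb_const, hcw,
      h.comm h.smooth hz]
    simp
  have e := congrArg (lorentz (wd θ (wd θ ψ) z)) hr
  rw [hd, star_add, star_smul, star_smul, h.star_n hz, h.star_k' hz] at e
  simp only [lorentz_add_right, lorentz_smul_right, hQ z hz, h.kk'_eq_one hQ hz, star_neg,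
    star_div₀, RCLike.star_def, Complex.conj_ofNat] at e
  linear_combination -2 * e

theorem wd_schwarzian {z : ℂ} (hz : z ∈ U) : wd θ (liftSchwarzian θ ψ) z = 0 := by
  have hc := h.smooth_liftSchwarzian.differentiableAt_of_isOpen h.isOpen hz
  rw [← wd_congr (F := fun z => conj (liftSchwarzian θ ψ z)) h.isOpen
    (fun z hz => h.conj_schwarzian hQ hz) hz, wd_conj hc, h.wdb_schwarzian hQ hz, map_zero]

theorem exists_schwarzian_eq (hU : IsPreconnected U) :
    ∃ c : ℝ, ∀ z ∈ U, liftSchwarzian θ ψ z = c := by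
  obtain rfl | ⟨z₀, hz₀⟩ := U.eq_empty_or_nonempty
  · exact ⟨0, fun z hz => hz.elim⟩
  refine ⟨(liftSchwarzian θ ψ z₀).re, fun z hz => ?_⟩
  rw [Complex.conj_eq_iff_re.1 (h.conj_schwarzian hQ hz₀)]
  refine h.isOpen.is_const_of_fderiv_eq_zero (𝕜 := ℝ) hU
    (fun y hy => (h.smooth_liftSchwarzian.differentiableAt_of_isOpen
      h.isOpen hy).differentiableWithinAt) (fun y hy => ?_) hz hz₀
  ext v
  rw [fderiv_eq_wd_add_wdb (h.ne_zero y hy), h.wd_schwarzian hQ hy, h.wdb_schwarzian hQ hy]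
  simp

end IsNormalizedLift

/-! ### Change of lift and the quartic differential -/

theorem wd_one {E : Type*} [NormedAddCommGroup E] [NormedSpace ℂ E] :
    (wd (fun _ => 1) : (ℂ → E) → ℂ → E) = dz := by
  funext F z; simp [wd]

theorem wdb_one {E : Type*} [NormedAddCommGroup E] [NormedSpace ℂ E] :
    (wdb (fun _ => 1) : (ℂ → E) → ℂ → E) = dzbar := by
  funext F z; simp [wdb]

/-- The second derivative of a multiple of `Ψ₀`, modulo `Ψ₀` and `Ψ₁`. -/
theorem exists_wd_wd_smul {U : Set ℂ} {θ : ℂ → ℂ} (hU : IsOpen U) (hθ : DifferentiableOn ℂ θ U)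
    (hθ0 : ∀ z ∈ U, θ z ≠ 0) {a b : ℂ → ℂ} {Ψ₀ Ψ₁ Ψ₂ : ℂ → Fin 5 → ℂ}
    (ha : ContDiffOn ℝ ∞ a U) (hb : ContDiffOn ℝ ∞ b U) (h₀ : ContDiffOn ℝ ∞ Ψ₀ U)
    (h₁ : ContDiffOn ℝ ∞ Ψ₁ U) (e₀ : ∀ z ∈ U, wd θ Ψ₀ z = b z • Ψ₁ z)
    (e₁ : ∀ z ∈ U, wd θ Ψ₁ z = b z • Ψ₂ z) {z : ℂ} (hz : z ∈ U) :
    ∃ r s : ℂ, wd θ (wd θ fun y => a y • Ψ₀ y) z =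
      (a z * b z ^ 2) • Ψ₂ z + r • Ψ₁ z + s • Ψ₀ z := by
  have d {E : Type} [NormedAddCommGroup E] [NormedSpace ℂ E] {F : ℂ → E}
    (hF : ContDiffOn ℝ ∞ F U) {y} (hy : y ∈ U) := hF.differentiableAt_of_isOpen hU hy
  have hwa := contDiffOn_wd hU hθ hθ0 ha
  have f1 : ∀ y ∈ U, wd θ (fun y => a y • Ψ₀ y) y = wd θ a y • Ψ₀ y + (a y • b y) • Ψ₁ y := by
    intro y hy
    rw [wd_smul (d ha hy) (d h₀ hy), e₀ y hy, smul_smul, smul_eq_mul]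
  have hab := ha.smul hb
  have hab' : ContDiffOn ℝ ∞ (fun y => a y • b y) U := hab
  refine ⟨wd θ a z * b z + wd θ (fun y => a y • b y) z, wd θ (wd θ a) z, ?_⟩
  rw [wd_congr hU f1 hz, wd_add (F := fun y => wd θ a y • Ψ₀ y)
    (G := fun y => (a y • b y) • Ψ₁ y) (d (hwa.smul h₀) hz) (d (hab'.smul h₁) hz),
    wd_smul (d hwa hz) (d h₀ hz), wd_smul (d hab' hz) (d h₁ hz), e₀ z hz, e₁ z hz]
  simp only [smul_eq_mul]
  module

/-- Only the Ψ₂ term survives, since Ψ₀ and Ψ₁ span an isotropic space orthogonal to Ψ₂. The lemma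
covers both the rescaling of a lift (b = θ⁻¹) and a change of coordinate (b = ζ'). -/
theorem lorentz_wd_wd_smul {U : Set ℂ} {θ : ℂ → ℂ} (hU : IsOpen U) (hθ : DifferentiableOn ℂ θ U)
    (hθ0 : ∀ z ∈ U, θ z ≠ 0) {a b : ℂ → ℂ} {Ψ₀ Ψ₁ Ψ₂ : ℂ → Fin 5 → ℂ}
    (ha : ContDiffOn ℝ ∞ a U) (hb : ContDiffOn ℝ ∞ b U) (h₀ : ContDiffOn ℝ ∞ Ψ₀ U)
    (h₁ : ContDiffOn ℝ ∞ Ψ₁ U) (e₀ : ∀ z ∈ U, wd θ Ψ₀ z = b z • Ψ₁ z)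
    (e₁ : ∀ z ∈ U, wd θ Ψ₁ z = b z • Ψ₂ z) {z : ℂ} (hz : z ∈ U)
    (h00 : lorentz (Ψ₀ z) (Ψ₀ z) = 0) (h01 : lorentz (Ψ₀ z) (Ψ₁ z) = 0)
    (h11 : lorentz (Ψ₁ z) (Ψ₁ z) = 0) (h20 : lorentz (Ψ₂ z) (Ψ₀ z) = 0)
    (h21 : lorentz (Ψ₂ z) (Ψ₁ z) = 0) :
    lorentz (wd θ (wd θ fun y => a y • Ψ₀ y) z) (wd θ (wd θ fun y => a y • Ψ₀ y) z) =
      (a z * b z ^ 2) ^ 2 * lorentz (Ψ₂ z) (Ψ₂ z) := by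
  obtain ⟨r, s, hrs⟩ := exists_wd_wd_smul hU hθ hθ0 ha hb h₀ h₁ e₀ e₁ hz
  rw [hrs]
  simp only [lorentz_add_left, lorentz_add_right, lorentz_smul_left, lorentz_smul_right, h00, h01,
    h11, h20, h21, lorentz_comm (Ψ₁ z) (Ψ₀ z), lorentz_comm (Ψ₀ z) (Ψ₂ z),
    lorentz_comm (Ψ₁ z) (Ψ₂ z)]
  ring

theorem contDiffOn_norm_holomorphic {U : Set ℂ} {θ : ℂ → ℂ} (hU : IsOpen U)
    (hθ : DifferentiableOn ℂ θ U) (hθ0 : ∀ z ∈ U, θ z ≠ 0) :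
    ContDiffOn ℝ ∞ (fun z => (‖θ z‖ : ℂ)) U :=
  ofRealCLM.contDiff.comp_contDiffOn
    ((contDiffOn_real_of_holomorphic hU hθ).norm ℝ hθ0)

namespace IsNormalizedLift

variable {U : Set ℂ} {θ : ℂ → ℂ} {ψ : ℂ → Fin 5 → ℂ}

theorem mono (h : IsNormalizedLift U θ ψ) {V : Set ℂ} (hV : IsOpen V) (hVU : V ⊆ U) :
    IsNormalizedLift V θ ψ :=
  ⟨hV, h.holo.mono hVU, fun z hz => h.ne_zero z (hVU hz), h.smooth.mono hVU,
    fun z hz => h.real z (hVU hz), fun z hz => h.null z (hVU hz),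
    fun z hz => h.conformal z (hVU hz), fun z hz => h.unit z (hVU hz)⟩

/-- As |dw|² = |θ|²|dz|², the lift must be multiplied by |θ|. Derivatives of this factor contribute
only multiples of ψ, which is null and orthogonal to its first derivatives. -/
theorem rescale (h : IsNormalizedLift U (fun _ => 1) ψ) (hθ : DifferentiableOn ℂ θ U)
    (hθ0 : ∀ z ∈ U, θ z ≠ 0) : IsNormalizedLift U θ (fun z => (‖θ z‖ : ℂ) • ψ z) := by
  have hn := contDiffOn_norm_holomorphic h.isOpen hθ hθ0
  have e1 : ∀ z ∈ U, wd θ (fun z => (‖θ z‖ : ℂ) • ψ z) z =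
      wd θ (fun z => (‖θ z‖ : ℂ)) z • ψ z + (‖θ z‖ * (θ z)⁻¹) • wd (fun _ => 1) ψ z := by
    intro z hz
    rw [wd_smul (hn.differentiableAt_of_isOpen h.isOpen hz)
      (h.smooth.differentiableAt_of_isOpen h.isOpen hz), wd_one, wd, wd, smul_smul]
  have e2 : ∀ z ∈ U, wdb θ (fun z => (‖θ z‖ : ℂ) • ψ z) z =
      wdb θ (fun z => (‖θ z‖ : ℂ)) z • ψ z
        + (‖θ z‖ * (conj (θ z))⁻¹) • wdb (fun _ => 1) ψ z := by
    intro z hz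
    rw [wdb_smul (hn.differentiableAt_of_isOpen h.isOpen hz)
      (h.smooth.differentiableAt_of_isOpen h.isOpen hz), wdb_one, wdb, wdb, smul_smul]
  refine ⟨h.isOpen, hθ, hθ0, hn.smul h.smooth, fun z hz => ?_, fun z hz => ?_, fun z hz => ?_,
    fun z hz => ?_⟩
  · rw [star_smul, h.real z hz]; simp
  · rw [lorentz_smul_left, lorentz_smul_right, h.null z hz]; ring
  · have hf := h.isNullFrame hz
    rw [e1 z hz]
    simp only [lorentz_add_left, lorentz_add_right, lorentz_smul_left, lorentz_smul_right, hf.pp,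
      hf.pq, hf.qq, lorentz_comm _ (ψ z)]
    ring
  · have hf := h.isNullFrame hz
    rw [e1 z hz, e2 z hz]
    simp only [lorentz_add_left, lorentz_add_right, lorentz_smul_left, lorentz_smul_right, hf.pp,
      hf.pq, hf.pq', hf.qq', lorentz_comm _ (ψ z)]
    have h1 : θ z * conj (θ z) = ‖θ z‖ ^ 2 := Complex.mul_conj' _
    have h0 := hθ0 z hz
    have h0' : conj (θ z) ≠ 0 := (map_ne_zero _).2 h0
    field_simp
    rw [h1]
    ring

theorem lorentz_rescale (h : IsNormalizedLift U (fun _ => 1) ψ) (hθ : DifferentiableOn ℂ θ U)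
    (hθ0 : ∀ z ∈ U, θ z ≠ 0) {z : ℂ} (hz : z ∈ U) :
    lorentz (wd θ (wd θ fun z => (‖θ z‖ : ℂ) • ψ z) z)
      (wd θ (wd θ fun z => (‖θ z‖ : ℂ) • ψ z) z) =
      (‖θ z‖ * ((θ z)⁻¹) ^ 2) ^ 2 * lorentz (dz (dz ψ) z) (dz (dz ψ) z) := by
  have hf := h.isNullFrame hz
  have hkp := h.kp hz
  have hkq := h.kq hz
  rw [wd_one] at hkp hkq
  have hpq := hf.pq
  have hqq := hf.qq
  rw [wd_one] at hpq hqq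
  exact lorentz_wd_wd_smul (Ψ₁ := dz ψ) (Ψ₂ := dz (dz ψ)) h.isOpen hθ hθ0
    (contDiffOn_norm_holomorphic h.isOpen hθ hθ0) (contDiffOn_inv_holomorphic h.isOpen hθ hθ0)
    h.smooth (contDiffOn_dz h.isOpen h.smooth) (fun _ _ => rfl) (fun _ _ => rfl) hz hf.pp hpq hqq
    hkp hkq

end IsNormalizedLift

/-- The quartic differential `⟨κ, κ⟩ |⟨κ, κ⟩|` of a conformal immersion. -/
def quartic (g : ℂ → EuclideanSpace ℝ (Fin 4)) (z : ℂ) : ℂ :=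
  lorentz (dz (dz (normalizedLift g)) z) (dz (dz (normalizedLift g)) z) *
    ‖lorentz (dz (dz (normalizedLift g)) z) (dz (dz (normalizedLift g)) z)‖

/-- Let Q be the pairing ⟨ψ_zz, ψ_zz⟩. From θ⁴ = Q|Q| follows |θ|² = |Q|, and rescaling turns Q into
|θ|² θ⁻⁴ Q = 1. -/
theorem lorentz_rescale_eq_one {U : Set ℂ} {θ : ℂ → ℂ} {g : ℂ → EuclideanSpace ℝ (Fin 4)}
    (h : IsNormalizedLift U (fun _ => 1) (normalizedLift g)) (hθ : DifferentiableOn ℂ θ U)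
    (hθ0 : ∀ z ∈ U, θ z ≠ 0) (hq : ∀ z ∈ U, θ z ^ 4 = quartic g z) {z : ℂ} (hz : z ∈ U) :
    lorentz (wd θ (wd θ fun z => (‖θ z‖ : ℂ) • normalizedLift g z) z)
      (wd θ (wd θ fun z => (‖θ z‖ : ℂ) • normalizedLift g z) z) = 1 := by
  rw [h.lorentz_rescale hθ hθ0 hz]
  have hq' := hq z hz
  rw [quartic] at hq'
  set Q := lorentz (dz (dz (normalizedLift g)) z) (dz (dz (normalizedLift g)) z)
  have h0 := hθ0 z hz
  have hn : ‖Q‖ = ‖θ z‖ ^ 2 := by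
    have := congrArg norm hq'
    rw [norm_mul, norm_pow, Complex.norm_real, norm_norm] at this
    rw [← abs_of_nonneg (norm_nonneg Q), ← abs_of_nonneg (sq_nonneg ‖θ z‖), ← sq_eq_sq_iff_abs_eq_abs]
    linarith
  rw [hn] at hq'
  push_cast at hq'
  rw [mul_pow, ← pow_mul, inv_pow, mul_comm, ← mul_assoc, hq']
  exact mul_inv_cancel₀ (by rw [← hq']; exact pow_ne_zero _ h0)

/-! ### Conformal immersions, their lifts and changes of coordinate -/

section Conformal

variable {U : Set ℂ} {g : ℂ → EuclideanSpace ℝ (Fin 4)}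

theorem fderiv_conformal {z : ℂ} (h : ConformalAt g z) : ∃ r : ℝ, 0 < r ∧
    (∀ v, ‖fderiv ℝ g z v‖ = r * ‖v‖) ∧
    inner ℝ (fderiv ℝ g z 1) (fderiv ℝ g z I) = 0 := by
  obtain ⟨f', hf, c, hc, li, hli⟩ := h
  rw [hf.fderiv]
  refine ⟨|c|, abs_pos.2 hc, fun v => ?_, ?_⟩
  · rw [hli]; simp [norm_smul]
  · rw [hli]
    simp [inner_smul_left, inner_smul_right, Complex.inner]

theorem fderiv_ne_zero_of_conformal {z : ℂ} (h : ConformalAt g z) : fderiv ℝ g z 1 ≠ 0 := by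
  obtain ⟨r, hr, hn, -⟩ := fderiv_conformal h
  rw [← norm_ne_zero_iff, hn]
  simp [hr.ne']

theorem fderiv_euclideanLift {z : ℂ} (hg : DifferentiableAt ℝ g z) (v : ℂ) :
    fderiv ℝ (fun y k => ((euclideanLift (g y) k : ℝ) : ℂ)) z v =
      Fin.cons 0 fun k => ((fderiv ℝ g z v k : ℝ) : ℂ) := by
  have h : HasFDerivAt (fun y k => ((euclideanLift (g y) k : ℝ) : ℂ))
      (ContinuousLinearMap.pi (Fin.cons 0 fun k =>
        ofRealCLM ∘L (EuclideanSpace.proj k) ∘L fderiv ℝ g z)) z := by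
    refine hasFDerivAt_pi'.2 fun k => ?_
    refine Fin.cases ?_ (fun k => ?_) k
    · simpa [euclideanLift] using hasFDerivAt_const (1 : ℂ) z
    · exact ofRealCLM.hasFDerivAt.comp z
        ((EuclideanSpace.proj k : EuclideanSpace ℝ (Fin 4) →L[ℝ] ℝ).hasFDerivAt.comp z
          hg.hasFDerivAt)
  rw [h.fderiv]
  funext k
  refine Fin.cases ?_ (fun k => ?_) k <;> simp

/-- The Lorentz form restricted to derivatives of (1, g) is the Euclidean inner product of the
derivatives of g. Differentiating the factor e^{-u} adds only multiples of the null vector (1, g),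
which is orthogonal to its own derivatives. -/
theorem isNormalizedLift_normalizedLift (hU : IsOpen U) (hg : ContDiffOn ℝ ∞ g U)
    (hc : ∀ z ∈ U, ConformalAt g z) (hs : ∀ z ∈ U, ‖g z‖ = 1) :
    IsNormalizedLift U (fun _ => 1) (normalizedLift g) := by
  set G : ℂ → Fin 5 → ℂ := fun y k => ((euclideanLift (g y) k : ℝ) : ℂ) with hG
  set l : ℂ → ℂ := fun z => ((‖fderiv ℝ g z 1‖⁻¹ : ℝ) : ℂ) with hl
  have hψ : normalizedLift g = fun z => l z • G z := by
    funext z k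
    simp [normalizedLift, hG, hl]
  have hGs : ContDiffOn ℝ ∞ G U := by
    refine contDiffOn_pi.2 fun k => ?_
    refine Fin.cases ?_ (fun k => ?_) k
    · exact contDiffOn_const (c := ((1 : ℝ) : ℂ))
    · exact ofRealCLM.contDiff.comp_contDiffOn
        ((EuclideanSpace.proj k : EuclideanSpace ℝ (Fin 4) →L[ℝ] ℝ).contDiff.comp_contDiffOn hg)
  have hls : ContDiffOn ℝ ∞ l U := by
    have h1 : ContDiffOn ℝ ∞ (fun z => fderiv ℝ g z 1) U :=
      (hg.fderiv_of_isOpen hU (m := ∞) (by simp)).clm_apply contDiffOn_const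
    exact ofRealCLM.contDiff.comp_contDiffOn ((h1.norm ℝ fun z hz =>
      fderiv_ne_zero_of_conformal (hc z hz)).inv fun z hz =>
        norm_ne_zero_iff.2 (fderiv_ne_zero_of_conformal (hc z hz)))
  have hGG : ∀ z ∈ U, lorentz (G z) (G z) = 0 := by
    intro z hz
    have := hs z hz
    rw [EuclideanSpace.norm_eq, Real.sqrt_eq_one] at this
    simp only [Real.norm_eq_abs, sq_abs] at this
    have h2 : lorentz (G z) (G z) = ((-1 + ∑ k, (g z k) ^ 2 : ℝ) : ℂ) := by
      simp [lorentz, hG, euclideanLift, pow_two]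
    rw [h2, this]; simp
  have hd {z} (hz : z ∈ U) : DifferentiableAt ℝ g z :=
    (hg.contDiffAt (hU.mem_nhds hz)).differentiableAt (by simp)
  have hGd {z} (hz : z ∈ U) : DifferentiableAt ℝ G z := hGs.differentiableAt_of_isOpen hU hz
  have e1 : ∀ z ∈ U, lorentz (G z) (dz G z) = 0 := by
    intro z hz
    have := dz_congr hU hGG hz
    rw [dz_lorentz (hGd hz) (hGd hz), dz_const, lorentz_comm] at this
    linear_combination this / 2
  have e2 : ∀ z ∈ U, lorentz (G z) (dzbar G z) = 0 := by
    intro z hz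
    have := dzbar_congr hU hGG hz
    rw [dzbar_lorentz (hGd hz) (hGd hz), dzbar_const, lorentz_comm] at this
    linear_combination this / 2
  have hx (z) (hz : z ∈ U) : fderiv ℝ G z 1 = Fin.cons 0 fun k => ((fderiv ℝ g z 1 k : ℝ) : ℂ) :=
    fderiv_euclideanLift (hd hz) 1
  have hy (z) (hz : z ∈ U) : fderiv ℝ G z I = Fin.cons 0 fun k => ((fderiv ℝ g z I k : ℝ) : ℂ) :=
    fderiv_euclideanLift (hd hz) I
  have inn (u v : EuclideanSpace ℝ (Fin 4)) :
      lorentz (Fin.cons 0 fun k => ((u k : ℝ) : ℂ)) (Fin.cons 0 fun k => ((v k : ℝ) : ℂ)) =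
        ((inner ℝ u v : ℝ) : ℂ) := by
    simp [lorentz, PiLp.inner_apply, mul_comm]
  have key : ∀ z ∈ U, ∃ r : ℝ, 0 < r ∧ l z = (r : ℂ)⁻¹ ∧
      lorentz (fderiv ℝ G z 1) (fderiv ℝ G z 1) = r ^ 2 ∧
      lorentz (fderiv ℝ G z I) (fderiv ℝ G z I) = r ^ 2 ∧
      lorentz (fderiv ℝ G z 1) (fderiv ℝ G z I) = 0 := by
    intro z hz
    obtain ⟨r, hr, hn, hi⟩ := fderiv_conformal (hc z hz)
    refine ⟨r, hr, ?_, ?_, ?_, ?_⟩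
    · simp [hl, hn]
    · rw [hx z hz, inn, real_inner_self_eq_norm_sq, hn]; simp
    · rw [hy z hz, inn, real_inner_self_eq_norm_sq, hn]; simp
    · rw [hx z hz, hy z hz, inn, hi]; simp
  have dψ : ∀ z ∈ U, dz (normalizedLift g) z = dz l z • G z + l z • dz G z := by
    intro z hz
    rw [hψ, dz_smul (hls.differentiableAt_of_isOpen hU hz) (hGd hz)]
  have dψ' : ∀ z ∈ U, dzbar (normalizedLift g) z = dzbar l z • G z + l z • dzbar G z := by
    intro z hz
    rw [hψ, dzbar_smul (hls.differentiableAt_of_isOpen hU hz) (hGd hz)]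
  refine ⟨hU, differentiableOn_const _, fun _ _ => one_ne_zero, ?_, fun z hz => ?_,
    fun z hz => ?_, fun z hz => ?_, fun z hz => ?_⟩
  · rw [hψ]; exact hls.smul hGs
  · funext k; simp [normalizedLift]
  · rw [hψ, lorentz_smul_left, lorentz_smul_right, hGG z hz]; ring
  · obtain ⟨r, hr, hlr, h1, h2, h3⟩ := key z hz
    rw [wd_one, dψ z hz]
    simp only [lorentz_add_left, lorentz_add_right, lorentz_smul_left, lorentz_smul_right,
      hGG z hz, e1 z hz, lorentz_comm (dz G z) (G z)]
    simp only [dz, lorentz_sub_left, lorentz_sub_right, lorentz_smul_left, lorentz_smul_right, h1,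
      h2, h3, lorentz_comm (fderiv ℝ G z I) (fderiv ℝ G z 1)]
    linear_combination (1 / 4 * l z ^ 2 * r ^ 2) * I_sq
  · obtain ⟨r, hr, hlr, h1, h2, h3⟩ := key z hz
    rw [wd_one, wdb_one, dψ z hz, dψ' z hz]
    simp only [lorentz_add_left, lorentz_add_right, lorentz_smul_left, lorentz_smul_right,
      hGG z hz, e1 z hz, e2 z hz, lorentz_comm (dz G z) (G z)]
    simp only [dz, dzbar, lorentz_sub_left, lorentz_add_right, lorentz_smul_left,
      lorentz_smul_right, h1, h2, h3, lorentz_comm (fderiv ℝ G z I) (fderiv ℝ G z 1)]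
    have hr0 : (r : ℂ) ≠ 0 := by exact_mod_cast hr.ne'
    have : l z ^ 2 * r ^ 2 = 1 := by rw [hlr]; field_simp
    linear_combination (-1 / 4 * l z ^ 2 * r ^ 2) * I_sq + this / 2

theorem liftSchwarzian_eq_of_isSchwarzianOn
    (h : IsNormalizedLift U (fun _ => 1) (normalizedLift g)) {c : ℂ → ℂ}
    (hS : IsSchwarzianOn g U c) {z : ℂ} (hz : z ∈ U) :
    liftSchwarzian (fun _ => 1) (normalizedLift g) z = c z := by
  have := hS z hz (dz (dzbar (normalizedLift g)) z) (Submodule.subset_span (by simp))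
  have hpn := (h.isNullFrame hz).pn
  rw [wd_one, wdb_one] at hpn
  rw [lorentz_add_left, lorentz_smul_left, hpn] at this
  rw [liftSchwarzian, wd_one, wdb_one]
  linear_combination 4 * this

theorem differentiableOn_quartic (h : IsNormalizedLift U (fun _ => 1) (normalizedLift g))
    {c : ℂ → ℂ} (hS : IsSchwarzianOn g U c) (hc : DifferentiableOn ℂ c U) :
    DifferentiableOn ℂ (quartic g) U := by
  intro z hz
  refine DifferentiableAt.differentiableWithinAt ?_
  have hw : wdb (fun _ => 1) (liftSchwarzian (fun _ => 1) (normalizedLift g)) z = 0 := by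
    rw [wdb_congr h.isOpen (fun z hz => liftSchwarzian_eq_of_isSchwarzianOn h hS hz) hz, wdb_one,
      dzbar_of_holomorphic (hc.differentiableAt (h.isOpen.mem_nhds hz))]
  have h1 := h.wdb_quartic hz hw
  have hsm := (contDiffOn_lorentz h.smooth_k h.smooth_k).smul
    (contDiffOn_lorentz h.smooth_k h.smooth_k')
  have h2 := differentiableAt_of_dzbar_eq_zero (hsm.differentiableAt_of_isOpen h.isOpen hz)
    (by rw [wdb_one] at h1; exact h1)
  refine h2.congr_of_eventuallyEq ?_
  filter_upwards [h.isOpen.mem_nhds hz] with y hy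
  -- `lorentz_kk'` replaces the modulus in `quartic` by the smooth pairing ⟨ψ_zz, ψ_z̄z̄⟩, so zeros
  -- cause no loss of differentiability.
  simp only [quartic, Pi.smul_apply', smul_eq_mul]
  rw [h.lorentz_kk' hy, wd_one]

theorem dz_comp {E : Type*} [NormedAddCommGroup E] [NormedSpace ℂ E] {F : ℂ → E} {ζ : ℂ → ℂ}
    {z : ℂ} (hF : DifferentiableAt ℝ F (ζ z)) (hζ : DifferentiableAt ℂ ζ z) :
    dz (fun y => F (ζ y)) z = deriv ζ z • dz F (ζ z) := by
  have h (v : ℂ) : fderiv ℝ (fun y => F (ζ y)) z v = fderiv ℝ F (ζ z) (v * deriv ζ z) := by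
    have := fderiv_fun_comp z hF (hζ.restrictScalars ℝ)
    rw [this, ContinuousLinearMap.comp_apply, fderiv_of_holomorphic hζ, smul_eq_mul]
  rw [dz, h, h, fderiv_apply_eq_dz_add_dzbar, fderiv_apply_eq_dz_add_dzbar]
  simp only [map_mul, conj_I, one_mul, smul_add, smul_sub, smul_smul]
  match_scalars
  · ring_nf; rw [I_sq]; ring
  · ring_nf; rw [I_sq]; ring

theorem normalizedLift_comp {ζ : ℂ → ℂ} {z : ℂ} (hc : ConformalAt g (ζ z))
    (hζ : DifferentiableAt ℂ ζ z) : normalizedLift (fun y => g (ζ y)) z =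
      ((‖deriv ζ z‖⁻¹ : ℝ) : ℂ) • normalizedLift g (ζ z) := by
  obtain ⟨r, hr, hn, -⟩ := fderiv_conformal hc
  have h : fderiv ℝ (fun y => g (ζ y)) z 1 = fderiv ℝ g (ζ z) (deriv ζ z) := by
    have := fderiv_fun_comp z hc.differentiableAt (hζ.restrictScalars ℝ)
    rw [this, ContinuousLinearMap.comp_apply, fderiv_of_holomorphic hζ, one_smul]
  funext k
  simp [normalizedLift, h, hn]
  ring

/-- The lift of g ∘ ζ is ψ ∘ ζ divided by |ζ'|. Hence ⟨ψ_zz, ψ_zz⟩ is multiplied by ζ'⁴/|ζ'|² and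
its modulus by |ζ'|², which gives the weight ζ'⁴ of a holomorphic quartic differential. -/
theorem quartic_comp (h : IsNormalizedLift U (fun _ => 1) (normalizedLift g))
    (hc : ∀ z ∈ U, ConformalAt g z) {V : Set ℂ} {ζ : ℂ → ℂ} (hV : IsOpen V)
    (hζ : DifferentiableOn ℂ ζ V) (hζ0 : ∀ z ∈ V, deriv ζ z ≠ 0) (hVU : MapsTo ζ V U) {z : ℂ}
    (hz : z ∈ V) :
    quartic (fun y => g (ζ y)) z = deriv ζ z ^ 4 * quartic g (ζ z) := by
  have hζs := contDiffOn_real_of_holomorphic hV hζ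
  have hd {z} (hz : z ∈ V) : DifferentiableAt ℂ ζ z := hζ.differentiableAt (hV.mem_nhds hz)
  have hU := h.isOpen
  have hζ' : DifferentiableOn ℂ (deriv ζ) V := hζ.deriv hV
  have hs1 := contDiffOn_dz hU h.smooth
  have e : EqOn (normalizedLift (fun y => g (ζ y)))
      (fun y => ((‖(deriv ζ y)⁻¹‖ : ℝ) : ℂ) • normalizedLift g (ζ y)) V := by
    intro y hy
    simp only [norm_inv]
    exact normalizedLift_comp (hc _ (hVU hy)) (hd hy)
  have e' : ∀ y ∈ V, dz (normalizedLift (fun y => g (ζ y))) y =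
      dz (fun y => ((‖(deriv ζ y)⁻¹‖ : ℝ) : ℂ) • normalizedLift g (ζ y)) y :=
    fun y hy => dz_congr hV e hy
  have hf := h.isNullFrame (hVU hz)
  have hkp := h.kp (hVU hz)
  have hkq := h.kq (hVU hz)
  have hpq := hf.pq
  have hqq := hf.qq
  rw [wd_one] at hkp hkq hpq hqq
  have key := lorentz_wd_wd_smul (θ := fun _ => 1) (a := fun y => ((‖(deriv ζ y)⁻¹‖ : ℝ) : ℂ))
    (b := deriv ζ) (Ψ₀ := fun y => normalizedLift g (ζ y))
    (Ψ₁ := fun y => dz (normalizedLift g) (ζ y)) (Ψ₂ := fun y => dz (dz (normalizedLift g)) (ζ y))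
    hV (differentiableOn_const _) (fun _ _ => one_ne_zero)
    (contDiffOn_norm_holomorphic hV (hζ'.inv hζ0) fun z hz => inv_ne_zero (hζ0 z hz))
    (contDiffOn_real_of_holomorphic hV hζ') (h.smooth.comp hζs hVU) (hs1.comp hζs hVU)
    (fun y hy => by
      rw [wd_one]; exact dz_comp (h.smooth.differentiableAt_of_isOpen hU (hVU hy)) (hd hy))
    (fun y hy => by
      rw [wd_one]; exact dz_comp (hs1.differentiableAt_of_isOpen hU (hVU hy)) (hd hy))
    hz hf.pp hpq hqq hkp hkq
  rw [wd_one] at key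
  rw [quartic, quartic, dz_congr hV e' hz, key]
  set Q := lorentz (dz (dz (normalizedLift g)) (ζ z)) (dz (dz (normalizedLift g)) (ζ z))
  have h0 : (‖deriv ζ z‖ : ℂ) ≠ 0 := by exact_mod_cast norm_ne_zero_iff.2 (hζ0 z hz)
  simp only [norm_mul, norm_pow, norm_inv, Complex.norm_real, norm_norm]
  push_cast
  field_simp

end Conformal

/-! ### The frame equation and its integration -/

/-- The infinitesimal motion of the frame `ψ, ψ_s, ψ_t, ψ_{w w̄}, κ` along the first curvature
line, where `w = s + i t`. -/
def curvatureLineS (c : ℝ) : Matrix (Fin 5) (Fin 5) ℝ :=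
  !![0, -c, 0, 0, 0;
     1, 0, 0, -(2 + c / 2), -2;
     0, 0, 0, 0, 0;
     0, 2, 0, 0, 0;
     0, 2, 0, 0, 0]

/-- The infinitesimal motion of the frame along the second curvature line. -/
def curvatureLineT (c : ℝ) : Matrix (Fin 5) (Fin 5) ℝ :=
  !![0, 0, c, 0, 0;
     0, 0, 0, 0, 0;
     1, 0, 0, -2 + c / 2, 2;
     0, 0, 2, 0, 0;
     0, 0, -2, 0, 0]

theorem curvatureLineS_mul_T (c : ℝ) : curvatureLineS c * curvatureLineT c = 0 := by
  ext i j
  fin_cases i <;> fin_cases j <;>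
    simp [curvatureLineS, curvatureLineT, Matrix.mul_apply, Fin.sum_univ_five]
  ring

theorem curvatureLineT_mul_S (c : ℝ) : curvatureLineT c * curvatureLineS c = 0 := by
  ext i j
  fin_cases i <;> fin_cases j <;>
    simp [curvatureLineS, curvatureLineT, Matrix.mul_apply, Fin.sum_univ_five]
  ring

/-- Commutation is the integrability of a frame system with constant coefficients. Here even both
products vanish. -/
theorem commute_curvatureLine (c : ℝ) : Commute (curvatureLineS c) (curvatureLineT c) := by
  rw [Commute, SemiconjBy, curvatureLineS_mul_T, curvatureLineT_mul_S]

/-- The frame `ψ, ψ_s, ψ_t, ψ_{w w̄}, κ`, where `w = s + i t`. -/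
def frameVec (θ : ℂ → ℂ) (ψ : ℂ → Fin 5 → ℂ) : Fin 5 → ℂ → Fin 5 → ℂ :=
  ![ψ, fun z => wd θ ψ z + wdb θ ψ z, fun z => I • (wd θ ψ z - wdb θ ψ z), wd θ (wdb θ ψ),
    liftHopf θ ψ]

/-- The matrix whose columns are the vectors of the frame. -/
def realFrame (θ : ℂ → ℂ) (ψ : ℂ → Fin 5 → ℂ) (z : ℂ) : Matrix (Fin 5) (Fin 5) ℝ :=
  Matrix.of fun i j => (frameVec θ ψ j z i).re

namespace IsNormalizedLift

variable {U : Set ℂ} {θ : ℂ → ℂ} {ψ : ℂ → Fin 5 → ℂ} (h : IsNormalizedLift U θ ψ)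
include h

theorem smooth_frameVec (j : Fin 5) : ContDiffOn ℝ ∞ (frameVec θ ψ j) U := by
  have hq := h.smooth_wd h.smooth
  have hq' := h.smooth_wdb h.smooth
  fin_cases j
  · exact h.smooth
  · exact hq.add hq'
  · exact (contDiffOn_const (c := I)).smul (hq.sub hq')
  · exact h.smooth_n
  · exact h.smooth_liftHopf

variable (hQ : ∀ z ∈ U, lorentz (wd θ (wd θ ψ) z) (wd θ (wd θ ψ) z) = 1) {c : ℝ}
  (hc : ∀ z ∈ U, liftSchwarzian θ ψ z = c)
include hQ

theorem star_frameVec (j : Fin 5) {z : ℂ} (hz : z ∈ U) :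
    star (frameVec θ ψ j z) = frameVec θ ψ j z := by
  fin_cases j
  · exact h.real z hz
  · change star (wd θ ψ z + wdb θ ψ z) = wd θ ψ z + wdb θ ψ z
    rw [star_add, h.star_q hz, h.star_q' hz, add_comm]
  · change star (I • (wd θ ψ z - wdb θ ψ z)) = I • (wd θ ψ z - wdb θ ψ z)
    rw [star_smul, star_sub, h.star_q hz, h.star_q' hz, RCLike.star_def, conj_I]
    module
  · exact h.star_n hz
  · exact h.star_hopf hQ hz

theorem ofReal_realFrame {z : ℂ} (hz : z ∈ U) (i j : Fin 5) :
    (realFrame θ ψ z i j : ℂ) = frameVec θ ψ j z i :=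
  Complex.conj_eq_iff_re.1 (congrFun (h.star_frameVec hQ j hz) i)

include hc

/-- The structure equations in the flat coordinate w = s + it, with ds and dt read off from θ z * v.
Constancy of c makes the two coefficient matrices independent of the point. -/
theorem fderiv_frameVec {z : ℂ} (hz : z ∈ U) (j : Fin 5) (v : ℂ) :
    fderiv ℝ (frameVec θ ψ j) z v = ∑ k, (((θ z * v).re • curvatureLineS c +
      (θ z * v).im • curvatureLineT c) k j : ℂ) • frameVec θ ψ k z := by
  have hq := (h.smooth_wd h.smooth).differentiableAt_of_isOpen h.isOpen hz
  have hq' := (h.smooth_wdb h.smooth).differentiableAt_of_isOpen h.isOpen hz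
  have hk : wd θ (wd θ ψ) z = liftHopf θ ψ z - (c / 2 : ℂ) • ψ z := by
    rw [liftHopf, hc z hz]; module
  have hk' : wdb θ (wdb θ ψ) z = liftHopf θ ψ z - (c / 2 : ℂ) • ψ z := by
    rw [← hk, h.k_sub_k' hQ hz, h.conj_schwarzian hQ hz]; module
  have hn : wdb θ (wd θ ψ) z = wd θ (wdb θ ψ) z := (h.comm h.smooth hz).symm
  have hdn := h.wd_n hQ hz
  rw [hc z hz] at hdn
  have hdn' : wdb θ (wd θ (wdb θ ψ)) z =
      (-2 : ℂ) • wdb θ ψ z + (-(c / 2 : ℂ)) • wd θ ψ z := by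
    rw [← h.star_wd h.smooth_n (fun _ => h.star_n) hz, hdn, star_add, star_smul, star_smul,
      h.star_q hz, h.star_q' hz]
    simp
  have hdk := h.wd_hopf hQ hz
  have hdk' : wdb θ (liftHopf θ ψ) z = (-2 : ℂ) • wd θ ψ z := by
    rw [← h.star_wd h.smooth_liftHopf (fun _ => h.star_hopf hQ) hz, hdk, star_smul, h.star_q' hz]
    simp
  have d1 : fderiv ℝ (frameVec θ ψ j) z v = (θ z * v) • wd θ (frameVec θ ψ j) z +
    conj (θ z * v) • wdb θ (frameVec θ ψ j) z := fderiv_eq_wd_add_wdb (h.ne_zero z hz) _ v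
  rw [d1]
  obtain ⟨x, y, hxy⟩ : ∃ x y : ℝ, θ z * v = x + y * I := ⟨_, _, (Complex.re_add_im _).symm⟩
  have hcj : conj (θ z * v) = x - y * I := by rw [hxy]; simp [sub_eq_add_neg]
  have hre : (θ z * v).re = x := by rw [hxy]; simp
  have him : (θ z * v).im = y := by rw [hxy]; simp
  rw [hcj, hre, him, hxy, Fin.sum_univ_five]
  have key : ∀ j, (wd θ (frameVec θ ψ j) z, wdb θ (frameVec θ ψ j) z) =
      ![(wd θ ψ z, wdb θ ψ z),
        (wd θ (wd θ ψ) z + wd θ (wdb θ ψ) z, wdb θ (wd θ ψ) z + wdb θ (wdb θ ψ) z),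
        (I • (wd θ (wd θ ψ) z - wd θ (wdb θ ψ) z), I • (wdb θ (wd θ ψ) z - wdb θ (wdb θ ψ) z)),
        (wd θ (wd θ (wdb θ ψ)) z, wdb θ (wd θ (wdb θ ψ)) z),
        (wd θ (liftHopf θ ψ) z, wdb θ (liftHopf θ ψ) z)] j := by
    intro j
    have e2 : frameVec θ ψ 2 = fun z => I • wd θ ψ z + (-I) • wdb θ ψ z := by
      funext z
      change I • (wd θ ψ z - wdb θ ψ z) = _
      module
    fin_cases j
    · rfl
    · exact Prod.ext (wd_add hq hq') (wdb_add hq hq')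
    · change (wd θ (frameVec θ ψ 2) z, wdb θ (frameVec θ ψ 2) z) = (_, _)
      have a1 := (differentiableAt_const (𝕜 := ℝ) (x := z) I).fun_smul hq
      have a2 := (differentiableAt_const (𝕜 := ℝ) (x := z) (-I)).fun_smul hq'
      rw [e2, wd_add a1 a2, wdb_add a1 a2, wd_smul (differentiableAt_const _) hq,
        wd_smul (differentiableAt_const _) hq', wdb_smul (differentiableAt_const _) hq,
        wdb_smul (differentiableAt_const _) hq', wd_const, wd_const, wdb_const, wdb_const]
      refine Prod.ext ?_ ?_ <;> simp only <;> module
    · rfl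
    · rfl
  have k1 := congrArg Prod.fst (key j)
  have k2 := congrArg Prod.snd (key j)
  simp only at k1 k2
  rw [k1, k2, hdk, hdk', hdn, hdn', hk, hk', hn]
  clear k1 k2 key d1 hdk hdk' hdn hdn' hk hk' hn
  funext i
  fin_cases j <;>
    simp [frameVec, curvatureLineS, curvatureLineT] <;> ring_nf <;> (try rw [I_sq]) <;> ring

theorem fderiv_realFrame {z : ℂ} (hz : z ∈ U) (i j : Fin 5) (v : ℂ) :
    fderiv ℝ (fun z => realFrame θ ψ z i j) z v = (realFrame θ ψ z *
      ((θ z * v).re • curvatureLineS c + (θ z * v).im • curvatureLineT c)) i j := by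
  have hd := (h.smooth_frameVec j).differentiableAt_of_isOpen h.isOpen hz
  have h1 : HasFDerivAt (fun z => realFrame θ ψ z i j) (reCLM ∘L
      (ContinuousLinearMap.proj i : (Fin 5 → ℂ) →L[ℝ] ℂ) ∘L fderiv ℝ (frameVec θ ψ j) z) z :=
    reCLM.hasFDerivAt.comp z ((ContinuousLinearMap.proj i :
      (Fin 5 → ℂ) →L[ℝ] ℂ).hasFDerivAt.comp z hd.hasFDerivAt)
  rw [h1.fderiv]
  simp only [ContinuousLinearMap.comp_apply, h.fderiv_frameVec hQ hc hz, Matrix.mul_apply]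
  simp only [ContinuousLinearMap.proj_apply, Finset.sum_apply, Pi.smul_apply, reCLM_apply,
    Complex.re_sum, smul_eq_mul, Complex.re_ofReal_mul, realFrame, Matrix.of_apply]
  exact Finset.sum_congr rfl fun k _ => mul_comm _ _

omit hQ hc in
theorem differentiableAt_realFrame {z : ℂ} (hz : z ∈ U) (i j : Fin 5) :
    DifferentiableAt ℝ (fun z => realFrame θ ψ z i j) z := by
  have hd := (h.smooth_frameVec j).differentiableAt_of_isOpen h.isOpen hz
  exact reCLM.differentiableAt.comp z ((ContinuousLinearMap.proj i :
      (Fin 5 → ℂ) →L[ℝ] ℂ).differentiableAt.comp z hd)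

end IsNormalizedLift

/-- The functional `P` will be a matrix entry. In this form the result for matrices makes no
reference to the norm used to differentiate the exponential. -/
theorem hasFDerivAt_exp_smul_mul_exp_smul {𝔸 E : Type*} [NormedRing 𝔸] [NormedAlgebra ℝ 𝔸]
    [FiniteDimensional ℝ 𝔸] [NormedAddCommGroup E] [NormedSpace ℝ E] {x y : 𝔸} (hxy : Commute x y)
    {a b : E → ℝ} {a' b' : E →L[ℝ] ℝ} {z : E} (ha : HasFDerivAt a a' z) (hb : HasFDerivAt b b' z)
    (P : 𝔸 →ₗ[ℝ] ℝ) :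
    ∃ L : E →L[ℝ] ℝ, HasFDerivAt
      (fun z => P (NormedSpace.exp (a z • x) * NormedSpace.exp (b z • y))) L z ∧
      ∀ v, L v = P ((a' v • x + b' v • y) *
        (NormedSpace.exp (a z • x) * NormedSpace.exp (b z • y))) := by
  have : CompleteSpace 𝔸 := FiniteDimensional.complete ℝ 𝔸
  have h1 := (hasDerivAt_exp_smul_const' (𝕂 := ℝ) x (a z)).hasFDerivAt.comp z ha
  have h2 := (hasDerivAt_exp_smul_const' (𝕂 := ℝ) y (b z)).hasFDerivAt.comp z hb
  have h3 := h1.mul' h2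
  refine ⟨_, P.toContinuousLinearMap.hasFDerivAt.comp z h3, fun v => ?_⟩
  have hcomm : Commute (NormedSpace.exp (a z • x)) y :=
    ((hxy.symm.smul_right (a z)).exp_right).symm
  rw [ContinuousLinearMap.comp_apply, LinearMap.coe_toContinuousLinearMap']
  simp only [Function.comp_apply, add_apply, smul_apply, ContinuousLinearMap.comp_apply,
    ContinuousLinearMap.toSpanSingleton_apply, smul_eq_mul, op_smul_eq_mul]
  rw [add_comm]
  congr 1
  simp only [smul_mul_assoc, add_mul, mul_assoc]
  rw [mul_smul_comm, ← mul_assoc _ y, hcomm.eq, mul_assoc]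

/-! ### The two-parameter group exp(sA) exp(tB) -/

section ExpPair

variable {ι : Type*} [Fintype ι] [DecidableEq ι]

/-- The element `exp(sA) exp(tB)` of the group generated by `A` and `B`. -/
def expPair (A B : Matrix ι ι ℝ) (s t : ℝ) : Matrix ι ι ℝ :=
  NormedSpace.exp (s • A) * NormedSpace.exp (t • B)

theorem expPair_zero (A B : Matrix ι ι ℝ) : expPair A B 0 0 = 1 := by
  simp [expPair]

variable {A B : Matrix ι ι ℝ} (hAB : Commute A B)
include hAB

theorem expPair_eq (s t : ℝ) : expPair A B s t = NormedSpace.exp (s • A + t • B) :=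
  (Matrix.exp_add_of_commute _ _ ((hAB.smul_left s).smul_right t)).symm

theorem expPair_add (s t s' t' : ℝ) :
    expPair A B (s + s') (t + t') = expPair A B s t * expPair A B s' t' := by
  rw [expPair_eq hAB, expPair_eq hAB, expPair_eq hAB, ← Matrix.exp_add_of_commute]
  · congr 1; module
  · have := hAB.symm
    exact (((Commute.refl A).smul_left s |>.smul_right s').add_right
        ((hAB.smul_left s).smul_right t')).add_left
      (((this.smul_left t).smul_right s').add_right
        ((Commute.refl B).smul_left t |>.smul_right t'))

theorem expPair_neg_mul (s t : ℝ) : expPair A B (-s) (-t) * expPair A B s t = 1 := by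
  rw [← expPair_add hAB]; simp [expPair_zero]

theorem commute_expPair (s t x y : ℝ) : Commute (x • A + y • B) (expPair A B s t) := by
  open scoped Matrix.Norms.Operator in
  rw [expPair_eq hAB]
  refine Commute.exp_right ?_
  have := hAB.symm
  exact (((Commute.refl A).smul_left x |>.smul_right s).add_right
        ((hAB.smul_left x).smul_right t)).add_left
      (((this.smul_left y).smul_right s).add_right
        ((Commute.refl B).smul_left y |>.smul_right t))

theorem hasFDerivAt_expPair {E : Type*} [NormedAddCommGroup E] [NormedSpace ℝ E] {a b : E → ℝ}
    {a' b' : E →L[ℝ] ℝ} {z : E} (ha : HasFDerivAt a a' z) (hb : HasFDerivAt b b' z) (i j : ι) :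
    ∃ L : E →L[ℝ] ℝ, HasFDerivAt (fun z => expPair A B (a z) (b z) i j) L z ∧
      ∀ v, L v = ((a' v • A + b' v • B) * expPair A B (a z) (b z)) i j := by
  open scoped Matrix.Norms.Operator in
  exact hasFDerivAt_exp_smul_mul_exp_smul hAB ha hb
    { toFun := fun M => M i j, map_add' := fun _ _ => rfl, map_smul' := fun _ _ => rfl }

end ExpPair

theorem differentiableAt_matrix_mul {E ι : Type*} [Fintype ι] [NormedAddCommGroup E]
    [NormedSpace ℝ E] {F G : E → Matrix ι ι ℝ} {z : E}
    (hF : ∀ i j, DifferentiableAt ℝ (fun z => F z i j) z)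
    (hG : ∀ i j, DifferentiableAt ℝ (fun z => G z i j) z) (i j : ι) :
    DifferentiableAt ℝ (fun z => (F z * G z) i j) z := by
  simp only [Matrix.mul_apply]
  exact DifferentiableAt.fun_sum fun k _ => (hF i k).fun_mul (hG k j)

theorem fderiv_matrix_mul {E ι : Type*} [Fintype ι] [NormedAddCommGroup E]
    [NormedSpace ℝ E] {F G : E → Matrix ι ι ℝ} {z : E}
    (hF : ∀ i j, DifferentiableAt ℝ (fun z => F z i j) z)
    (hG : ∀ i j, DifferentiableAt ℝ (fun z => G z i j) z) (i j : ι) (v : E) :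
    fderiv ℝ (fun z => (F z * G z) i j) z v =
      ((Matrix.of fun i j => fderiv ℝ (fun z => F z i j) z v) * G z +
        F z * Matrix.of fun i j => fderiv ℝ (fun z => G z i j) z v) i j := by
  simp only [Matrix.mul_apply]
  rw [fderiv_fun_sum fun k _ => (hF i k).fun_mul (hG k j)]
  rw [sum_apply, Matrix.add_apply, Matrix.mul_apply, Matrix.mul_apply,
    ← Finset.sum_add_distrib]
  refine Finset.sum_congr rfl fun k _ => ?_
  rw [fderiv_fun_mul (hF i k) (hG k j)]
  simp only [add_apply, smul_apply, smul_eq_mul, Matrix.of_apply]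
  ring

/-- By the frame equation the product of the frame with exp(-sA - tB), where s + it = w - w(z₀), has
derivative zero; at z₀ it is the frame itself. -/
theorem IsNormalizedLift.realFrame_eq {U : Set ℂ} {θ : ℂ → ℂ} {ψ : ℂ → Fin 5 → ℂ}
    (h : IsNormalizedLift U θ ψ)
    (hQ : ∀ z ∈ U, lorentz (wd θ (wd θ ψ) z) (wd θ (wd θ ψ) z) = 1) {c : ℝ}
    (hc : ∀ z ∈ U, liftSchwarzian θ ψ z = c) (hU : IsPreconnected U) {w : ℂ → ℂ}
    (hw : ∀ z ∈ U, HasDerivAt w (θ z) z) {z₀ z : ℂ} (hz₀ : z₀ ∈ U) (hz : z ∈ U) :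
    realFrame θ ψ z = realFrame θ ψ z₀ *
      expPair (curvatureLineS c) (curvatureLineT c) (w z - w z₀).re (w z - w z₀).im := by
  have hAB := commute_curvatureLine c
  set A := curvatureLineS c with hA
  set B := curvatureLineT c with hB
  have hwd : ∀ y ∈ U, HasFDerivAt (fun y => w y - w z₀)
      ((ContinuousLinearMap.toSpanSingleton ℂ (θ y)).restrictScalars ℝ) y :=
    fun y hy => ((hw y hy).hasFDerivAt.restrictScalars ℝ).sub_const _
  have ha (y) (hy : y ∈ U) : HasFDerivAt (fun y => -(w y - w z₀).re) _ y :=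
    (reCLM.hasFDerivAt.comp y (hwd y hy)).neg
  have hb (y) (hy : y ∈ U) : HasFDerivAt (fun y => -(w y - w z₀).im) _ y :=
    (imCLM.hasFDerivAt.comp y (hwd y hy)).neg
  have hE (y) (hy : y ∈ U) (i j) : DifferentiableAt ℝ
      (fun y => expPair A B (-(w y - w z₀).re) (-(w y - w z₀).im) i j) y := by
    obtain ⟨L, hL, -⟩ := hasFDerivAt_expPair hAB (ha y hy) (hb y hy) i j
    exact hL.differentiableAt
  have hE' (y) (hy : y ∈ U) (i j) (v : ℂ) : fderiv ℝ
      (fun y => expPair A B (-(w y - w z₀).re) (-(w y - w z₀).im) i j) y v =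
      (-(((θ y * v).re • A + (θ y * v).im • B) *
        expPair A B (-(w y - w z₀).re) (-(w y - w z₀).im))) i j := by
    obtain ⟨L, hL, hv⟩ := hasFDerivAt_expPair hAB (ha y hy) (hb y hy) i j
    rw [hL.fderiv, hv, ← neg_mul]
    refine congrFun (congrFun (congrArg (· * _) ?_) i) j
    simp [mul_comm v]
    module
  have hF (y) (hy : y ∈ U) (i j) := h.differentiableAt_realFrame hy i j
  have hconst : realFrame θ ψ z * expPair A B (-(w z - w z₀).re) (-(w z - w z₀).im) =
      realFrame θ ψ z₀ := by
    ext i j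
    have := h.isOpen.is_const_of_fderiv_eq_zero (𝕜 := ℝ) hU
      (f := fun y => (realFrame θ ψ y * expPair A B (-(w y - w z₀).re) (-(w y - w z₀).im)) i j)
      (fun y hy => (differentiableAt_matrix_mul (hF y hy)
        (hE y hy) i j).differentiableWithinAt) (fun y hy => ?_) hz hz₀
    · simpa [expPair_zero] using this
    · ext v
      rw [fderiv_matrix_mul (hF y hy) (hE y hy)]
      have e1 : (Matrix.of fun i j => fderiv ℝ (fun z => realFrame θ ψ z i j) y v) =
          realFrame θ ψ y * ((θ y * v).re • A + (θ y * v).im • B) := by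
        ext i j; exact h.fderiv_realFrame hQ hc hy i j v
      have e2 : (Matrix.of fun i j => fderiv ℝ
          (fun y => expPair A B (-(w y - w z₀).re) (-(w y - w z₀).im) i j) y v) =
          -(((θ y * v).re • A + (θ y * v).im • B) *
            expPair A B (-(w y - w z₀).re) (-(w y - w z₀).im)) := by
        ext i j; exact hE' y hy i j v
      rw [e1, e2, mul_neg, mul_assoc, add_neg_cancel]
      simp
  rw [← hconst, mul_assoc, expPair_neg_mul hAB, mul_one]

/-- With F a primitive of h'/h on the disc, h e^{-F} is constant, and a fourth root of this constant
times e^{F/4} is a root of h. -/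
theorem exists_fourth_root {x : ℂ} {r : ℝ} {h : ℂ → ℂ} (hh : DifferentiableOn ℂ h (ball x r))
    (h0 : ∀ z ∈ ball x r, h z ≠ 0) : ∃ θ : ℂ → ℂ, DifferentiableOn ℂ θ (ball x r) ∧
      ∀ z ∈ ball x r, θ z ^ 4 = h z := by
  obtain hr | hr := le_or_gt r 0
  · rw [ball_eq_empty.2 hr]; exact ⟨0, differentiableOn_empty, by simp⟩
  obtain ⟨F, hF⟩ := ((hh.deriv isOpen_ball).div hh h0).isExactOn_ball
  have hk : ∀ z ∈ ball x r, h z * exp (-F z) = h x * exp (-F x) := by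
    intro z hz
    refine isOpen_ball.is_const_of_fderiv_eq_zero (𝕜 := ℂ) (convex_ball x r).isPreconnected
      (f := fun z => h z * exp (-F z)) (fun y hy => ?_) (fun y hy => ?_) hz (mem_ball_self hr)
    · exact ((hh y hy).mul ((hF y hy).neg.cexp.differentiableAt.differentiableWithinAt))
    · have h1 := (hh.differentiableAt (isOpen_ball.mem_nhds hy)).hasDerivAt.mul (hF y hy).neg.cexp
      have h2 : HasDerivAt (fun z => h z * exp (-F z)) 0 y := by
        refine HasDerivAt.congr_deriv h1 ?_
        have := h0 y hy
        change deriv h y * exp (-F y) + h y * (exp (-F y) * -(deriv h y / h y)) = 0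
        field_simp
        ring
      rw [h2.hasFDerivAt.fderiv]; simp
  obtain ⟨k, hk4⟩ := IsAlgClosed.exists_pow_nat_eq (h x * exp (-F x)) (n := 4) (by norm_num)
  refine ⟨fun z => k * exp (F z / 4), fun z hz => ?_, fun z hz => ?_⟩
  · exact (((hF z hz).div_const 4).cexp.const_mul k).differentiableAt.differentiableWithinAt
  · rw [mul_pow, hk4, ← hk z hz, ← Complex.exp_nat_mul, mul_assoc, ← Complex.exp_add]
    push_cast
    rw [show -F z + 4 * (F z / 4) = 0 by ring, Complex.exp_zero, mul_one]

/-! ### Flat coordinates and the exclusion of isolated zeros -/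

section Local

variable {g : ℂ → EuclideanSpace ℝ (Fin 4)} {U : Set ℂ}

/-- The lift of `g` that is normalized with respect to `w`, where `dw = θ dz`. -/
def scaledLift (θ : ℂ → ℂ) (g : ℂ → EuclideanSpace ℝ (Fin 4)) (z : ℂ) : Fin 5 → ℂ :=
  (‖θ z‖ : ℂ) • normalizedLift g z

theorem exists_flat_coordinate (h : IsNormalizedLift U (fun _ => 1) (normalizedLift g))
    (hq : DifferentiableOn ℂ (quartic g) U) {x : ℂ} {r : ℝ} (hB : ball x r ⊆ U)
    (h0 : ∀ z ∈ ball x r, quartic g z ≠ 0) :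
    ∃ (θ w : ℂ → ℂ) (c : ℝ), IsNormalizedLift (ball x r) θ (scaledLift θ g) ∧
      (∀ z ∈ ball x r, θ z ^ 4 = quartic g z) ∧ (∀ z ∈ ball x r, HasDerivAt w (θ z) z) ∧
      (∀ z ∈ ball x r, lorentz (wd θ (wd θ (scaledLift θ g)) z)
        (wd θ (wd θ (scaledLift θ g)) z) = 1) ∧
      ∀ z₀ ∈ ball x r, ∀ z ∈ ball x r, realFrame θ (scaledLift θ g) z =
        realFrame θ (scaledLift θ g) z₀ *
          expPair (curvatureLineS c) (curvatureLineT c) (w z - w z₀).re (w z - w z₀).im := by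
  obtain ⟨θ, hθ, hθ4⟩ := exists_fourth_root (hq.mono hB) h0
  have hθ0 : ∀ z ∈ ball x r, θ z ≠ 0 := by
    intro z hz h
    apply h0 z hz
    rw [← hθ4 z hz, h]; simp
  obtain ⟨w, hw⟩ := hθ.isExactOn_ball
  have hl := h.mono isOpen_ball hB
  have hs : IsNormalizedLift (ball x r) θ (scaledLift θ g) := hl.rescale hθ hθ0
  have hQ : ∀ z ∈ ball x r, lorentz (wd θ (wd θ (scaledLift θ g)) z)
      (wd θ (wd θ (scaledLift θ g)) z) = 1 := fun z hz => lorentz_rescale_eq_one hl hθ hθ0 hθ4 hz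
  obtain ⟨c, hc⟩ := hs.exists_schwarzian_eq hQ (convex_ball x r).isPreconnected
  exact ⟨θ, w, c, hs, hθ4, hw, hQ, fun z₀ hz₀ z hz =>
    hs.realFrame_eq hQ hc (convex_ball x r).isPreconnected hw hz₀ hz⟩

theorem continuous_expPair {ι : Type*} [Fintype ι] [DecidableEq ι] {A B : Matrix ι ι ℝ}
    (hAB : Commute A B) (i j : ι) : Continuous fun q : ℝ × ℝ => expPair A B q.1 q.2 i j := by
  rw [continuous_iff_continuousAt]
  intro q
  obtain ⟨L, hL, -⟩ := hasFDerivAt_expPair hAB (hasFDerivAt_fst (𝕜 := ℝ) (p := q)) hasFDerivAt_snd i j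
  exact hL.continuousAt

theorem exists_expPair_bound {A B : Matrix (Fin 5) (Fin 5) ℝ} (hAB : Commute A B)
    (F : Matrix (Fin 5) (Fin 5) ℝ) (j : Fin 5) (R : ℝ) :
    ∃ C : ℝ, 0 < C ∧ ∀ w : ℂ, ‖w‖ ≤ R → ∀ i, |(F * expPair A B w.re w.im) i j| ≤ C := by
  have hcont : Continuous fun w : ℂ => fun i => (F * expPair A B w.re w.im) i j := by
    refine continuous_pi fun i => ?_
    simp only [Matrix.mul_apply]
    exact continuous_finsetSum _ fun k _ => continuous_const.mul
      ((continuous_expPair hAB k j).comp (continuous_re.prodMk continuous_im))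
  obtain ⟨C, hC⟩ := (isCompact_closedBall (0 : ℂ) R).exists_bound_of_continuousOn hcont.continuousOn
  refine ⟨max C 1, by positivity, fun w hw i => ?_⟩
  exact ((norm_le_pi_norm _ i).trans (hC w (by simpa using hw))).trans (le_max_left _ _)

theorem norm_lorentz_le {v w : Fin 5 → ℂ} {a b : ℝ} (hv : ∀ i, ‖v i‖ ≤ a) (hw : ∀ i, ‖w i‖ ≤ b) :
    ‖lorentz v w‖ ≤ 5 * (a * b) := by
  have ha : 0 ≤ a := (norm_nonneg _).trans (hv 0)
  have h (i : Fin 5) : ‖v i * w i‖ ≤ a * b := by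
    rw [norm_mul]; exact mul_le_mul (hv i) (hw i) (norm_nonneg _) ha
  rw [lorentz]
  refine (norm_add_le _ _).trans ?_
  rw [norm_neg]
  have h2 : ‖∑ k : Fin 4, v k.succ * w k.succ‖ ≤ ∑ _k : Fin 4, a * b :=
    norm_sum_le_of_le _ fun k _ => h k.succ
  rw [Finset.sum_const, Finset.card_univ, Fintype.card_fin, nsmul_eq_mul] at h2
  push_cast at h2
  linarith [h 0]

/-- The zeros of the quartic differential are not isolated. -/
theorem quartic_ne_zero (h : IsNormalizedLift U (fun _ => 1) (normalizedLift g))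
    (hq : DifferentiableOn ℂ (quartic g) U) {z₀ : ℂ} (hz₀ : z₀ ∈ U)
    (hne : ¬ ∀ᶠ z in 𝓝 z₀, quartic g z = 0) : quartic g z₀ ≠ 0 := by
  intro hzero
  have hUn := h.isOpen.mem_nhds hz₀
  have han : AnalyticAt ℂ (quartic g) z₀ := hq.analyticAt hUn
  have hev := han.eventually_eq_zero_or_eventually_ne_zero.resolve_left hne
  rw [eventually_nhdsWithin_iff] at hev
  obtain ⟨r, hr, hball⟩ := Metric.nhds_basis_closedBall.mem_iff.1 (Filter.inter_mem hUn hev)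
  -- The disc about `x` of radius `r / 2` has z₀ on its boundary and contains no zero. A flat
  -- coordinate exists on it even if the fourth root branches at z₀.
  set x : ℂ := z₀ + (r / 2 : ℝ) with hx
  have hxz : dist x z₀ = r / 2 := by
    rw [hx, dist_eq_norm, add_sub_cancel_left, Complex.norm_real, Real.norm_of_nonneg (by positivity)]
  have hsub : ball x (r / 2) ⊆ closedBall z₀ r := by
    intro y hy
    have := dist_triangle y x z₀
    rw [mem_ball] at hy
    rw [mem_closedBall]; linarith
  have hz₀x : z₀ ∉ ball x (r / 2) := by
    rw [mem_ball, dist_comm, hxz]; exact lt_irrefl _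
  have h0 : ∀ z ∈ ball x (r / 2), quartic g z ≠ 0 := fun z hz =>
    (hball (hsub hz)).2 (fun h => hz₀x (h ▸ hz))
  have hBU : ball x (r / 2) ⊆ U := fun z hz => (hball (hsub hz)).1
  have hKU : closedBall z₀ r ⊆ U := fun z hz => (hball hz).1
  obtain ⟨θ, w, c, hs, hθ4, hw, hQ, hfr⟩ := exists_flat_coordinate h hq hBU h0
  obtain ⟨C₁, hC₁⟩ := (isCompact_closedBall z₀ r).exists_bound_of_continuousOn
    (hq.continuousOn.mono hKU)
  obtain ⟨C₂, hC₂⟩ := (isCompact_closedBall z₀ r).exists_bound_of_continuousOn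
    (h.smooth.continuousOn.mono hKU)
  have hθb : ∀ z ∈ ball x (r / 2), ‖θ z‖ ≤ C₁ + 1 := by
    intro z hz
    have h1 := hC₁ z (hsub hz)
    rw [← hθ4 z hz, norm_pow] at h1
    by_contra! hlt
    have h2 : 1 < ‖θ z‖ := by
      have : 0 ≤ C₁ := (pow_nonneg (norm_nonneg _) _).trans h1
      linarith
    have h3 : ‖θ z‖ ^ 1 ≤ ‖θ z‖ ^ 4 := pow_le_pow_right₀ h2.le (by norm_num)
    rw [pow_one] at h3
    linarith
  have hxm : x ∈ ball x (r / 2) := mem_ball_self (by positivity)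
  -- Bounded flat coordinates keep the frame in a compact set, in particular its column 3, which is
  -- ψ_{ww̄}.
  have hwb : ∀ z ∈ ball x (r / 2), ‖w z - w x‖ ≤ (C₁ + 1) * (r / 2) := by
    intro z hz
    have h1 := (convex_ball x (r / 2)).norm_image_sub_le_of_norm_hasDerivWithin_le
      (fun y hy => (hw y hy).hasDerivWithinAt) hθb hxm hz
    refine h1.trans ?_
    have hC : 0 ≤ C₁ + 1 := (norm_nonneg _).trans (hθb x hxm)
    rw [mem_ball, dist_eq_norm] at hz
    gcongr
  obtain ⟨C₃, hC₃, hC₃'⟩ := exists_expPair_bound (commute_curvatureLine c)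
    (realFrame θ (scaledLift θ g) x) 3 ((C₁ + 1) * (r / 2))
  have hnb : ∀ z ∈ ball x (r / 2), ∀ i, ‖wd θ (wdb θ (scaledLift θ g)) z i‖ ≤ C₃ := by
    intro z hz i
    have h1 := hC₃' _ (hwb z hz) i
    rw [← hfr x hxm z hz] at h1
    have h2 := hs.ofReal_realFrame hQ hz i 3
    change _ = wd θ (wdb θ (scaledLift θ g)) z i at h2
    rw [← h2, Complex.norm_real]
    exact h1
  -- The pairing -1/2 of the lift |θ|ψ with its ψ_{ww̄} bounds |θ| from below, as ψ and ψ_{ww̄} are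
  -- bounded. Since |θ|⁴ is the modulus of the quartic differential, this persists in the limit at
  -- z₀ and contradicts the zero there.
  have hkey : ∀ z ∈ ball x (r / 2), (1 / 2 : ℝ) ^ 4 ≤ ‖quartic g z‖ * (5 * (C₂ * C₃)) ^ 4 := by
    intro z hz
    have h1 := (hs.isNullFrame hz).pn
    rw [scaledLift, lorentz_smul_left] at h1
    have h2 := congrArg norm h1
    rw [norm_mul, Complex.norm_real, norm_norm] at h2
    have h3 := norm_lorentz_le (fun i => (norm_le_pi_norm _ i).trans (hC₂ z (hsub hz))) (hnb z hz)
    rw [← hθ4 z hz, norm_pow, ← mul_pow]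
    gcongr
    calc (1 / 2 : ℝ) = ‖(-1 / 2 : ℂ)‖ := by norm_num
      _ = _ := h2.symm
      _ ≤ _ := by gcongr
  have hcl : z₀ ∈ closure (ball x (r / 2)) := by
    rw [closure_ball _ (by positivity), mem_closedBall, dist_comm, hxz]
  have hcontq : ContinuousWithinAt (fun z => ‖quartic g z‖ * (5 * (C₂ * C₃)) ^ 4)
      (ball x (r / 2)) z₀ :=
    (han.continuousAt.norm.mul continuousAt_const).continuousWithinAt
  have : (𝓝[ball x (r / 2)] z₀).NeBot := mem_closure_iff_nhdsWithin_neBot.1 hcl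
  have hlim := ge_of_tendsto hcontq (eventually_nhdsWithin_of_forall hkey)
  norm_num [hzero] at hlim

end Local

/-! ### Totally umbilic pieces and 2-spheres -/

namespace IsNormalizedLift

variable {U : Set ℂ} {θ : ℂ → ℂ} {ψ : ℂ → Fin 5 → ℂ} (h : IsNormalizedLift U θ ψ)
include h

/-- Replacing ψ_w and ψ_w̄ by real combinations allows the kernel to be taken over ℝ. A vector
orthogonal to the real null vector ψ has non-negative square, and square zero is impossible because
the vector is a non-zero multiple of the complex unit normal. -/
theorem exists_real_normal {z : ℂ} (hz : z ∈ U) : ∃ n : Fin 5 → ℝ, 0 < lorentz n n ∧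
    lorentz (fun i => (n i : ℂ)) (ψ z) = 0 ∧ lorentz (fun i => (n i : ℂ)) (wd θ ψ z) = 0 ∧
    lorentz (fun i => (n i : ℂ)) (wdb θ ψ z) = 0 ∧
    lorentz (fun i => (n i : ℂ)) (wd θ (wdb θ ψ) z) = 0 := by
  have hf := h.isNullFrame hz
  set b : Fin 4 → Fin 5 → ℂ := ![ψ z, wd θ ψ z + wdb θ ψ z, I • (wd θ ψ z - wdb θ ψ z),
    wd θ (wdb θ ψ) z] with hb
  have hstar : ∀ k, star (b k) = b k := by
    intro k
    fin_cases k
    · exact h.real z hz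
    · change star (wd θ ψ z + wdb θ ψ z) = wd θ ψ z + wdb θ ψ z
      rw [star_add, h.star_q hz, h.star_q' hz, add_comm]
    · change star (I • (wd θ ψ z - wdb θ ψ z)) = I • (wd θ ψ z - wdb θ ψ z)
      rw [star_smul, star_sub, h.star_q hz, h.star_q' hz, RCLike.star_def, conj_I]
      module
    · exact h.star_n hz
  have hre : ∀ k, (fun i => ((b k i).re : ℂ)) = b k := fun k => funext fun i =>
    Complex.conj_eq_iff_re.1 (congrFun (hstar k) i)
  obtain ⟨n, hn0, hn⟩ : ∃ n : Fin 5 → ℝ, n ≠ 0 ∧ ∀ k, lorentz (fun i => (b k i).re) n = 0 := by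
    let T : (Fin 5 → ℝ) →ₗ[ℝ] (Fin 4 → ℝ) :=
      { toFun := fun x k => lorentz (fun i => (b k i).re) x
        map_add' := fun x y => funext fun i => lorentz_add_right _ _ _
        map_smul' := fun a x => funext fun i => lorentz_smul_right _ _ _ }
    obtain ⟨x, hx, hx0⟩ := (Submodule.ne_bot_iff _).1
      (LinearMap.ker_ne_bot_of_finrank_lt (f := T) (by simp))
    exact ⟨x, hx0, fun i => congrFun (LinearMap.mem_ker.1 hx) i⟩
  have hnb : ∀ k, lorentz (fun i => (n i : ℂ)) (b k) = 0 := by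
    intro k
    rw [← hre k, lorentz_ofReal, lorentz_comm, hn k, ofReal_zero]
  have hp : lorentz (fun i => (n i : ℂ)) (ψ z) = 0 := hnb 0
  have hs : lorentz (fun i => (n i : ℂ)) (wd θ ψ z + wdb θ ψ z) = 0 := hnb 1
  have ht : lorentz (fun i => (n i : ℂ)) (I • (wd θ ψ z - wdb θ ψ z)) = 0 := hnb 2
  have hN : lorentz (fun i => (n i : ℂ)) (wd θ (wdb θ ψ) z) = 0 := hnb 3
  rw [lorentz_smul_right, mul_eq_zero, lorentz_sub_right] at ht
  have ht' := ht.resolve_left I_ne_zero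
  rw [lorentz_add_right] at hs
  have hq : lorentz (fun i => (n i : ℂ)) (wd θ ψ z) = 0 := by linear_combination (hs + ht') / 2
  have hq' : lorentz (fun i => (n i : ℂ)) (wdb θ ψ z) = 0 := by linear_combination (hs - ht') / 2
  refine ⟨n, ?_, hp, hq, hq', hN⟩
  have hnstar : star (fun i => (n i : ℂ)) = fun i => (n i : ℂ) := by
    funext i; simp
  have h1 := sum_sq_le_of_lorentz_eq_zero (h.real z hz) (h.zero_ne hz) hf.pp hp
  rw [hnstar, lorentz_ofReal, ofReal_re] at h1
  refine lt_of_le_of_ne h1 fun h2 => hn0 ?_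
  obtain ⟨ξ, e1, ep, eq, eq', en, hv⟩ := hf.exists_unit_normal
  have h3 := hv _ hp hq hq' hN
  set a := lorentz (fun i => (n i : ℂ)) ξ
  have h4 : lorentz (fun i => (n i : ℂ)) (fun i => (n i : ℂ)) = 0 := by
    rw [lorentz_ofReal, ← h2, ofReal_zero]
  rw [h3, lorentz_smul_left, lorentz_smul_right, e1, mul_one, mul_self_eq_zero] at h4
  rw [h4, zero_smul] at h3
  funext i
  have h5 : (n i : ℂ) = 0 := congrFun h3 i
  exact_mod_cast h5

theorem normal_of_eventually {n : Fin 5 → ℂ} {z₀ : ℂ} (hz₀ : z₀ ∈ U)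
    (hn : ∀ᶠ z in 𝓝 z₀, lorentz n (ψ z) = 0) :
    lorentz n (ψ z₀) = 0 ∧ lorentz n (wd θ ψ z₀) = 0 ∧ lorentz n (wdb θ ψ z₀) = 0 ∧
      lorentz n (wd θ (wdb θ ψ) z₀) = 0 := by
  obtain ⟨V, hV, hVo, hz₀V⟩ := _root_.eventually_nhds_iff.1 hn
  have hl := h.mono (hVo.inter h.isOpen) inter_subset_right
  have hV0 : ∀ z ∈ V ∩ U, lorentz n (ψ z) = 0 := fun z hz => hV z hz.1
  have hc : ContDiffOn ℝ ∞ (fun _ : ℂ => n) (V ∩ U) := contDiffOn_const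
  have e1 : ∀ z ∈ V ∩ U, lorentz n (wd θ ψ z) = 0 := by
    intro z hz
    have := hl.leibniz_wd_const hc hl.smooth hV0 hz
    rw [wd_const, lorentz_zero_left] at this
    linear_combination this
  have e2 : ∀ z ∈ V ∩ U, lorentz n (wdb θ ψ z) = 0 := by
    intro z hz
    have := hl.leibniz_wdb_const hc hl.smooth hV0 hz
    rw [wdb_const, lorentz_zero_left] at this
    linear_combination this
  have hm : z₀ ∈ V ∩ U := ⟨hz₀V, hz₀⟩
  refine ⟨hV0 _ hm, e1 _ hm, e2 _ hm, ?_⟩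
  have := hl.leibniz_wd_const hc (hl.smooth_wdb hl.smooth) e2 hm
  rw [wd_const, lorentz_zero_left] at this
  linear_combination this

/-- When κ = 0 and c is holomorphic, derivatives of ψ, ψ_w, ψ_w̄, ψ_{ww̄} are combinations of these
four vectors. Their pairings with n therefore solve a homogeneous linear system along the segment
from z₀ to z, and Grönwall's inequality keeps them zero. -/
theorem lorentz_eq_zero_of_umbilic (hU : Convex ℝ U)
    (hQ : ∀ z ∈ U, lorentz (wd θ (wd θ ψ) z) (wd θ (wd θ ψ) z) = 0)
    (hc : ∀ z ∈ U, wdb θ (liftSchwarzian θ ψ) z = 0) {n : Fin 5 → ℂ} {z₀ : ℂ} (hz₀ : z₀ ∈ U)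
    (hp : lorentz n (ψ z₀) = 0) (hq : lorentz n (wd θ ψ z₀) = 0)
    (hq' : lorentz n (wdb θ ψ z₀) = 0) (hN : lorentz n (wd θ (wdb θ ψ) z₀) = 0) {z : ℂ}
    (hz : z ∈ U) : lorentz n (ψ z) = 0 := by
  have hk : ∀ y ∈ U, wd θ (wd θ ψ) y = (-(liftSchwarzian θ ψ y / 2)) • ψ y := by
    intro y hy
    obtain ⟨ξ, a, b, h1, hp, hq, hq', hn, ha, hb⟩ := h.exists_normal hy
    have hpξ : lorentz (ψ y) ξ = 0 := by rw [lorentz_comm, hp]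
    have e := hQ y hy
    rw [ha] at e
    simp only [lorentz_add_left, lorentz_add_right, lorentz_smul_left, lorentz_smul_right, h1, hp,
      hpξ, h.null y hy] at e
    have ha0 : a = 0 := by
      rw [← mul_self_eq_zero]; linear_combination e
    rw [ha, ha0]; module
  have hk' : ∀ y ∈ U, wdb θ (wdb θ ψ) y = (-(conj (liftSchwarzian θ ψ y) / 2)) • ψ y := by
    intro y hy
    rw [← h.star_k hy, hk y hy, star_smul, h.real y hy]
    simp
  have hdn : ∀ y ∈ U, wd θ (wd θ (wdb θ ψ)) y =
      (-(liftSchwarzian θ ψ y / 2)) • wdb θ ψ y := by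
    intro y hy
    have hcd := h.smooth_liftSchwarzian.differentiableAt_of_isOpen h.isOpen hy
    have hψ := h.smooth.differentiableAt_of_isOpen h.isOpen hy
    have e0 : (fun y => (-(liftSchwarzian θ ψ y / 2)) • ψ y) =
        fun y => (-1 / 2 : ℂ) • (liftSchwarzian θ ψ y • ψ y) := by
      funext y; module
    rw [← h.wdb_k hy, wdb_congr h.isOpen hk hy, e0,
      wdb_smul (differentiableAt_const _) (hcd.fun_smul hψ), wdb_const, wdb_smul hcd hψ, hc y hy]
    module
  have hdn' : ∀ y ∈ U, wdb θ (wd θ (wdb θ ψ)) y =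
      (-(conj (liftSchwarzian θ ψ y) / 2)) • wd θ ψ y := by
    intro y hy
    rw [← h.star_wd h.smooth_n (fun _ => h.star_n) hy, hdn y hy, star_smul, h.star_q' hy]
    simp
  have hn : ∀ y ∈ U, wdb θ (wd θ ψ) y = wd θ (wdb θ ψ) y := fun y hy => (h.comm h.smooth hy).symm
  set b : Fin 4 → ℂ → Fin 5 → ℂ := ![ψ, wd θ ψ, wdb θ ψ, wd θ (wdb θ ψ)] with hb
  have hbs : ∀ k, ContDiffOn ℝ ∞ (b k) U := by
    intro k
    fin_cases k
    · exact h.smooth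
    · exact h.smooth_wd h.smooth
    · exact h.smooth_wdb h.smooth
    · exact h.smooth_n
  have hγ : ∀ t ∈ Icc (0 : ℝ) 1, z₀ + t * (z - z₀) ∈ U := by
    intro t ht
    have := hU.add_smul_sub_mem hz₀ hz ht
    simpa using this
  have hγd : ∀ t : ℝ, HasDerivAt (fun t : ℝ => z₀ + t * (z - z₀)) (z - z₀) t := by
    intro t
    have := ((hasDerivAt_id t).ofReal_comp.mul_const (z - z₀)).const_add z₀
    simpa using this
  have hcont : ContinuousOn (fun t : ℝ => z₀ + t * (z - z₀)) (Icc 0 1) := by fun_prop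
  obtain ⟨C₁, hC₁⟩ := isCompact_Icc.exists_bound_of_continuousOn
    (h.smooth_liftSchwarzian.continuousOn.comp hcont hγ)
  obtain ⟨C₂, hC₂⟩ := isCompact_Icc.exists_bound_of_continuousOn
    (h.holo.continuousOn.comp hcont hγ)
  have h0m : (0 : ℝ) ∈ Icc (0 : ℝ) 1 := by simp
  have hC₁0 : 0 ≤ C₁ := (norm_nonneg _).trans (hC₁ 0 h0m)
  have hC₂0 : 0 ≤ C₂ := (norm_nonneg _).trans (hC₂ 0 h0m)
  have hder : ∀ t ∈ Icc (0 : ℝ) 1, HasDerivAt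
      (fun t : ℝ => fun k => lorentz n (b k (z₀ + t * (z - z₀))))
      (fun k => lorentz n (fderiv ℝ (b k) (z₀ + t * (z - z₀)) (z - z₀))) t := by
    intro t ht
    refine hasDerivAt_pi.2 fun k => ?_
    have hbd := ((hbs k).differentiableAt_of_isOpen h.isOpen (hγ t ht))
    have hd : DifferentiableAt ℝ (fun y => lorentz n (b k y)) (z₀ + t * (z - z₀)) :=
      (contDiffOn_lorentz contDiffOn_const (hbs k)).differentiableAt_of_isOpen h.isOpen (hγ t ht)
    have h2 := hd.hasFDerivAt.comp_hasDerivAt t (hγd t)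
    rw [fderiv_lorentz (differentiableAt_const _) hbd] at h2
    rw [fderiv_const_apply, zero_apply, lorentz_zero_left, zero_add] at h2
    exact h2
  -- Each derivative has a w-part and a w̄-part. Both are at most C₂‖z - z₀‖(1 + C₁/2) times the
  -- norm of the vector of pairings, where C₁ bounds c and C₂ bounds θ; their sum gives `K`.
  have hzero := eq_zero_of_abs_deriv_le_mul_abs_self_of_eq_zero_right (a := 0) (b := 1)
    (f := fun t : ℝ => fun k => lorentz n (b k (z₀ + t * (z - z₀))))
    (f' := fun t => fun k => lorentz n (fderiv ℝ (b k) (z₀ + t * (z - z₀)) (z - z₀)))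
    (K := C₂ * ‖z - z₀‖ * (2 + C₁))
    (fun t ht => (hder t ht).continuousAt.continuousWithinAt)
    (fun t ht => (hder t (Ico_subset_Icc_self ht)).hasDerivWithinAt) ?_ ?_ 1 (by simp)
  · have := congrFun hzero 0
    simpa [hb] using this
  · funext k
    simp only [ofReal_zero, zero_mul, add_zero]
    fin_cases k <;> assumption
  · intro t ht
    have ht' := Ico_subset_Icc_self ht
    set y := z₀ + t * (z - z₀) with hy
    have hyU : y ∈ U := hγ t ht'
    set u : Fin 4 → ℂ := fun k => lorentz n (b k y) with hu
    have hub (k) : ‖u k‖ ≤ ‖u‖ := norm_le_pi_norm u k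
    have hcb : ‖liftSchwarzian θ ψ y‖ ≤ C₁ := hC₁ t ht'
    have hθb : ‖θ y * (z - z₀)‖ ≤ C₂ * ‖z - z₀‖ := by
      rw [norm_mul]; gcongr; exact hC₂ t ht'
    have hθb' : ‖conj (θ y * (z - z₀))‖ ≤ C₂ * ‖z - z₀‖ := by
      rw [RCLike.norm_conj]; exact hθb
    have hcoef (a b : ℂ) (ha : ‖a‖ ≤ (1 + C₁ / 2) * ‖u‖) (hb : ‖b‖ ≤ (1 + C₁ / 2) * ‖u‖) :
        ‖θ y * (z - z₀) * a + conj (θ y * (z - z₀)) * b‖ ≤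
          C₂ * ‖z - z₀‖ * (2 + C₁) * ‖u‖ := by
      calc _ ≤ ‖θ y * (z - z₀)‖ * ‖a‖ + ‖conj (θ y * (z - z₀))‖ * ‖b‖ := by
            rw [← norm_mul, ← norm_mul]; exact norm_add_le _ _
        _ ≤ C₂ * ‖z - z₀‖ * ((1 + C₁ / 2) * ‖u‖) + C₂ * ‖z - z₀‖ * ((1 + C₁ / 2) * ‖u‖) := by
            gcongr
        _ = _ := by ring
    have hone (k) : ‖u k‖ ≤ (1 + C₁ / 2) * ‖u‖ := by
      have := mul_nonneg (div_nonneg hC₁0 zero_le_two) (norm_nonneg u)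
      linarith [hub k]
    have hcu (k) : ‖-(liftSchwarzian θ ψ y / 2) * u k‖ ≤ (1 + C₁ / 2) * ‖u‖ := by
      rw [norm_mul, norm_neg, norm_div]
      have h2 : ‖liftSchwarzian θ ψ y‖ / ‖(2 : ℂ)‖ ≤ 1 + C₁ / 2 := by
        simp only [Complex.norm_ofNat]; linarith
      gcongr
      exact hub k
    have hcu' (k) : ‖-(conj (liftSchwarzian θ ψ y) / 2) * u k‖ ≤ (1 + C₁ / 2) * ‖u‖ := by
      have := hcu k
      rw [norm_mul, norm_neg, norm_div] at this ⊢
      rwa [RCLike.norm_conj]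
    refine (pi_norm_le_iff_of_nonneg (by positivity)).2 fun k => ?_
    have hfd : lorentz n (fderiv ℝ (b k) y (z - z₀)) =
        θ y * (z - z₀) * lorentz n (wd θ (b k) y) +
          conj (θ y * (z - z₀)) * lorentz n (wdb θ (b k) y) := by
      rw [fderiv_eq_wd_add_wdb (h.ne_zero y hyU), lorentz_add_right, lorentz_smul_right,
        lorentz_smul_right]
    rw [hfd]
    fin_cases k
    · exact hcoef _ _ (hone 1) (hone 2)
    · refine hcoef _ _ ?_ ?_
      · change ‖lorentz n (wd θ (wd θ ψ) y)‖ ≤ _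
        rw [hk y hyU, lorentz_smul_right]; exact hcu 0
      · change ‖lorentz n (wdb θ (wd θ ψ) y)‖ ≤ _
        rw [hn y hyU]; exact hone 3
    · refine hcoef _ _ (hone 3) ?_
      change ‖lorentz n (wdb θ (wdb θ ψ) y)‖ ≤ _
      rw [hk' y hyU, lorentz_smul_right]; exact hcu' 0
    · refine hcoef _ _ ?_ ?_
      · change ‖lorentz n (wd θ (wd θ (wdb θ ψ)) y)‖ ≤ _
        rw [hdn y hyU, lorentz_smul_right]; exact hcu 2
      · change ‖lorentz n (wdb θ (wd θ (wdb θ ψ)) y)‖ ≤ _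
        rw [hdn' y hyU, lorentz_smul_right]; exact hcu' 1

end IsNormalizedLift

/-! ### Gram matrices and homogeneous surfaces -/

/-- The matrix of the Lorentz form. -/
def lorentzMatrix : Matrix (Fin 5) (Fin 5) ℝ := Matrix.diagonal ![-1, 1, 1, 1, 1]

/-- The Gram matrix of the frame `ψ, ψ_s, ψ_t, ψ_{w w̄}, κ` in a flat coordinate `w`. -/
def frameGram : Matrix (Fin 5) (Fin 5) ℝ :=
  !![0, 0, 0, -1 / 2, 0;
     0, 1, 0, 0, 0;
     0, 0, 1, 0, 0;
     -1 / 2, 0, 0, 1, 0;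
     0, 0, 0, 0, 1]

theorem lorentz_eq_dotProduct (v w : Fin 5 → ℝ) :
    lorentz v w = v ⬝ᵥ lorentzMatrix.mulVec w := by
  simp [lorentz_eq, lorentzMatrix, Matrix.mulVec_diagonal, dotProduct, Fin.sum_univ_five]

theorem transpose_mul_lorentzMatrix_mul_apply (F : Matrix (Fin 5) (Fin 5) ℝ) (i j : Fin 5) :
    (F.transpose * lorentzMatrix * F) i j = lorentz (fun k => F k i) (fun k => F k j) := by
  simp [Matrix.mul_apply, lorentz_eq, lorentzMatrix, Fin.sum_univ_five, Matrix.diagonal_apply]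

theorem isUnit_frameGram : IsUnit frameGram := by
  have : frameGram * !![-4, 0, 0, -2, 0; 0, 1, 0, 0, 0; 0, 0, 1, 0, 0; -2, 0, 0, 0, 0;
      0, 0, 0, 0, 1] = 1 := by
    ext i j
    fin_cases i <;> fin_cases j <;>
      simp [frameGram, Matrix.mul_apply, Fin.sum_univ_five] <;> norm_num
  exact IsUnit.of_mul_eq_one _ this

theorem isUnit_of_frameGram {F : Matrix (Fin 5) (Fin 5) ℝ}
    (h : F.transpose * lorentzMatrix * F = frameGram) : IsUnit F := by
  have h1 := congrArg Matrix.det h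
  rw [Matrix.det_mul, Matrix.det_mul, Matrix.det_transpose] at h1
  have h2 := (Matrix.isUnit_iff_isUnit_det _).1 isUnit_frameGram
  rw [Matrix.isUnit_iff_isUnit_det]
  rw [← h1] at h2
  exact isUnit_of_mul_isUnit_right h2

theorem isInfinitesimalLorentz_of_transpose {A : Matrix (Fin 5) (Fin 5) ℝ}
    (h : A.transpose * lorentzMatrix + lorentzMatrix * A = 0) : IsInfinitesimalLorentz A := by
  intro v w
  have e1 : lorentz (A.mulVec v) w = v ⬝ᵥ (A.transpose * lorentzMatrix).mulVec w := by
    rw [lorentz_eq_dotProduct, ← Matrix.mulVec_mulVec, Matrix.dotProduct_mulVec v,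
      Matrix.vecMul_transpose]
  have e2 : lorentz v (A.mulVec w) = v ⬝ᵥ (lorentzMatrix * A).mulVec w := by
    rw [lorentz_eq_dotProduct, ← Matrix.mulVec_mulVec]
  rw [e1, e2, ← dotProduct_add, ← Matrix.add_mulVec, h, Matrix.zero_mulVec, dotProduct_zero]

theorem curvatureLineS_skew (c : ℝ) :
    (curvatureLineS c).transpose * frameGram + frameGram * curvatureLineS c = 0 := by
  ext i j
  fin_cases i <;> fin_cases j <;>
    simp [curvatureLineS, frameGram, Matrix.mul_apply, Fin.sum_univ_five] <;> ring

theorem curvatureLineT_skew (c : ℝ) :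
    (curvatureLineT c).transpose * frameGram + frameGram * curvatureLineT c = 0 := by
  ext i j
  fin_cases i <;> fin_cases j <;>
    simp [curvatureLineT, frameGram, Matrix.mul_apply, Fin.sum_univ_five] <;> ring

/-- The matrix F carries the form `frameGram` to the Lorentz form, so conjugation by F carries one
orthogonal Lie algebra to the other. -/
theorem skew_conj {F X : Matrix (Fin 5) (Fin 5) ℝ}
    (hF : F.transpose * lorentzMatrix * F = frameGram)
    (hX : X.transpose * frameGram + frameGram * X = 0) :
    (F * X * F⁻¹).transpose * lorentzMatrix + lorentzMatrix * (F * X * F⁻¹) = 0 := by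
  have hu := (Matrix.isUnit_iff_isUnit_det _).1 (isUnit_of_frameGram hF)
  have hu' : IsUnit F.transpose.det := by rwa [Matrix.det_transpose]
  have e1 : lorentzMatrix = F.transpose⁻¹ * frameGram * F⁻¹ := by
    rw [← hF, ← mul_assoc, ← mul_assoc, Matrix.nonsing_inv_mul _ hu', one_mul, mul_assoc,
      Matrix.mul_nonsing_inv _ hu, mul_one]
  rw [Matrix.transpose_mul, Matrix.transpose_mul, Matrix.transpose_nonsing_inv]
  have e2 : F.transpose⁻¹ * (X.transpose * F.transpose) * lorentzMatrix =
      F.transpose⁻¹ * (X.transpose * frameGram) * F⁻¹ := by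
    rw [e1]
    simp only [mul_assoc]
    rw [← mul_assoc F.transpose, Matrix.mul_nonsing_inv _ hu', one_mul]
  have e3 : lorentzMatrix * (F * X * F⁻¹) = F.transpose⁻¹ * (frameGram * X) * F⁻¹ := by
    rw [e1]
    simp only [mul_assoc]
    rw [← mul_assoc F⁻¹ F, Matrix.nonsing_inv_mul _ hu, one_mul]
  rw [e2, e3, ← add_mul, ← mul_add, hX, mul_zero, zero_mul]

theorem commute_conj {F X Y : Matrix (Fin 5) (Fin 5) ℝ} (hF : IsUnit F) (h : Commute X Y) :
    Commute (F * X * F⁻¹) (F * Y * F⁻¹) := by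
  have hu := (Matrix.isUnit_iff_isUnit_det _).1 hF
  have e (X Y : Matrix (Fin 5) (Fin 5) ℝ) : F * X * F⁻¹ * (F * Y * F⁻¹) = F * (X * Y) * F⁻¹ := by
    simp only [mul_assoc]
    rw [← mul_assoc F⁻¹ F, Matrix.nonsing_inv_mul _ hu, one_mul]
  rw [Commute, SemiconjBy, e, e, h.eq]

/-- With G = `frameGram`, skewness says that the transpose of X is G(-X)G⁻¹, and exponentiation
commutes with transposition and conjugation. -/
theorem exp_transpose_mul_frameGram {X : Matrix (Fin 5) (Fin 5) ℝ}
    (hX : X.transpose * frameGram + frameGram * X = 0) :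
    (NormedSpace.exp X).transpose * frameGram * NormedSpace.exp X = frameGram := by
  have hu := (Matrix.isUnit_iff_isUnit_det _).1 isUnit_frameGram
  have h1 : X.transpose = frameGram * (-X) * frameGram⁻¹ := by
    have := eq_neg_of_add_eq_zero_left hX
    rw [mul_neg, ← this, mul_assoc, Matrix.mul_nonsing_inv _ hu, mul_one]
  rw [← Matrix.exp_transpose, h1, Matrix.exp_conj _ _ isUnit_frameGram, mul_assoc, mul_assoc,
    mul_assoc, ← mul_assoc frameGram⁻¹, Matrix.nonsing_inv_mul _ hu, one_mul,
    ← Matrix.exp_add_of_commute _ _ (Commute.refl X).neg_left, neg_add_cancel,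
    NormedSpace.exp_zero, mul_one]

theorem expPair_transpose_mul_frameGram (c s t : ℝ) :
    (expPair (curvatureLineS c) (curvatureLineT c) s t).transpose * frameGram *
      expPair (curvatureLineS c) (curvatureLineT c) s t = frameGram := by
  rw [expPair_eq (commute_curvatureLine c)]
  refine exp_transpose_mul_frameGram ?_
  have h1 := curvatureLineS_skew c
  have h2 := curvatureLineT_skew c
  have : (s • curvatureLineS c + t • curvatureLineT c).transpose * frameGram +
      frameGram * (s • curvatureLineS c + t • curvatureLineT c) =
      s • ((curvatureLineS c).transpose * frameGram + frameGram * curvatureLineS c) +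
      t • ((curvatureLineT c).transpose * frameGram + frameGram * curvatureLineT c) := by
    simp only [Matrix.transpose_add, Matrix.transpose_smul, add_mul, mul_add, smul_mul_assoc,
      mul_smul_comm, smul_add]
    abel
  rw [this, h1, h2, smul_zero, smul_zero, add_zero]

/-- The frame at the point with flat coordinates `q` of the homogeneous surface with initial
frame `F`. -/
def orbitFrame (F : Matrix (Fin 5) (Fin 5) ℝ) (c : ℝ) (q : ℝ × ℝ) : Matrix (Fin 5) (Fin 5) ℝ :=
  F * expPair (curvatureLineS c) (curvatureLineT c) q.1 q.2

/-- The homogeneous surface with initial frame `F`. -/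
def orbitPoint (F : Matrix (Fin 5) (Fin 5) ℝ) (c : ℝ) (q : ℝ × ℝ) : EuclideanSpace ℝ (Fin 4) :=
  lightConePoint fun i => orbitFrame F c q i 0

theorem lightConePoint_smul {a : ℝ} (ha : a ≠ 0) (v : Fin 5 → ℝ) :
    lightConePoint (a • v) = lightConePoint v := by
  simp only [lightConePoint, Pi.smul_apply, smul_eq_mul, mul_div_mul_left _ _ ha]

theorem lightConePoint_euclideanLift (x : EuclideanSpace ℝ (Fin 4)) :
    lightConePoint (euclideanLift x) = x := by
  ext k; simp [lightConePoint, euclideanLift]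

section Orbit

variable {F : Matrix (Fin 5) (Fin 5) ℝ} (hF : F.transpose * lorentzMatrix * F = frameGram) (c : ℝ)
include hF

theorem orbitFrame_gram (q : ℝ × ℝ) :
    (orbitFrame F c q).transpose * lorentzMatrix * orbitFrame F c q = frameGram := by
  rw [orbitFrame, Matrix.transpose_mul]
  simp only [mul_assoc]
  rw [← mul_assoc lorentzMatrix, ← mul_assoc F.transpose, ← mul_assoc F.transpose, hF,
    ← mul_assoc, expPair_transpose_mul_frameGram]

/-- Column 0 of the frame is null, so it would vanish altogether with its zeroth entry; but it pairs
to -1/2 with column 3. The quotients that define `orbitPoint` are therefore regular. -/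
theorem orbitFrame_zero_ne (q : ℝ × ℝ) : orbitFrame F c q 0 0 ≠ 0 := by
  intro h0
  have hg := orbitFrame_gram hF c q
  have h1 : lorentz (fun k => orbitFrame F c q k 0) (fun k => orbitFrame F c q k 0) = 0 := by
    rw [← transpose_mul_lorentzMatrix_mul_apply, hg]; simp [frameGram]
  have h2 := eq_zero_of_null h1 h0
  have h3 : lorentz (fun k => orbitFrame F c q k 0) (fun k => orbitFrame F c q k 3) = -1 / 2 := by
    rw [← transpose_mul_lorentzMatrix_mul_apply, hg]; simp [frameGram]
  rw [h2, lorentz_zero_left] at h3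
  norm_num at h3

omit hF in
theorem hasFDerivAt_orbitFrame (q : ℝ × ℝ) (i : Fin 5) : ∃ L : ℝ × ℝ →L[ℝ] ℝ,
    HasFDerivAt (fun q => orbitFrame F c q i 0) L q ∧
      ∀ v, L v = v.1 * orbitFrame F c q i 1 + v.2 * orbitFrame F c q i 2 := by
  have hAB := commute_curvatureLine c
  have h (k : Fin 5) := hasFDerivAt_expPair hAB (hasFDerivAt_fst (𝕜 := ℝ) (p := q))
    hasFDerivAt_snd k 0
  choose L hL hLv using h
  refine ⟨∑ k, F i k • L k, ?_, fun v => ?_⟩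
  · simp only [orbitFrame, Matrix.mul_apply]
    exact HasFDerivAt.fun_sum fun k _ => (hL k).const_mul (F i k)
  · have e1 : (∑ k, F i k • L k) v = (F * ((v.1 • curvatureLineS c + v.2 • curvatureLineT c) *
        expPair (curvatureLineS c) (curvatureLineT c) q.1 q.2)) i 0 := by
      rw [Matrix.mul_apply, sum_apply]
      refine Finset.sum_congr rfl fun k _ => ?_
      rw [smul_apply, hLv]; rfl
    rw [e1, (commute_expPair hAB _ _ _ _).eq, ← mul_assoc, ← orbitFrame, Matrix.mul_apply,
      Fin.sum_univ_five]
    simp [curvatureLineS, curvatureLineT]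
    ring

/-- If v is annihilated, the derivative of column 0 along v is a multiple of column 0. This
derivative is v.1 times column 1 plus v.2 times column 2, and the columns are independent since
their Gram matrix is invertible. -/
theorem fderiv_orbitPoint_injective (q : ℝ × ℝ) :
    Function.Injective (fderiv ℝ (orbitPoint F c) q) := by
  rw [injective_iff_map_eq_zero]
  intro v hv
  choose L hL hLv using hasFDerivAt_orbitFrame (F := F) c q
  have h0 := orbitFrame_zero_ne hF c q
  set Y := orbitFrame F c q with hY
  have hdp : DifferentiableAt ℝ (orbitPoint F c) q := differentiableAt_euclidean.2 fun k =>
    ((hL k.succ).differentiableAt.mul ((hL 0).differentiableAt.inv h0)).congr_of_eventuallyEq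
      (.of_forall fun _ => div_eq_mul_inv _ _)
  have hk : ∀ k : Fin 4, L k.succ v * Y 0 0 = Y k.succ 0 * L 0 v := by
    intro k
    have h1 := (EuclideanSpace.proj k : EuclideanSpace ℝ (Fin 4) →L[ℝ] ℝ).hasFDerivAt.comp q
      hdp.hasFDerivAt
    have h2 := h1.mul (hL 0)
    have e : (fun q => orbitFrame F c q k.succ 0) =
        (EuclideanSpace.proj k : EuclideanSpace ℝ (Fin 4) →L[ℝ] ℝ) ∘ orbitPoint F c *
          fun q => orbitFrame F c q 0 0 := by
      funext q
      exact (div_mul_cancel₀ _ (orbitFrame_zero_ne hF c q)).symm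
    rw [← e] at h2
    have h3 := congrArg (fun T : ℝ × ℝ →L[ℝ] ℝ => T v) (h2.unique (hL k.succ))
    simp only [add_apply, smul_apply, ContinuousLinearMap.comp_apply, hv, map_zero, smul_eq_mul] at h3
    have h4 : ((EuclideanSpace.proj k : EuclideanSpace ℝ (Fin 4) →L[ℝ] ℝ) ∘ orbitPoint F c) q
      * Y 0 0 = Y k.succ 0 := div_mul_cancel₀ _ h0
    rw [← h3, ← h4]
    ring
  have hall : ∀ i : Fin 5, L i v * Y 0 0 = Y i 0 * L 0 v := by
    intro i
    refine Fin.cases ?_ hk i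
    ring
  have hcomb : Y.mulVec ![-(L 0 v / Y 0 0), v.1, v.2, 0, 0] = 0 := by
    funext i
    have := hall i
    rw [hLv i] at this
    simp only [Matrix.mulVec, dotProduct, Fin.sum_univ_five, Matrix.cons_val, Pi.zero_apply]
    field_simp
    linarith
  have hu := isUnit_of_frameGram (orbitFrame_gram hF c q)
  have h6 := Matrix.mulVec_injective_of_isUnit hu (hcomb.trans (Matrix.mulVec_zero _).symm)
  have h7 : v.1 = 0 := congrFun h6 1
  have h8 : v.2 = 0 := congrFun h6 2
  exact Prod.ext h7 h8

/-- The conjugated group acts by F exp(X) F⁻¹, and (1, x) is proportional to the first column of F,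
so the orbit vector is proportional to the first column of F exp(X). The factor does not affect the
point of the light cone. -/
theorem orbitMap_eq_orbitPoint {x : S3} {a : ℝ} (ha : a ≠ 0)
    (hx : ∀ i, F i 0 = a * euclideanLift x i) :
    orbitMap (F * curvatureLineS c * F⁻¹) (F * curvatureLineT c * F⁻¹) x = orbitPoint F c := by
  funext q
  have hu := isUnit_of_frameGram hF
  have hud := (Matrix.isUnit_iff_isUnit_det _).1 hu
  have e1 : q.1 • (F * curvatureLineS c * F⁻¹) + q.2 • (F * curvatureLineT c * F⁻¹) =
      F * (q.1 • curvatureLineS c + q.2 • curvatureLineT c) * F⁻¹ := by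
    simp only [mul_add, add_mul, mul_smul_comm, smul_mul_assoc]
  have e2 : (euclideanLift x) = a⁻¹ • F.mulVec (Pi.single 0 1) := by
    funext i
    rw [Matrix.mulVec_single_one, Pi.smul_apply, Matrix.col_apply, hx, smul_eq_mul]
    field_simp
  rw [orbitMap, e1, Matrix.exp_conj _ _ hu, ← expPair_eq (commute_curvatureLine c), e2,
    Matrix.mulVec_smul, lightConePoint_smul (inv_ne_zero ha), Matrix.mulVec_mulVec, mul_assoc,
    Matrix.nonsing_inv_mul _ hud, mul_one, Matrix.mulVec_single_one, orbitPoint]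
  rfl

end Orbit

theorem IsNormalizedLift.realFrame_gram {U : Set ℂ} {θ : ℂ → ℂ} {ψ : ℂ → Fin 5 → ℂ}
    (h : IsNormalizedLift U θ ψ)
    (hQ : ∀ z ∈ U, lorentz (wd θ (wd θ ψ) z) (wd θ (wd θ ψ) z) = 1) {z : ℂ} (hz : z ∈ U) :
    (realFrame θ ψ z).transpose * lorentzMatrix * realFrame θ ψ z = frameGram := by
  have hf := h.isNullFrame hz
  ext i j
  have key : ((((realFrame θ ψ z).transpose * lorentzMatrix * realFrame θ ψ z) i j : ℝ) : ℂ) =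
      lorentz (frameVec θ ψ i z) (frameVec θ ψ j z) := by
    rw [transpose_mul_lorentzMatrix_mul_apply, ← lorentz_ofReal]
    simp only [h.ofReal_realFrame hQ hz]
  have hnn := (h.nn hz).trans (h.kk'_eq_one hQ hz)
  have hkk := h.hopf_hopf hQ hz
  have hkp := h.hopf_p hz
  have hkq := h.hopf_q hz
  have hkq' := h.hopf_q' hz
  have hkn := h.hopf_n hz
  have hpk := lorentz_comm (liftHopf θ ψ z) (ψ z)
  have : lorentz (frameVec θ ψ i z) (frameVec θ ψ j z) = (frameGram i j : ℂ) := by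
    fin_cases i <;> fin_cases j <;>
      simp [frameVec, frameGram, lorentz_add_left, lorentz_add_right, lorentz_sub_left,
        lorentz_sub_right, lorentz_smul_left, lorentz_smul_right, hf.pp, hf.pq, hf.pq', hf.pn,
        hf.qq, hf.qq', hf.q'q', hf.qn, hf.q'n, hnn, hkk, hkp, hkq, hkq', hkn,
        lorentz_comm _ (ψ z), lorentz_comm _ (liftHopf θ ψ z),
        lorentz_comm (wdb θ ψ z) (wd θ ψ z), lorentz_comm (wd θ (wdb θ ψ) z) (wd θ ψ z),
        lorentz_comm (wd θ (wdb θ ψ) z) (wdb θ ψ z)]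
    · norm_num
    · ring_nf
      rw [I_sq]
      norm_num
  rw [this] at key
  exact_mod_cast key

/-- Repeated differentiation of ⟨n, ψ⟩ = 0 shows that n is orthogonal to the frame and to ψ_ww. Then
κ is orthogonal to the frame and to its normal n, so κ = 0. -/
theorem IsNormalizedLift.eventually_umbilic {U : Set ℂ} {θ : ℂ → ℂ} {ψ : ℂ → Fin 5 → ℂ}
    (h : IsNormalizedLift U θ ψ) {n : Fin 5 → ℂ} (hn0 : n ≠ 0) {z₀ : ℂ} (hz₀ : z₀ ∈ U)
    (hn : ∀ᶠ z in 𝓝 z₀, lorentz n (ψ z) = 0) :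
    ∀ᶠ z in 𝓝 z₀, lorentz (wd θ (wd θ ψ) z) (wd θ (wd θ ψ) z) = 0 := by
  obtain ⟨V, hV, hVo, hz₀V⟩ := _root_.eventually_nhds_iff.1 hn
  have hl := h.mono (hVo.inter h.isOpen) inter_subset_right
  have hV' : ∀ z ∈ V ∩ U, ∀ᶠ y in 𝓝 z, lorentz n (ψ y) = 0 := fun z hz =>
    eventually_of_mem (hVo.mem_nhds hz.1) hV
  filter_upwards [hl.isOpen.mem_nhds ⟨hz₀V, hz₀⟩] with z hz
  obtain ⟨hp, hq, hq', hN⟩ := hl.normal_of_eventually hz (hV' z hz)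
  have hf := hl.isNullFrame hz
  have hc : ContDiffOn ℝ ∞ (fun _ : ℂ => n) (V ∩ U) := contDiffOn_const
  have hk := hl.leibniz_wd_const hc (hl.smooth_wd hl.smooth)
    (fun y hy => (hl.normal_of_eventually hy (hV' y hy)).2.1) hz
  rw [wd_const, lorentz_zero_left] at hk
  have h0 : liftHopf θ ψ z = 0 := by
    refine hf.eq_zero_of_orthogonal hn0 ?_ ?_ ?_ ?_ (hl.hopf_p hz) (hl.hopf_q hz) (hl.hopf_q' hz)
      (hl.hopf_n hz) ?_
    · rw [lorentz_comm, hp]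
    · rw [lorentz_comm, hq]
    · rw [lorentz_comm, hq']
    · rw [lorentz_comm, hN]
    · rw [lorentz_comm, liftHopf, lorentz_add_right, lorentz_smul_right, hp]
      linear_combination hk
  have h1 : lorentz (wd θ (wd θ ψ) z) (liftHopf θ ψ z) = 0 := by rw [h0, lorentz_zero_right]
  rw [liftHopf, lorentz_add_right, lorentz_smul_right, hl.kp hz] at h1
  linear_combination h1

theorem quartic_congr {U : Set ℂ} (hU : IsOpen U) {g g' : ℂ → EuclideanSpace ℝ (Fin 4)}
    (h : EqOn g g' U) {z : ℂ} (hz : z ∈ U) : quartic g z = quartic g' z := by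
  have h1 : EqOn (normalizedLift g) (normalizedLift g') U := by
    intro y hy
    have : g =ᶠ[𝓝 y] g' := eventually_of_mem (hU.mem_nhds hy) h
    funext k
    simp only [normalizedLift, this.fderiv_eq, h hy]
  have h2 : EqOn (dz (normalizedLift g)) (dz (normalizedLift g')) U := fun y hy =>
    dz_congr hU h1 hy
  rw [quartic, quartic, dz_congr hU h2 hz]

theorem quartic_eq_zero_iff {g : ℂ → EuclideanSpace ℝ (Fin 4)} {z : ℂ} : quartic g z = 0 ↔
    lorentz (dz (dz (normalizedLift g)) z) (dz (dz (normalizedLift g)) z) = 0 := by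
  simp [quartic]

theorem lorentz_normalizedLift (n : Fin 5 → ℝ) (g : ℂ → EuclideanSpace ℝ (Fin 4)) (z : ℂ) :
    lorentz (fun i => (n i : ℂ)) (normalizedLift g z) =
      ((‖fderiv ℝ g z 1‖⁻¹ * lorentz n (euclideanLift (g z)) : ℝ) : ℂ) := by
  have := lorentz_ofReal n (‖fderiv ℝ g z 1‖⁻¹ • euclideanLift (g z))
  rw [lorentz_smul_right] at this
  exact this

/-! ### Surface patches with holomorphic Schwarzian -/

/-- Conformal immersions of plane domains into `S³` with holomorphic Schwarzian. -/
structure IsSchwarzianPatch (U : Set ℂ) (g : ℂ → EuclideanSpace ℝ (Fin 4)) : Prop where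
  lift : IsNormalizedLift U (fun _ => 1) (normalizedLift g)
  conformal : ∀ z ∈ U, ConformalAt g z
  quartic : DifferentiableOn ℂ (quartic g) U
  schwarzian : ∀ z ∈ U, wdb (fun _ => 1) (liftSchwarzian (fun _ => 1) (normalizedLift g)) z = 0

namespace IsSchwarzianPatch

variable {U : Set ℂ} {g : ℂ → EuclideanSpace ℝ (Fin 4)} (h : IsSchwarzianPatch U g)
include h

theorem lorentz_normalizedLift_eq_zero_iff (n : Fin 5 → ℝ) {z : ℂ} (hz : z ∈ U) :
    lorentz (fun i => (n i : ℂ)) (normalizedLift g z) = 0 ↔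
      lorentz n (euclideanLift (g z)) = 0 := by
  have := fderiv_ne_zero_of_conformal (h.conformal z hz)
  rw [lorentz_normalizedLift, ofReal_eq_zero, mul_eq_zero, inv_eq_zero, norm_eq_zero]
  simp [this]

/-- Near z₁ the surface is umbilic, so the quartic differential vanishes near z₁ and, by the
identity theorem, on the disc. The whole disc is then umbilic, and the orthogonality to n spreads
over it. -/
theorem eqOn_twoSphere {n : Fin 5 → ℝ} (hn0 : n ≠ 0) {x : ℂ} {r : ℝ} (hB : ball x r ⊆ U)
    {z₁ : ℂ} (hz₁ : z₁ ∈ ball x r)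
    (hn : ∀ᶠ z in 𝓝 z₁, lorentz n (euclideanLift (g z)) = 0) {z : ℂ} (hz : z ∈ ball x r) :
    lorentz n (euclideanLift (g z)) = 0 := by
  have hl := h.lift.mono isOpen_ball hB
  have hnC : (fun i => (n i : ℂ)) ≠ 0 := by
    intro h0
    apply hn0
    funext i
    have h1 : (n i : ℂ) = 0 := congrFun h0 i
    exact_mod_cast h1
  have hn' : ∀ᶠ z in 𝓝 z₁, lorentz (fun i => (n i : ℂ)) (normalizedLift g z) = 0 := by
    filter_upwards [hn, h.lift.isOpen.mem_nhds (hB hz₁)] with y hy hyU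
    exact (h.lorentz_normalizedLift_eq_zero_iff n hyU).2 hy
  have hk := hl.eventually_umbilic hnC hz₁ hn'
  rw [wd_one] at hk
  have hq0 : EqOn (_root_.quartic g) 0 (ball x r) := by
    have ha : AnalyticOnNhd ℂ (_root_.quartic g) (ball x r) :=
      (h.quartic.mono hB).analyticOnNhd isOpen_ball
    refine ha.eqOn_zero_of_preconnected_of_eventuallyEq_zero (convex_ball x r).isPreconnected hz₁ ?_
    filter_upwards [hk] with y hy
    exact quartic_eq_zero_iff.2 hy
  obtain ⟨hp, hq, hq', hN⟩ := hl.normal_of_eventually hz₁ hn'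
  refine (h.lorentz_normalizedLift_eq_zero_iff n (hB hz)).1 ?_
  refine hl.lorentz_eq_zero_of_umbilic (convex_ball x r) (fun y hy => ?_)
    (fun y hy => h.schwarzian y (hB hy)) hz₁ hp hq hq' hN hz
  rw [wd_one]
  exact quartic_eq_zero_iff.1 (hq0 hy)

theorem exists_twoSphere {z₀ : ℂ} (hz₀ : z₀ ∈ U) (h0 : ∀ᶠ z in 𝓝 z₀, _root_.quartic g z = 0) :
    ∃ n : Fin 5 → ℝ, 0 < lorentz n n ∧ ∀ᶠ z in 𝓝 z₀, lorentz n (euclideanLift (g z)) = 0 := by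
  obtain ⟨r, hr, hball⟩ := Metric.nhds_basis_ball.mem_iff.1
    (Filter.inter_mem (h.lift.isOpen.mem_nhds hz₀) h0)
  have hB : ball z₀ r ⊆ U := fun z hz => (hball hz).1
  obtain ⟨n, hn, hp, hq, hq', hN⟩ := h.lift.exists_real_normal hz₀
  refine ⟨n, hn, ?_⟩
  filter_upwards [ball_mem_nhds z₀ hr] with z hz
  refine (h.lorentz_normalizedLift_eq_zero_iff n (hB hz)).1 ?_
  refine (h.lift.mono isOpen_ball hB).lorentz_eq_zero_of_umbilic (convex_ball z₀ r)
    (fun y hy => ?_) (fun y hy => h.schwarzian y (hB hy)) (mem_ball_self hr) hp hq hq' hN hz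
  rw [wd_one]
  exact quartic_eq_zero_iff.1 (hball hy).2

theorem quartic_transition {V : Set ℂ} {ζ : ℂ → ℂ} {g' : ℂ → EuclideanSpace ℝ (Fin 4)}
    (hV : IsOpen V) (hζ : DifferentiableOn ℂ ζ V) (hζ0 : ∀ z ∈ V, deriv ζ z ≠ 0)
    (hVU : MapsTo ζ V U) (hg : ∀ z ∈ V, g' z = g (ζ z)) {z : ℂ} (hz : z ∈ V) :
    _root_.quartic g' z = deriv ζ z ^ 4 * _root_.quartic g (ζ z) := by
  rw [← quartic_comp h.lift h.conformal hV hζ hζ0 hVU hz]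
  exact quartic_congr hV hg hz

end IsSchwarzianPatch

/-! ### Analytic continuation of homogeneous parametrizations -/

theorem analyticOnNhd_orbitFrame {F : Matrix (Fin 5) (Fin 5) ℝ} {c : ℝ} {B : Set ℂ}
    (hB : IsOpen B) {w : ℂ → ℂ} (hw : DifferentiableOn ℂ w B) (i : Fin 5) :
    AnalyticOnNhd ℝ (fun z => orbitFrame F c ((w z).re, (w z).im) i 0) B := by
  open scoped Matrix.Norms.Operator in
  intro z hz
  have hwa : AnalyticAt ℝ w z := (hw.analyticAt (hB.mem_nhds hz)).restrictScalars
  have hre : AnalyticAt ℝ (fun z => (w z).re) z := (reCLM.analyticAt _).comp hwa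
  have him : AnalyticAt ℝ (fun z => (w z).im) z := (imCLM.analyticAt _).comp hwa
  have h1 : AnalyticAt ℝ (fun z => (w z).re • curvatureLineS c + (w z).im • curvatureLineT c) z :=
    (hre.smul analyticAt_const).add (him.smul analyticAt_const)
  have h2 : AnalyticAt ℝ (fun z => NormedSpace.exp
      ((w z).re • curvatureLineS c + (w z).im • curvatureLineT c)) z :=
    (NormedSpace.exp_analytic (𝕂 := ℝ) _).comp h1
  have h3 : AnalyticAt ℝ (fun z => F * NormedSpace.exp
      ((w z).re • curvatureLineS c + (w z).im • curvatureLineT c)) z := analyticAt_const.mul h2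
  have h4 := ((Matrix.entryLinearMap ℝ ℝ i (0 : Fin 5)).toContinuousLinearMap.analyticAt _).comp h3
  simp only [orbitFrame, expPair_eq (commute_curvatureLine c)]
  exact h4

theorem analyticOnNhd_orbitPoint {F : Matrix (Fin 5) (Fin 5) ℝ}
    (hF : F.transpose * lorentzMatrix * F = frameGram) {c : ℝ} {B : Set ℂ}
    (hB : IsOpen B) {w : ℂ → ℂ} (hw : DifferentiableOn ℂ w B) (k : Fin 4) :
    AnalyticOnNhd ℝ (fun z => orbitPoint F c ((w z).re, (w z).im) k) B :=
  (analyticOnNhd_orbitFrame hB hw k.succ).div (analyticOnNhd_orbitFrame hB hw 0)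
    fun _ _ => orbitFrame_zero_ne hF c _

/-- Both sides are real analytic in z, because the matrix exponential is analytic and w, w' are
holomorphic; the identity theorem applies. -/
theorem orbitPoint_eqOn {F F' : Matrix (Fin 5) (Fin 5) ℝ}
    (hF : F.transpose * lorentzMatrix * F = frameGram)
    (hF' : F'.transpose * lorentzMatrix * F' = frameGram) {c c' : ℝ} {B : Set ℂ}
    (hB : IsOpen B) (hBc : IsPreconnected B) {w w' : ℂ → ℂ} (hw : DifferentiableOn ℂ w B)
    (hw' : DifferentiableOn ℂ w' B) {z₁ : ℂ} (hz₁ : z₁ ∈ B)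
    (h : ∀ᶠ z in 𝓝 z₁, orbitPoint F c ((w z).re, (w z).im) =
      orbitPoint F' c' ((w' z).re, (w' z).im)) {z : ℂ} (hz : z ∈ B) :
    orbitPoint F c ((w z).re, (w z).im) = orbitPoint F' c' ((w' z).re, (w' z).im) := by
  ext k
  exact (analyticOnNhd_orbitPoint hF hB hw k).eqOn_of_preconnected_of_eventuallyEq
    (analyticOnNhd_orbitPoint hF' hB hw' k) hBc hz₁ (h.mono fun y hy => congrArg (· k) hy) hz

/-- `w` is a flat coordinate near `z₀` in which `g` is the homogeneous surface with initial
frame `F`. -/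
def IsOrbitCoordinateAt (F : Matrix (Fin 5) (Fin 5) ℝ) (c : ℝ) (g : ℂ → EuclideanSpace ℝ (Fin 4))
    (w : ℂ → ℂ) (z₀ : ℂ) : Prop :=
  ∀ᶠ z in 𝓝 z₀, DifferentiableAt ℂ w z ∧ deriv w z ^ 4 = quartic g z ∧
    g z = orbitPoint F c ((w z).re, (w z).im)

namespace IsSchwarzianPatch

variable {U : Set ℂ} {g : ℂ → EuclideanSpace ℝ (Fin 4)} (h : IsSchwarzianPatch U g)
include h

/-- On a disc without umbilics the surface is homogeneous. -/
theorem exists_orbit {x : ℂ} {r : ℝ} (hB : ball x r ⊆ U)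
    (h0 : ∀ z ∈ ball x r, _root_.quartic g z ≠ 0) {z₀ : ℂ} (hz₀ : z₀ ∈ ball x r) :
    ∃ (F : Matrix (Fin 5) (Fin 5) ℝ) (c a : ℝ) (w : ℂ → ℂ),
      F.transpose * lorentzMatrix * F = frameGram ∧ a ≠ 0 ∧
      (∀ i, F i 0 = a * euclideanLift (g z₀) i) ∧ DifferentiableOn ℂ w (ball x r) ∧
      ∀ z ∈ ball x r, deriv w z ^ 4 = _root_.quartic g z ∧
        g z = orbitPoint F c ((w z).re, (w z).im) := by
  obtain ⟨θ, w, c, hs, hθ4, hw, hQ, hfr⟩ := exists_flat_coordinate h.lift h.quartic hB h0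
  have hcol : ∀ z ∈ ball x r, ∀ i, realFrame θ (scaledLift θ g) z i 0 =
      (‖θ z‖ * ‖fderiv ℝ g z 1‖⁻¹) * euclideanLift (g z) i := by
    intro z hz i
    have h2 := hs.ofReal_realFrame hQ hz i 0
    change _ = scaledLift θ g z i at h2
    rw [scaledLift, Pi.smul_apply, normalizedLift, smul_eq_mul, ← ofReal_mul, ofReal_inj] at h2
    rw [h2, mul_assoc]
  have hne : ∀ z ∈ ball x r, ‖θ z‖ * ‖fderiv ℝ g z 1‖⁻¹ ≠ 0 := fun z hz =>
    mul_ne_zero (norm_ne_zero_iff.2 (hs.ne_zero z hz))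
      (inv_ne_zero (norm_ne_zero_iff.2 (fderiv_ne_zero_of_conformal (h.conformal z (hB hz)))))
  -- The flat coordinate is shifted to vanish at z₀. There the frame is F, and its first column is a
  -- multiple of the lift of g z₀.
  refine ⟨realFrame θ (scaledLift θ g) z₀, c, _, fun z => w z - w z₀, hs.realFrame_gram hQ hz₀,
    hne z₀ hz₀, hcol z₀ hz₀, fun z hz =>
      ((hw z hz).sub_const (w z₀)).differentiableAt.differentiableWithinAt, fun z hz => ⟨?_, ?_⟩⟩
  · rw [((hw z hz).sub_const (w z₀)).deriv, hθ4 z hz]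
  · rw [orbitPoint, orbitFrame, ← hfr z₀ hz₀ z hz]
    simp only [hcol z hz]
    exact ((lightConePoint_smul (hne z hz) (euclideanLift (g z))).trans
      (lightConePoint_euclideanLift _)).symm

/-- A homogeneous parametrization near one point of a disc without umbilics extends to
the disc. -/
theorem isOrbitCoordinateAt_extend {F : Matrix (Fin 5) (Fin 5) ℝ}
    (hF : F.transpose * lorentzMatrix * F = frameGram) {c : ℝ} {x : ℂ} {r : ℝ} (hB : ball x r ⊆ U)
    (h0 : ∀ z ∈ ball x r, _root_.quartic g z ≠ 0) {z₁ : ℂ} (hz₁ : z₁ ∈ ball x r) {w : ℂ → ℂ}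
    (hw : IsOrbitCoordinateAt F c g w z₁) :
    ∃ W : ℂ → ℂ, ∀ z ∈ ball x r, IsOrbitCoordinateAt F c g W z := by
  obtain ⟨F', c', -, w', hF', -, -, hw', hg'⟩ := h.exists_orbit hB h0 hz₁
  have hd' : ∀ z ∈ ball x r, DifferentiableAt ℂ w' z := fun z hz =>
    hw'.differentiableAt (isOpen_ball.mem_nhds hz)
  have hne' : ∀ z ∈ ball x r, deriv w' z ≠ 0 := by
    intro z hz h1
    apply h0 z hz
    rw [← (hg' z hz).1, h1]; simp
  obtain ⟨ε, hε, hsub⟩ := Metric.nhds_basis_ball.mem_iff.1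
    (Filter.inter_mem (isOpen_ball.mem_nhds hz₁) hw)
  have hsB : ball z₁ ε ⊆ ball x r := fun z hz => (hsub hz).1
  have hd : ∀ z ∈ ball z₁ ε, DifferentiableAt ℂ w z := fun z hz => (hsub hz).2.1
  have hwd : DifferentiableOn ℂ w (ball z₁ ε) := fun z hz => (hd z hz).differentiableWithinAt
  have hm : z₁ ∈ ball z₁ ε := mem_ball_self hε
  -- The derivatives of w and w' are fourth roots of the same function, so their ratio is a fourth
  -- root of unity and constant on the small ball. Hence w = j w' + const there, and the right side
  -- is defined on the whole disc.
  set j : ℂ := deriv w z₁ / deriv w' z₁ with hj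
  have hq : ∀ z ∈ ball z₁ ε, (deriv w z / deriv w' z) ^ 4 = 1 := by
    intro z hz
    rw [div_pow, (hsub hz).2.2.1, (hg' z (hsB hz)).1, div_self (h0 z (hsB hz))]
  have hqd : DifferentiableOn ℂ (fun z => deriv w z / deriv w' z) (ball z₁ ε) :=
    (hwd.deriv isOpen_ball).div ((hw'.deriv isOpen_ball).mono hsB) fun z hz => hne' z (hsB hz)
  have hjc : ∀ z ∈ ball z₁ ε, deriv w z / deriv w' z = j := by
    intro z hz
    refine isOpen_ball.is_const_of_deriv_eq_zero (convex_ball z₁ ε).isPreconnected hqd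
      (fun y hy => ?_) hz hm
    have h1 := (hqd.differentiableAt (isOpen_ball.mem_nhds hy)).hasDerivAt.pow 4
    have h2 : (fun z => deriv w z / deriv w' z) ^ 4 =ᶠ[𝓝 y] fun _ => 1 :=
      eventually_of_mem (isOpen_ball.mem_nhds hy) hq
    have h3 := h1.deriv
    rw [h2.deriv_eq, deriv_const] at h3
    have h4 : deriv w y / deriv w' y ≠ 0 := by
      intro h5
      have := hq y hy
      rw [h5] at this
      norm_num at this
    have h5 := (mul_eq_zero.1 h3.symm).resolve_left
      (mul_ne_zero (by norm_num) (pow_ne_zero _ h4))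
    exact h5
  have hlin : ∀ z ∈ ball z₁ ε, w z - j * w' z = w z₁ - j * w' z₁ := by
    intro z hz
    refine isOpen_ball.is_const_of_deriv_eq_zero (f := fun z => w z - j * w' z)
      (convex_ball z₁ ε).isPreconnected
      (hwd.sub ((hw'.mono hsB).const_mul j)) (fun y hy => ?_) hz hm
    have h1 := (hd y hy).hasDerivAt.sub ((hd' y (hsB hy)).hasDerivAt.const_mul j)
    refine h1.deriv.trans ?_
    rw [← hjc y hy, div_mul_cancel₀ _ (hne' y (hsB hy)), sub_self]
    rfl
  set W : ℂ → ℂ := fun z => j * w' z + (w z₁ - j * w' z₁) with hW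
  have hWd : DifferentiableOn ℂ W (ball x r) := (hw'.const_mul j).add_const _
  have hWw : ∀ z ∈ ball z₁ ε, W z = w z := fun z hz => by
    rw [hW]; linear_combination -hlin z hz
  have hall : ∀ z ∈ ball x r, DifferentiableAt ℂ W z ∧ deriv W z ^ 4 = _root_.quartic g z ∧
      g z = orbitPoint F c ((W z).re, (W z).im) := by
    intro z hz
    refine ⟨hWd.differentiableAt (isOpen_ball.mem_nhds hz), ?_, ?_⟩
    · have h1 : deriv W z = j * deriv w' z :=
        (((hd' z hz).hasDerivAt.const_mul j).add_const (w z₁ - j * w' z₁)).deriv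
      rw [h1, mul_pow, (hg' z hz).1, hj, hq z₁ hm, one_mul]
    · rw [(hg' z hz).2]
      -- Both orbits parametrize g near z₁, so they agree near z₁ and, by analyticity, on the disc.
      -- This keeps the given F and c in place of the local F' and c'.
      refine orbitPoint_eqOn hF' hF isOpen_ball (convex_ball x r).isPreconnected hw' hWd hz₁ ?_ hz
      filter_upwards [ball_mem_nhds z₁ hε] with y hy
      rw [← (hg' y (hsB hy)).2, hWw y hy, (hsub hy).2.2.2]
  exact ⟨W, fun z hz => eventually_of_mem (isOpen_ball.mem_nhds hz) hall⟩

theorem isOrbitCoordinateAt_transition {F : Matrix (Fin 5) (Fin 5) ℝ} {c : ℝ} {V : Set ℂ}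
    {ζ : ℂ → ℂ} {g' : ℂ → EuclideanSpace ℝ (Fin 4)}
    (hV : IsOpen V) (hζ : DifferentiableOn ℂ ζ V) (hζ0 : ∀ z ∈ V, deriv ζ z ≠ 0)
    (hVU : MapsTo ζ V U) (hg : ∀ z ∈ V, g' z = g (ζ z)) {z : ℂ} (hz : z ∈ V) {w : ℂ → ℂ}
    (hw : IsOrbitCoordinateAt F c g w (ζ z)) :
    IsOrbitCoordinateAt F c g' (fun y => w (ζ y)) z := by
  have hd {y} (hy : y ∈ V) := hζ.differentiableAt (hV.mem_nhds hy)
  filter_upwards [(hd hz).continuousAt.eventually hw, hV.mem_nhds hz] with y hy hyV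
  have h1 := hy.1.hasDerivAt.comp y (hd hyV).hasDerivAt
  have h2 : deriv (fun y => w (ζ y)) y = deriv w (ζ y) * deriv ζ y := h1.deriv
  refine ⟨h1.differentiableAt, ?_, by rw [hg y hyV, hy.2.2]⟩
  rw [h2, mul_pow, hy.2.1, h.quartic_transition hV hζ hζ0 hVU hg hyV, mul_comm]

end IsSchwarzianPatch

/-- The fourth power of the derivative of w is the quartic differential, so w is locally invertible
away from zeros. This makes the parameter set of the orbit open. -/
theorem IsOrbitCoordinateAt.map_nhds {F : Matrix (Fin 5) (Fin 5) ℝ} {c : ℝ}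
    {g : ℂ → EuclideanSpace ℝ (Fin 4)} {w : ℂ → ℂ} {z₀ : ℂ} (hw : IsOrbitCoordinateAt F c g w z₀)
    (h0 : quartic g z₀ ≠ 0) : map w (𝓝 z₀) = 𝓝 (w z₀) := by
  have h1 : deriv w z₀ ≠ 0 := by
    intro h1
    apply h0
    rw [← hw.self_of_nhds.2.1, h1]; simp
  have h2 : AnalyticAt ℂ w z₀ :=
    Complex.analyticAt_iff_eventually_differentiableAt.2 (hw.mono fun _ hz => hz.1)
  exact h2.hasStrictDerivAt.map_nhds_eq h1

/-! ### From patches to the connected Riemann surface -/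

section Surface

variable {M : Type*} [TopologicalSpace M] [ChartedSpace ℂ M] [IsManifold 𝓘(ℂ, ℂ) ω M]

variable (M) in
/-- A Riemann surface is a smooth surface. -/
theorem isManifold_real : IsManifold 𝓘(ℝ, ℂ) ∞ M := by
  refine isManifold_of_contDiffOn 𝓘(ℝ, ℂ) ∞ M fun e e' he he' => ?_
  have h1 := (contDiffGroupoid ω 𝓘(ℂ, ℂ)).compatible he he'
  have h2 := (mem_groupoid_of_pregroupoid.1 h1).1
  have h3 : ContDiffOn ℂ ω (e.symm ≫ₕ e') (e.symm ≫ₕ e').source := by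
    simpa [contDiffPregroupoid] using h2
  simpa using (h3.of_le le_top).restrict_scalars ℝ

theorem differentiableOn_chart_transition (p q : M) :
    DifferentiableOn ℂ ((chartAt ℂ q).symm ≫ₕ chartAt ℂ p)
      ((chartAt ℂ q).symm ≫ₕ chartAt ℂ p).source := by
  have h1 : ContMDiffOn 𝓘(ℂ, ℂ) 𝓘(ℂ, ℂ) ω ((chartAt ℂ q).symm ≫ₕ chartAt ℂ p)
      ((chartAt ℂ q).symm ≫ₕ chartAt ℂ p).source := by
    rw [OpenPartialHomeomorph.trans_source]
    exact contMDiffOn_chart.comp' contMDiffOn_chart_symm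
  exact (contMDiffOn_iff_contDiffOn.1 h1).differentiableOn (by simp)

theorem deriv_chart_transition_ne_zero (p q : M) {z : ℂ}
    (hz : z ∈ ((chartAt ℂ q).symm ≫ₕ chartAt ℂ p).source) :
    deriv ((chartAt ℂ q).symm ≫ₕ chartAt ℂ p) z ≠ 0 := by
  set T := (chartAt ℂ q).symm ≫ₕ chartAt ℂ p with hT
  have hTs : T.symm = (chartAt ℂ p).symm ≫ₕ chartAt ℂ q := by
    rw [hT, OpenPartialHomeomorph.trans_symm_eq_symm_trans_symm, OpenPartialHomeomorph.symm_symm]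
  have h1 := ((differentiableOn_chart_transition p q).differentiableAt
    (T.open_source.mem_nhds hz)).hasDerivAt
  have h2 : DifferentiableAt ℂ T.symm (T z) := by
    have h3 := differentiableOn_chart_transition q p
    rw [← hTs] at h3
    exact h3.differentiableAt (T.symm.open_source.mem_nhds (T.map_source hz))
  have h3 := h2.hasDerivAt.comp z h1
  have h4 : T.symm ∘ T =ᶠ[𝓝 z] id :=
    eventually_of_mem (T.open_source.mem_nhds hz) fun y hy => T.left_inv hy
  have h5 := h4.deriv_eq
  rw [h3.deriv, deriv_id] at h5
  exact right_ne_zero_of_mul_eq_one h5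

theorem isSchwarzianPatch {f : M → S3} (hf : IsConformalImmersion f)
    (hc : HasHolomorphicSchwarzian f) (p : M) :
    IsSchwarzianPatch (chartAt ℂ p).target (inCoordinate f (chartAt ℂ p)) := by
  have := isManifold_real M
  set e := chartAt ℂ p with he
  have hem : e ∈ holomorphicCoordinates M := IsManifold.chart_mem_maximalAtlas p
  have hs : ContDiffOn ℝ ∞ (inCoordinate f e) e.target := by
    rw [← contMDiffOn_iff_contDiffOn]
    have : Fact (Module.finrank ℝ (EuclideanSpace ℝ (Fin 4)) = 3 + 1) := ⟨by simp⟩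
    exact ((contMDiff_coe_sphere (n := 3) (E := EuclideanSpace ℝ (Fin 4))).comp hf.1).comp_contMDiffOn contMDiffOn_chart_symm
  have hl := isNormalizedLift_normalizedLift e.open_target hs (hf.2 e hem)
    fun z _ => by simp [inCoordinate]
  obtain ⟨c, hS, hcd⟩ := hc e hem
  refine ⟨hl, hf.2 e hem, differentiableOn_quartic hl hS hcd, fun z hz => ?_⟩
  rw [wdb_congr hl.isOpen (fun z hz => liftSchwarzian_eq_of_isSchwarzianOn hl hS hz) hz, wdb_one,
    dzbar_of_holomorphic (hcd.differentiableAt (hl.isOpen.mem_nhds hz))]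

omit [IsManifold 𝓘(ℂ, ℂ) ω M] in
/-- Every point has a disc in the chart at this point as a neighbourhood. -/
theorem exists_chart_ball (p : M) :
    ∃ r, 0 < r ∧ ball (chartAt ℂ p p) r ⊆ (chartAt ℂ p).target ∧
      ∀ᶠ q in 𝓝 p, q ∈ (chartAt ℂ p).source ∧ chartAt ℂ p q ∈ ball (chartAt ℂ p p) r := by
  obtain ⟨r, hr, hsub⟩ := Metric.nhds_basis_ball.mem_iff.1 (chart_target_mem_nhds ℂ p)
  exact ⟨r, hr, hsub, Filter.inter_mem (chart_source_mem_nhds ℂ p)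
    (((chartAt ℂ p).continuousAt (mem_chart_source ℂ p)).eventually (ball_mem_nhds _ hr))⟩

omit [ChartedSpace ℂ M] [IsManifold 𝓘(ℂ, ℂ) ω M] in
/-- An open and closed property that holds somewhere holds everywhere. -/
theorem forall_of_local [ConnectedSpace M] {P : M → Prop} (hopen : ∀ p, P p → ∀ᶠ q in 𝓝 p, P q)
    (hclosed : ∀ p, (∃ᶠ q in 𝓝 p, P q) → P p) {p₀ : M} (h₀ : P p₀) (p : M) : P p := by
  have h1 : IsClopen {p | P p} := by
    refine ⟨isClosed_of_closure_subset fun p hp => hclosed p (mem_closure_iff_frequently.1 hp),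
      isOpen_iff_mem_nhds.2 hopen⟩
  have h2 := h1.eq_univ ⟨p₀, h₀⟩
  exact (h2 ▸ mem_univ p : p ∈ {p | P p})

omit [IsManifold 𝓘(ℂ, ℂ) ω M] in
theorem inCoordinate_chart_apply (f : M → S3) {p q : M} (hq : q ∈ (chartAt ℂ p).source) :
    inCoordinate f (chartAt ℂ p) (chartAt ℂ p q) = f q := by
  rw [inCoordinate, (chartAt ℂ p).left_inv hq]

/-- A surface that lies locally in a 2-sphere lies globally in it. -/
theorem range_subset_twoSphere [ConnectedSpace M] {f : M → S3} (hf : IsConformalImmersion f)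
    (hc : HasHolomorphicSchwarzian f) {n : Fin 5 → ℝ} (hn : n ≠ 0) {p₀ : M}
    (h₀ : ∀ᶠ q in 𝓝 p₀, lorentz n (euclideanLift (f q)) = 0) (p : M) :
    lorentz n (euclideanLift (f p)) = 0 := by
  suffices h : ∀ᶠ q in 𝓝 p, lorentz n (euclideanLift (f q)) = 0 from h.self_of_nhds
  refine forall_of_local (P := fun p => ∀ᶠ q in 𝓝 p, lorentz n (euclideanLift (f q)) = 0)
    (fun p hp => eventually_eventually_nhds.2 hp) (fun p hp => ?_) h₀ p
  obtain ⟨r, hr, hB, hev⟩ := exists_chart_ball p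
  -- A point q of the disc about p near which the surface lies in the sphere suffices: the sphere
  -- condition spreads from q over the disc.
  obtain ⟨q, hq, hqs, hqB⟩ := (hp.and_eventually hev).exists
  have hq' : ∀ᶠ z in 𝓝 (chartAt ℂ p q),
      lorentz n (euclideanLift (inCoordinate f (chartAt ℂ p) z)) = 0 := by
    have h1 := (chartAt ℂ p).continuousAt_symm ((chartAt ℂ p).map_source hqs)
    rw [ContinuousAt, (chartAt ℂ p).left_inv hqs] at h1
    exact h1.eventually hq
  filter_upwards [hev] with y hy
  have := (isSchwarzianPatch hf hc p).eqOn_twoSphere hn hB hqB hq' hy.2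
  rwa [inCoordinate_chart_apply f hy.1] at this

/-- A surface that is not contained in a 2-sphere has no umbilics. -/
theorem quartic_inCoordinate_ne_zero [ConnectedSpace M] {f : M → S3}
    (hf : IsConformalImmersion f) (hc : HasHolomorphicSchwarzian f)
    (hns : ∀ S : Set S3, IsTwoSphere S → ¬ range f ⊆ S) (p : M) {z : ℂ}
    (hz : z ∈ (chartAt ℂ p).target) : quartic (inCoordinate f (chartAt ℂ p)) z ≠ 0 := by
  have hP := isSchwarzianPatch hf hc p
  -- Only vanishing on a whole neighbourhood remains to be excluded; it would put the surface into a
  -- 2-sphere.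
  refine quartic_ne_zero hP.lift hP.quartic hz fun h0 => ?_
  obtain ⟨n, hn, hnz⟩ := hP.exists_twoSphere hz h0
  have hn0 : n ≠ 0 := by
    rintro rfl
    rw [lorentz_zero_left] at hn
    exact hn.false
  refine hns {x : S3 | lorentz n (euclideanLift x) = 0} ⟨n, hn, rfl⟩ ?_
  rintro _ ⟨q, rfl⟩
  have hs := (chartAt ℂ p).map_target hz
  refine range_subset_twoSphere hf hc hn0 (p₀ := (chartAt ℂ p).symm z) ?_ q
  have h1 := (chartAt ℂ p).continuousAt hs
  rw [ContinuousAt, (chartAt ℂ p).right_inv hz] at h1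
  filter_upwards [h1.eventually hnz, (chartAt ℂ p).open_source.mem_nhds hs] with y hy hys
  rwa [inCoordinate_chart_apply f hys] at hy

/-- Near `p` the surface is a piece of the homogeneous surface with initial frame `F`. -/
def IsOrbitNear (F : Matrix (Fin 5) (Fin 5) ℝ) (c : ℝ) (f : M → S3) (p : M) : Prop :=
  ∃ (p' : M) (w : ℂ → ℂ), p ∈ (chartAt ℂ p').source ∧
    IsOrbitCoordinateAt F c (inCoordinate f (chartAt ℂ p')) w (chartAt ℂ p' p)

theorem IsOrbitNear.exists_coordinate {f : M → S3} (hf : IsConformalImmersion f)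
    (hc : HasHolomorphicSchwarzian f) {F : Matrix (Fin 5) (Fin 5) ℝ} {c : ℝ} {p q : M}
    (h : IsOrbitNear F c f q) (hq : q ∈ (chartAt ℂ p).source) : ∃ w : ℂ → ℂ,
      IsOrbitCoordinateAt F c (inCoordinate f (chartAt ℂ p)) w (chartAt ℂ p q) := by
  obtain ⟨p', w, hp', hw⟩ := h
  have hz : chartAt ℂ p q ∈ ((chartAt ℂ p).symm ≫ₕ chartAt ℂ p').source := by
    simp [hq, hp']
  refine ⟨_, (isSchwarzianPatch hf hc p').isOrbitCoordinateAt_transition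
    ((chartAt ℂ p).symm ≫ₕ chartAt ℂ p').open_source
    (differentiableOn_chart_transition p' p)
    (fun z hz => deriv_chart_transition_ne_zero p' p hz) (fun z hz => ?_) (fun z hz => ?_) hz
    (w := w) ?_⟩
  · have := ((chartAt ℂ p).symm ≫ₕ chartAt ℂ p').map_source hz
    rw [OpenPartialHomeomorph.trans_target] at this
    exact this.1
  · rw [OpenPartialHomeomorph.trans_source] at hz
    simp only [OpenPartialHomeomorph.coe_trans, Function.comp_apply]
    rw [inCoordinate_chart_apply f hz.2, inCoordinate]
  · simpa [(chartAt ℂ p).left_inv hq] using hw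

/-- For fixed F and c the property is open and closed. Closedness comes from extending a flat
coordinate over the disc of a chart, where the absence of zeros is essential. So a single orbit
serves the entire surface. -/
theorem isOrbitNear_of_isConformalImmersion [ConnectedSpace M] {f : M → S3}
    (hf : IsConformalImmersion f) (hc : HasHolomorphicSchwarzian f)
    (hns : ∀ S : Set S3, IsTwoSphere S → ¬ range f ⊆ S) {F : Matrix (Fin 5) (Fin 5) ℝ}
    (hF : F.transpose * lorentzMatrix * F = frameGram) {c : ℝ} {p₀ : M}
    (h₀ : IsOrbitNear F c f p₀) (p : M) : IsOrbitNear F c f p := by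
  refine forall_of_local (fun p hp => ?_) (fun p hp => ?_) h₀ p
  · obtain ⟨p', w, hp', hw⟩ := hp
    have h1 := ((chartAt ℂ p').continuousAt hp').eventually (eventually_eventually_nhds.2 hw)
    filter_upwards [h1, (chartAt ℂ p').open_source.mem_nhds hp'] with q hq hqs
    exact ⟨p', w, hqs, hq⟩
  · obtain ⟨r, hr, hB, hev⟩ := exists_chart_ball p
    obtain ⟨q, hq, hqs, hqB⟩ := (hp.and_eventually hev).exists
    obtain ⟨w, hw⟩ := hq.exists_coordinate hf hc hqs
    obtain ⟨W, hW⟩ := (isSchwarzianPatch hf hc p).isOrbitCoordinateAt_extend hF hB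
      (fun z hz => quartic_inCoordinate_ne_zero hf hc hns p (hB hz)) hqB hw
    exact ⟨p, W, mem_chart_source ℂ p, hW _ (mem_ball_self hr)⟩

end Surface

end

/-! ### Proof of the theorem -/

theorem mainTheorem2 {M : Type*} [TopologicalSpace M] [T2Space M] [ConnectedSpace M]
    [ChartedSpace ℂ M] [IsManifold 𝓘(ℂ, ℂ) ω M]
    (f : M → S3) (hf : IsConformalImmersion f)
    (hns : ∀ S : Set S3, IsTwoSphere S → ¬ Set.range f ⊆ S)
    (hc : HasHolomorphicSchwarzian f) :
    IsCyclideOfDupin f := by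
  obtain ⟨p₀⟩ := (inferInstance : Nonempty M)
  obtain ⟨r, hr, hB, -⟩ := exists_chart_ball p₀
  have hm : chartAt ℂ p₀ p₀ ∈ Metric.ball (chartAt ℂ p₀ p₀) r := Metric.mem_ball_self hr
  obtain ⟨F, c, a, w, hF, ha, hx, hw, hg⟩ := (isSchwarzianPatch hf hc p₀).exists_orbit hB
    (fun z hz => quartic_inCoordinate_ne_zero hf hc hns p₀ (hB hz)) hm
  rw [inCoordinate_chart_apply f (mem_chart_source ℂ p₀)] at hx
  have h₀ : IsOrbitNear F c f p₀ := ⟨p₀, w, mem_chart_source ℂ p₀,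
    Filter.eventually_of_mem (Metric.isOpen_ball.mem_nhds hm) fun z hz =>
      ⟨hw.differentiableAt (Metric.isOpen_ball.mem_nhds hz), hg z hz⟩⟩
  have hall := isOrbitNear_of_isConformalImmersion hf hc hns hF h₀
  have horb := orbitMap_eq_orbitPoint hF c ha hx
  -- The generators are `curvatureLineS c` and `curvatureLineT c` conjugated by the frame at p₀. The
  -- parameter set collects the values of all admissible flat coordinates at all points, as no
  -- single-valued flat coordinate on M is available.
  refine ⟨_, _, isInfinitesimalLorentz_of_transpose (skew_conj hF (curvatureLineS_skew c)),
    isInfinitesimalLorentz_of_transpose (skew_conj hF (curvatureLineT_skew c)),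
    commute_conj (isUnit_of_frameGram hF) (commute_curvatureLine c), f p₀, ?_,
    {q | ∃ (p p' : M) (w : ℂ → ℂ), p ∈ (chartAt ℂ p').source ∧
      IsOrbitCoordinateAt F c (inCoordinate f (chartAt ℂ p')) w (chartAt ℂ p' p) ∧
      w (chartAt ℂ p' p) = Complex.equivRealProdCLM.symm q}, ?_, ?_⟩
  · rw [horb]
    exact fderiv_orbitPoint_injective hF c
  · rw [isOpen_iff_mem_nhds]
    rintro q ⟨p, p', w, hp, hw, hwq⟩
    have hz := (chartAt ℂ p').map_source hp
    have h1 : ∀ᶠ z in nhds (chartAt ℂ p' p), z ∈ (chartAt ℂ p').target ∧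
        IsOrbitCoordinateAt F c (inCoordinate f (chartAt ℂ p')) w z :=
      Filter.inter_mem ((chartAt ℂ p').open_target.mem_nhds hz) (eventually_eventually_nhds.2 hw)
    have h2 := Filter.image_mem_map (m := w) h1
    -- The flat coordinate w maps neighbourhoods onto neighbourhoods, and it remains admissible at
    -- nearby points, so parameters close to q are values of the same w.
    rw [hw.map_nhds (quartic_inCoordinate_ne_zero hf hc hns p' hz), hwq] at h2
    filter_upwards [Complex.equivRealProdCLM.symm.continuous.continuousAt.preimage_mem_nhds h2]
    rintro q' ⟨z, ⟨hzt, hzw⟩, hzq⟩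
    refine ⟨(chartAt ℂ p').symm z, p', w, (chartAt ℂ p').map_target hzt, ?_⟩
    rw [(chartAt ℂ p').right_inv hzt]
    exact ⟨hzw, hzq⟩
  · have key {p p' : M} {w : ℂ → ℂ} (hp : p ∈ (chartAt ℂ p').source)
        (hw : IsOrbitCoordinateAt F c (inCoordinate f (chartAt ℂ p')) w (chartAt ℂ p' p)) :
        (f p : EuclideanSpace ℝ (Fin 4)) =
          orbitPoint F c (Complex.equivRealProdCLM (w (chartAt ℂ p' p))) := by
      rw [← inCoordinate_chart_apply f hp]
      exact hw.self_of_nhds.2.2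
    rw [horb]
    ext y
    constructor
    · rintro ⟨p, rfl⟩
      obtain ⟨p', w, hp, hw⟩ := hall p
      exact ⟨_, ⟨p, p', w, hp, hw, (ContinuousLinearEquiv.symm_apply_apply _ _).symm⟩,
        (key hp hw).symm⟩
    · rintro ⟨q, ⟨p, p', w, hp, hw, hwq⟩, rfl⟩
      refine ⟨p, ?_⟩
      simp only
      rw [key hp hw, hwq, ContinuousLinearEquiv.apply_symm_apply]
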